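/- Fix an integer $N\ge 1$. Let $\mathfrak A$ be the quasi-local (UHF) $C^*$-algebra of the chain $\mathbb Z$ with on-site algebra $M_N(\mathbb C)$, i.e. the norm closure of the union of the local algebras $\mathfrak A_{[x,y]}=\bigotimes_{z=x}^{y}M_N(\mathbb C)$; let $\eta_x$ denote translation by $x$, write $a_x=\eta_x(a)$, and let $\omega$ be the tracial (infinite-temperature) state on $\mathfrak A$. Let $h=h^*\in\mathfrak A_{[0,d_h-1]}$ be an interaction and, for a finite interval $\Lambda=[a,b]$, put $H_\Lambda=\sum_{x=a}^{b-d_h+1}h_x$ and $\tau^\Lambda_t(A)=e^{itH_\Lambda}Ae^{-itH_\Lambda}$. Let $j=j^*\in\mathfrak A_{[0,d_j-1]}$ be a current density with $\omega(j)=0$, let $\Lambda_n=[1,n]$ and $J_{\Lambda_n}=\sum_{x=1}^{n-d_j+1}j_x$. Let $Q_{\Lambda_n}=Q_{\Lambda_n}^*\in\mathfrak A_{[1,n]}$ $(n\ge 0)$ be almost conserved: there are $d_b$ and a local operator $b\in\mathfrak A_{[0,d_b-1]}$, independent of $n$, with $$[H_{\Lambda_n},Q_{\Lambda_n}]=b_1-b_{n-d_b+1}\qquad\text{for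 all } n\ge d_b .$$ Let $\beta\ge 0$. Then: 1. For all $t\in\mathbb R$ and $A\in\mathfrak A$ the norm limit $\tau_t(A)=\lim_{\Lambda\to\mathbb Z}\tau_t^\Lambda(A)$ exists and lies in $\mathfrak A$. 2. For every $t$ the limit $$C(t)=\lim_{n\to\infty}\frac1n\,\omega\big(J_{\Lambda_n}\tau_t(J_{\Lambda_n})\big)=\sum_{x\in\mathbb Z}\omega\big(j_x\tau_t(j_0)\big)$$ exists and is real, $C$ is continuous, and the limit defining the high-temperature Drude weight (thermodynamic limit first, time limit second), $$D^{\rm th}_0=\lim_{t\to\infty}\frac{\beta}{2t}\int_0^t C(t')\,dt',$$ exists. 3. With the convention $0/0=0$, the sequence $\frac1n\,\omega(J_{\Lambda_n}Q_{\Lambda_n})^2/\omega(Q_{\Lambda_n}^2)$ is bounded above and $$D^{\rm th}_0\;\ge\;\frac{\beta}{2}\,\limsup_{n\to\infty}\frac1n\,\frac{\omega(J_{\Lambda_n}Q_{\Lambda_n})^2}{\omega(Q_{\Lambda_n}^2)} .$$ 4. Suppose moreover that $Q$ is pseudo-local: $Q_{\Lambda_n}=\sum_{d=1}^n\sum_{x=1}^{n-d+1}q^{(d)}_x$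 for all $n$, with $q^{(d)}=(q^{(d)})^*\in\mathfrak A_{[0,d-1]}$, $\omega(q^{(d)})=0$ and $\omega((q^{(d)})^2)\le\zeta e^{-\xi d}$ for constants $\zeta,\xi>0$. Then the limits $r=\lim_n\frac1n\omega(J_{\Lambda_n}Q_{\Lambda_n})$ and $\chi=\lim_n\frac1n\omega(Q_{\Lambda_n}^2)$ exist and are real, and if $\chi\ne 0$, then the sequence in 3 converges, to $r^2/\chi$, so that $$D^{\rm th}_0\;\ge\;\frac{\beta}{2}\,\lim_{n\to\infty}\frac1n\,\frac{\omega(J_{\Lambda_n}Q_{\Lambda_n})^2}{\omega(Q_{\Lambda_n}^2)} .$$ -/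

import Mathlib

open Filter Topology MeasureTheory
open scoped BigOperators

noncomputable section

namespace SpinChain

/-- Configurations of a chain of `N`-level systems, one on each site of `ℤ`. -/
abbrev Config (N : ℕ) : Type := ℤ → Fin N

/-- The Hilbert space with orthonormal basis indexed by all configurations. -/
abbrev Hil (N : ℕ) : Type := lp (fun _ : Config N => ℂ) 2

/-- Bounded operators on `Hil N`, a C*-algebra in which all observables live. -/
abbrev Op (N : ℕ) : Type := Hil N →L[ℂ] Hil N

/-- Matrices on `d` sites: the algebra `⊗^d M_N(ℂ)`. -/
abbrev LocalMatrix (N d : ℕ) : Type := Matrix (Fin d → Fin N) (Fin d → Fin N) ℂ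

/-- The restriction of a configuration to the sites `x, …, x + d - 1`. -/
def window {N : ℕ} (d : ℕ) (x : ℤ) (s : Config N) : Fin d → Fin N :=
  fun k => s (x + (k : ℕ))

/-- The configuration `s`, replaced by `v` on the sites `x, …, x + d - 1`. -/
def overwrite {N d : ℕ} (x : ℤ) (v : Fin d → Fin N) (s : Config N) : Config N :=
  fun i => if hi : 0 ≤ i - x ∧ i - x < d then v ⟨(i - x).toNat, by omega⟩ else s i

theorem overwrite_window_injective {N d : ℕ} (x : ℤ) (v : Fin d → Fin N) :
    Function.Injective fun s : Config N => (overwrite x v s, window d x s) := by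
  intro s s' hs
  simp only [Prod.mk.injEq] at hs
  funext i
  by_cases hi : 0 ≤ i - x ∧ i - x < d
  · have h2 := congrFun hs.2 ⟨(i - x).toNat, by omega⟩
    have h3 : x + (((i - x).toNat : ℕ) : ℤ) = i := by omega
    simpa only [window, h3] using h2
  · have h1 := congrFun hs.1 i
    simpa only [overwrite, dif_neg hi] using h1

theorem memℓp_overwrite {N d : ℕ} (x : ℤ) (v : Fin d → Fin N) (c : (Fin d → Fin N) → ℂ)
    (f : Hil N) :
    Memℓp (fun s : Config N => c (window d x s) * f (overwrite x v s)) 2 := by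
  have h2 : (0 : ℝ) < (2 : ENNReal).toReal := by norm_num
  refine memℓp_gen ?_
  have hf : Summable fun s : Config N => ‖f s‖ ^ (2 : ENNReal).toReal :=
    (memℓp_gen_iff h2).1 (lp.memℓp f)
  have hc : Summable fun w : Fin d → Fin N => ‖c w‖ ^ (2 : ENNReal).toReal :=
    (hasSum_fintype _).summable
  have hp := Summable.mul_of_nonneg hf hc (fun _ => by positivity) (fun _ => by positivity)
  have hq := hp.comp_injective (overwrite_window_injective x v)
  refine hq.congr fun s => ?_
  simp only [Function.comp]
  rw [norm_mul, Real.mul_rpow (norm_nonneg _) (norm_nonneg _), mul_comm]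

/-- The action of a `d`-site matrix on the sites `x, …, x + d - 1`, as a linear map. -/
def placeLin {N d : ℕ} (x : ℤ) (M : LocalMatrix N d) : Hil N →ₗ[ℂ] Hil N where
  toFun f := ∑ v : Fin d → Fin N,
    (⟨fun s => M (window d x s) v * f (overwrite x v s),
      memℓp_overwrite x v (fun w => M w v) f⟩ : Hil N)
  map_add' f g := by
    rw [← Finset.sum_add_distrib]
    refine Finset.sum_congr rfl fun v _ => ?_
    ext s
    simp only [lp.coeFn_add, Pi.add_apply, mul_add]
  map_smul' c f := by
    rw [RingHom.id_apply, Finset.smul_sum]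
    refine Finset.sum_congr rfl fun v _ => ?_
    ext s
    simp only [lp.coeFn_smul, Pi.smul_apply, smul_eq_mul, mul_left_comm]

theorem placeLin_apply {N d : ℕ} (x : ℤ) (M : LocalMatrix N d) (f : Hil N) (s : Config N) :
    placeLin x M f s = ∑ v : Fin d → Fin N, M (window d x s) v * f (overwrite x v s) := by
  change (⇑(∑ v : Fin d → Fin N, (_ : Hil N))) s = _
  rw [lp.coeFn_sum, Finset.sum_apply]

theorem continuous_coord {N : ℕ} (s : Config N) : Continuous fun f : Hil N => f s := by
  have h : LipschitzWith 1 fun f : Hil N => f s := by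
    refine LipschitzWith.of_dist_le_mul fun f g => ?_
    rw [dist_eq_norm, dist_eq_norm]
    have := lp.norm_apply_le_norm (p := 2) (by norm_num) (f - g) s
    simpa using this
  exact h.continuous

/-- The operator `η_x(M) = ⋯ ⊗ 1 ⊗ M ⊗ 1 ⊗ ⋯`, with the `d`-site matrix `M` acting on the sites
`x, …, x + d - 1`. -/
def place {N d : ℕ} (x : ℤ) (M : LocalMatrix N d) : Op N :=
  ContinuousLinearMap.ofSeqClosedGraph (g := placeLin x M) (by
    intro u f g hu hg
    ext s
    have h1 := ((continuous_coord s).tendsto g).comp hg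
    have h2 : Tendsto (fun n => placeLin x M (u n) s) atTop (𝓝 (placeLin x M f s)) := by
      simp only [placeLin_apply]
      exact tendsto_finsetSum _ fun v _ =>
        (((continuous_coord (overwrite x v s)).tendsto f).comp hu).const_mul _
    exact tendsto_nhds_unique h1 h2)

theorem place_apply {N d : ℕ} (x : ℤ) (M : LocalMatrix N d) (f : Hil N) (s : Config N) :
    place x M f s = ∑ v : Fin d → Fin N, M (window d x s) v * f (overwrite x v s) :=
  placeLin_apply x M f s

/-- The local algebra of the sites `x, …, x + d - 1`. -/
def localAlgebra (N : ℕ) (x : ℤ) (d : ℕ) : Set (Op N) :=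
  Set.range fun M : LocalMatrix N d => place x M

/-- The quasi-local UHF C*-algebra of the chain: the norm closure of the *-algebra of all local
observables. -/
def quasiLocalAlgebra (N : ℕ) : StarSubalgebra ℂ (Op N) :=
  (StarAlgebra.adjoin ℂ (⋃ (x : ℤ) (d : ℕ), localAlgebra N x d)).topologicalClosure

/-- The uniform product measure on configurations. -/
def uniformConfig (N : ℕ) [NeZero N] : Measure (Config N) :=
  Measure.infinitePi fun _ : ℤ => (PMF.uniformOfFintype (Fin N)).toMeasure

open Classical in
/-- The tracial (infinite-temperature) state `ω`: the average of the diagonal matrix elements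
`⟨s, A s⟩` over independent uniformly distributed sites. On a local observable it is the
normalized trace. -/
def tracialState {N : ℕ} [NeZero N] (A : Op N) : ℂ :=
  ∫ s, (A (lp.single 2 s (1 : ℂ))) s ∂(uniformConfig N)

/-- The homogeneous sum `∑_x η_x(M)` over all translates of the `d`-site matrix `M` inside the
interval `[a, b]`. -/
def homogeneousSum {N d : ℕ} (M : LocalMatrix N d) (a b : ℤ) : Op N :=
  ∑ x ∈ Finset.Icc a (b - d + 1), place x M

/-- Heisenberg evolution generated by the Hamiltonian of the finite chain `[a, b]` with
interaction `h`. -/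
def finiteEvolution {N d : ℕ} (h : LocalMatrix N d) (a b : ℤ) (t : ℝ) (A : Op N) : Op N :=
  NormedSpace.exp ((Complex.I * t) • homogeneousSum h a b) * A *
    NormedSpace.exp (-(Complex.I * t) • homogeneousSum h a b)

/-- Heisenberg evolution of the infinite chain: the norm limit of the evolutions of `[a, b]` as
`a → -∞` and `b → ∞`. -/
def evolution {N d : ℕ} (h : LocalMatrix N d) (t : ℝ) (A : Op N) : Op N :=
  limUnder (atBot ×ˢ atTop) fun p : ℤ × ℤ => finiteEvolution h p.1 p.2 t A

/-- `Q n` is almost conserved: its commutator with the Hamiltonian of `[1, n]` is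
`b_1 - b_{n - d_b + 1}` for a fixed local operator `b` on `d_b` sites. -/
def IsAlmostConserved {N d : ℕ} (h : LocalMatrix N d) (Q : ℕ → Op N) : Prop :=
  ∃ (db : ℕ) (b : LocalMatrix N db), ∀ n : ℕ, db ≤ n →
    homogeneousSum h 1 n * Q n - Q n * homogeneousSum h 1 n =
      place 1 b - place ((n : ℤ) - db + 1) b

/-- `Q n` is a translation-invariant sum of pseudo-local densities with exponentially decaying
Hilbert–Schmidt norms. -/
def IsPseudoLocal {N : ℕ} [NeZero N] (Q : ℕ → Op N) : Prop :=
  ∃ (q : ∀ d : ℕ, LocalMatrix N d) (ζ ξ : ℝ), 0 < ζ ∧ 0 < ξ ∧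
    (∀ d, 1 ≤ d → (q d).IsHermitian ∧ tracialState (place 0 (q d)) = 0 ∧
      (tracialState (place 0 (q d) * place 0 (q d))).re ≤ ζ * Real.exp (-ξ * d)) ∧
    ∀ n : ℕ, Q n = ∑ d ∈ Finset.Icc 1 n, homogeneousSum (q d) 1 n

/-- The quotient `(1/n) ω(J_n Q_n)² / ω(Q_n²)`; for self-adjoint `J_n`, `Q_n` both values of the
tracial state are real. -/
def mazurRatio {N d : ℕ} [NeZero N] (j : LocalMatrix N d) (Q : ℕ → Op N) (n : ℕ) : ℝ :=
  1 / n * ((tracialState (homogeneousSum j 1 n * Q n)).re ^ 2 / (tracialState (Q n * Q n)).re)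

end SpinChain

end

open SpinChain

noncomputable section

namespace SpinChain

/-! Three ingredients combine. The first is locality. The Lieb–Robinson bound
(`norm_heisenberg_sub_near_le`) says that the evolution of a local observable is exponentially close
to one generated by nearby interaction terms only, uniformly in the volume and for bounded times.
This gives the infinite-volume dynamics (`tendsto_finiteEvolution`). Since `ω` is a product state,
it also gives exponential decay of `ω(j_x τ_t(j_y))` in `|x - y|`
(`norm_traceFun_place_mul_heisenberg_le`). Dominated convergence over the distance `x - y`
(`tendsto_pair_average`) then identifies the limit per site, and it is the same `C(t)` whether the
current evolves under the infinite dynamics or under that of the chain `[1, n]`.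

The second is existence of the time limit, obtained without spectral theory. In finite volume put
`A_n(T) = ∫_0^T τ_s(J_n) ds`. Invariance and cyclicity of the trace give `‖A_n(T)‖² / n = ∬_{[0,T]²}
C_n(s' - s)`, with `‖·‖` the Hilbert–Schmidt norm of `ω` (`hsNorm_timeIntegral_sq`). As `A_n(S + T)
= A_n(S) + τ_S(A_n(T))` and the evolution preserves the norm, `‖A_n(T)‖` is subadditive in `T`. Let
`n → ∞`: the square root of `G(T) = ∬ C(s' - s)` is subadditive, so `G(T) / T²` converges to some
`D` by Fekete's lemma (`tendsto_squareIntegral_div_sq`). Finally `G(T) = 2 ∫_0^T F` with `F` the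
primitive of `C`. As `C` is bounded, `F` is Lipschitz, and a Tauberian argument upgrades the
convergence to `F(T) / T → D` (`tendsto_primitive_div`). The Drude weight is `β D / 2`.

The third is the Mazur bound, which is Cauchy–Schwarz for `A_n(T)` and `Q_n`. The derivative of
`ω(τ_s(J_n) Q_n)` is, up to a phase, `ω(τ_s(J_n) [H_n, Q_n])`. It is bounded in `n`, because a
boundary term made traceless overlaps only with nearby current densities. So `ω(A_n(T) Q_n) = T
ω(J_n Q_n) + O(1)`. The error must be small compared with `√n ‖Q_n‖`. It vanishes if the boundary
density `b` is zero; otherwise pairing `[H_n, Q_n]` with `b_1^*` shows that `‖Q_n‖` is bounded below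
(`exists_hsNorm_lower_bound`). Dividing by `√n ‖Q_n‖` and taking `n → ∞`, then `T → ∞`, bounds the
limsup by `D`. For pseudo-local `Q`, the pair-average theorem is applied once more, with the sizes
of the densities as an additional summation index.

The integral defining `tracialState` is well behaved only where the diagonal is integrable, so the
argument runs with `traceFun`, a Hahn–Banach extension that is linear and bounded on all operators
and agrees with `ω` on the quasi-local algebra. -/

open Classical in
/-- The basis vector of the configuration `s`. -/
def ket {N : ℕ} (s : Config N) : Hil N := lp.single 2 s (1 : ℂ)

theorem ket_apply {N : ℕ} (s s' : Config N) [Decidable (s' = s)] :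
    ket s s' = if s' = s then (1 : ℂ) else 0 := by
  classical
  rw [ket, lp.single_apply, Pi.single_apply]
  split_ifs <;> rfl

theorem inner_ket {N : ℕ} (s : Config N) (f : Hil N) : inner ℂ (ket s) f = f s := by
  classical
  rw [ket, lp.inner_single_left]
  simp

theorem norm_ket {N : ℕ} (s : Config N) : ‖ket s‖ = 1 := by
  classical
  rw [ket, lp.norm_single (by norm_num)]; simp

theorem tracialState_eq {N : ℕ} [NeZero N] (A : Op N) :
    tracialState A = ∫ s, (A (ket s)) s ∂(uniformConfig N) := rfl

/-! ### Combinatorics of reading and overwriting a window of a configuration. -/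

section Window

variable {N d d' : ℕ}

theorem overwrite_apply_of_mem (x : ℤ) (v : Fin d → Fin N) (s : Config N) {i : ℤ}
    (hi : 0 ≤ i - x ∧ i - x < d) : overwrite x v s i = v ⟨(i - x).toNat, by omega⟩ := dif_pos hi

theorem overwrite_apply_of_notMem (x : ℤ) (v : Fin d → Fin N) (s : Config N) {i : ℤ}
    (hi : ¬ (0 ≤ i - x ∧ i - x < d)) : overwrite x v s i = s i := dif_neg hi

theorem window_apply_toNat (x : ℤ) (s : Config N) {i : ℤ} (hi : 0 ≤ i - x ∧ i - x < d) :
    window d x s ⟨(i - x).toNat, by omega⟩ = s i := by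
  have : x + (((i - x).toNat : ℕ) : ℤ) = i := by omega
  simp only [window, this]

@[simp] theorem window_overwrite (x : ℤ) (v : Fin d → Fin N) (s : Config N) :
    window d x (overwrite x v s) = v := by
  funext k
  have hk := k.2
  rw [window, overwrite_apply_of_mem x v s (i := x + (k : ℕ)) (by omega)]
  congr 1
  ext
  simp

@[simp] theorem overwrite_window (x : ℤ) (s : Config N) : overwrite x (window d x s) s = s := by
  funext i
  by_cases hi : 0 ≤ i - x ∧ i - x < d
  · rw [overwrite_apply_of_mem _ _ _ hi, window_apply_toNat _ _ hi]
  · rw [overwrite_apply_of_notMem _ _ _ hi]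

@[simp] theorem overwrite_overwrite (x : ℤ) (u v : Fin d → Fin N) (s : Config N) :
    overwrite x u (overwrite x v s) = overwrite x u s := by
  funext i
  by_cases hi : 0 ≤ i - x ∧ i - x < d
  · simp only [overwrite_apply_of_mem _ _ _ hi]
  · simp only [overwrite_apply_of_notMem _ _ _ hi]

/-- The second condition encodes that `s` and `s'` agree off the window. Being independent of `v`,
it leaves at most one nonzero term in the sums for matrix elements between basis vectors. -/
theorem overwrite_eq_iff (x : ℤ) (v : Fin d → Fin N) (s s' : Config N) :
    overwrite x v s = s' ↔ v = window d x s' ∧ overwrite x (window d x s) s' = s := by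
  constructor
  · rintro rfl; simp
  · rintro ⟨rfl, h⟩; rw [← h]; simp

/-- Two windows without a common site. -/
def DisjointWindows (x : ℤ) (d : ℕ) (y : ℤ) (d' : ℕ) : Prop := x + d ≤ y ∨ y + d' ≤ x

theorem DisjointWindows.symm {x y : ℤ} (hxy : DisjointWindows x d y d') :
    DisjointWindows y d' x d := Or.symm hxy

theorem window_overwrite_of_disjoint {x y : ℤ} (hxy : DisjointWindows x d y d')
    (v : Fin d → Fin N) (s : Config N) : window d' y (overwrite x v s) = window d' y s := by
  funext k
  have hk := k.2
  unfold DisjointWindows at hxy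
  exact overwrite_apply_of_notMem x v s (by omega)

theorem overwrite_comm_of_disjoint {x y : ℤ} (hxy : DisjointWindows x d y d')
    (v : Fin d → Fin N) (u : Fin d' → Fin N) (s : Config N) :
    overwrite y u (overwrite x v s) = overwrite x v (overwrite y u s) := by
  unfold DisjointWindows at hxy
  funext i
  by_cases hi : 0 ≤ i - x ∧ i - x < d
  · have hi' : ¬ (0 ≤ i - y ∧ i - y < d') := by omega
    rw [overwrite_apply_of_notMem _ _ _ hi', overwrite_apply_of_mem _ _ _ hi,
      overwrite_apply_of_mem _ _ _ hi]
  · rw [overwrite_apply_of_notMem x _ _ hi]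
    by_cases hi' : 0 ≤ i - y ∧ i - y < d'
    · simp only [overwrite_apply_of_mem y _ _ hi']
    · simp only [overwrite_apply_of_notMem y _ _ hi', overwrite_apply_of_notMem x _ _ hi]

end Window

/-! ### Matrices acting on a window: algebra, adjoint, locality. -/

section Place

variable {N d d' : ℕ}

theorem op_ext {A B : Op N} (hAB : ∀ f s, A f s = B f s) : A = B :=
  ContinuousLinearMap.ext fun f => lp.ext (funext (hAB f))

theorem place_add (x : ℤ) (M M' : LocalMatrix N d) : place x (M + M') = place x M + place x M' := by
  refine op_ext fun f s => ?_
  rw [add_apply, lp.coeFn_add, Pi.add_apply]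
  simp only [place_apply, Matrix.add_apply, add_mul, Finset.sum_add_distrib]

theorem place_smul (x : ℤ) (c : ℂ) (M : LocalMatrix N d) : place x (c • M) = c • place x M := by
  refine op_ext fun f s => ?_
  rw [smul_apply, lp.coeFn_smul, Pi.smul_apply]
  simp only [place_apply, Matrix.smul_apply, smul_eq_mul, mul_assoc, Finset.mul_sum]

theorem place_mul (x : ℤ) (M M' : LocalMatrix N d) : place x (M * M') = place x M * place x M' := by
  refine op_ext fun f s => ?_
  rw [mul_apply_eq_comp]
  simp only [place_apply, Matrix.mul_apply, window_overwrite, overwrite_overwrite, Finset.sum_mul,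
    Finset.mul_sum]
  rw [Finset.sum_comm]
  simp only [mul_assoc]

theorem place_one (x : ℤ) : place x (1 : LocalMatrix N d) = 1 := by
  classical
  refine op_ext fun f s => ?_
  rw [place_apply, one_apply_eq_self, Finset.sum_eq_single (window d x s)]
  · simp
  · intro v _ hv
    rw [Matrix.one_apply_ne hv.symm, zero_mul]
  · simp

/-- Placing matrices on the sites `x, …, x + d - 1`, as a homomorphism of algebras. -/
def placeHom (N d : ℕ) (x : ℤ) : LocalMatrix N d →ₐ[ℂ] Op N :=
  AlgHom.ofLinearMap ⟨⟨place x, place_add x⟩, place_smul x⟩ (place_one x) (place_mul x)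

theorem place_zero (x : ℤ) : place x (0 : LocalMatrix N d) = 0 := map_zero (placeHom N d x)

theorem place_neg (x : ℤ) (M : LocalMatrix N d) : place x (-M) = -place x M :=
  map_neg (placeHom N d x) M

theorem place_sub (x : ℤ) (M M' : LocalMatrix N d) : place x (M - M') = place x M - place x M' :=
  map_sub (placeHom N d x) M M'

theorem place_ket_apply (x : ℤ) (M : LocalMatrix N d) (s s' : Config N)
    [Decidable (overwrite x (window d x s') s = s')] :
    place x M (ket s) s' =
      if overwrite x (window d x s') s = s' then M (window d x s') (window d x s) else 0 := by
  classical
  rw [place_apply]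
  split_ifs with hs
  · rw [Finset.sum_eq_single (window d x s)]
    · rw [ket_apply, if_pos ((overwrite_eq_iff x _ s' s).2 ⟨rfl, hs⟩), mul_one]
    · intro v _ hv
      rw [ket_apply, if_neg fun h => hv ((overwrite_eq_iff x _ s' s).1 h).1, mul_zero]
    · simp
  · refine Finset.sum_eq_zero fun v _ => ?_
    rw [ket_apply, if_neg fun h => hs ((overwrite_eq_iff x _ s' s).1 h).2, mul_zero]

theorem place_ket (x : ℤ) (M : LocalMatrix N d) (s : Config N) :
    place x M (ket s) = ∑ v, M v (window d x s) • ket (overwrite x v s) := by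
  classical
  refine lp.ext (funext fun s' => ?_)
  rw [place_ket_apply, lp.coeFn_sum, Finset.sum_apply]
  simp only [lp.coeFn_smul, Pi.smul_apply, ket_apply, smul_eq_mul, mul_ite, mul_one, mul_zero]
  split_ifs with hs
  · rw [Finset.sum_eq_single (window d x s')]
    · rw [if_pos hs.symm]
    · intro v _ hv
      rw [if_neg fun h => hv ((overwrite_eq_iff x _ s s').1 h.symm).1]
    · simp
  · refine (Finset.sum_eq_zero fun v _ => if_neg fun h => hs ?_).symm
    exact (overwrite_eq_iff x _ s s').2 ⟨rfl, ((overwrite_eq_iff x _ s s').1 h.symm).2⟩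

/-- A coordinate is an inner product with a basis vector, so the adjoint can be moved onto that
vector, where `place_ket` expands it in a column of `M`. -/
theorem star_place (x : ℤ) (M : LocalMatrix N d) : star (place x M) = place x M.conjTranspose := by
  refine op_ext fun f s => ?_
  rw [ContinuousLinearMap.star_eq_adjoint, ← inner_ket, ContinuousLinearMap.adjoint_inner_right,
    place_ket, sum_inner, place_apply]
  refine Finset.sum_congr rfl fun v _ => ?_
  rw [inner_smul_left, inner_ket]
  rfl

theorem isSelfAdjoint_place (x : ℤ) {M : LocalMatrix N d} (hM : M.IsHermitian) :
    IsSelfAdjoint (place x M) := by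
  rw [IsSelfAdjoint, star_place, hM.eq]

theorem commute_place_of_disjoint {x y : ℤ} (hxy : DisjointWindows x d y d')
    (M : LocalMatrix N d) (M' : LocalMatrix N d') : Commute (place x M) (place y M') := by
  refine op_ext fun f s => ?_
  rw [mul_apply_eq_comp, mul_apply_eq_comp]
  simp only [place_apply, Finset.mul_sum, window_overwrite_of_disjoint hxy,
    window_overwrite_of_disjoint hxy.symm, overwrite_comm_of_disjoint hxy]
  rw [Finset.sum_comm]
  refine Finset.sum_congr rfl fun v _ => Finset.sum_congr rfl fun u _ => ?_
  ring

/-- A local observable of a window is a local observable of every larger window. -/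
theorem exists_place_enlarge {x y : ℤ} (hyx : y ≤ x) (hxy : x + d ≤ y + d') (M : LocalMatrix N d) :
    ∃ M' : LocalMatrix N d', place y M' = place x M := by
  classical
  let res (w : Fin d' → Fin N) : Fin d → Fin N :=
    fun k => w ⟨(x + (k : ℕ) - y).toNat, by have := k.2; omega⟩
  have hres (s : Config N) : res (window d' y s) = window d x s := by
    funext k
    have hk := k.2
    have : y + (((x + (k : ℕ) - y).toNat : ℕ) : ℤ) = x + (k : ℕ) := by omega
    simp only [res, window, this]
  -- `off w v` says that `w` and `v` agree outside the small window. The enlarged matrix is `M` on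
  -- that window tensored with the identity on the other sites.
  let off (w v : Fin d' → Fin N) : Prop :=
    ∀ k : Fin d', ¬ (0 ≤ y + (k : ℕ) - x ∧ y + (k : ℕ) - x < d) → w k = v k
  have hoff (s : Config N) (v : Fin d' → Fin N) :
      off (window d' y s) v ↔ v = window d' y (overwrite x (res v) s) := by
    constructor
    · intro h
      funext k
      have hk := k.2
      by_cases hi : 0 ≤ y + (k : ℕ) - x ∧ y + (k : ℕ) - x < d
      · rw [window, overwrite_apply_of_mem _ _ _ hi]
        simp only [res]
        congr 1
        ext
        simp only
        omega
      · rw [window, overwrite_apply_of_notMem _ _ _ hi, ← h k hi, window]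
    · intro h k hk
      rw [h, window, window, overwrite_apply_of_notMem _ _ _ hk]
  have hover (s : Config N) (u : Fin d → Fin N) :
      overwrite y (window d' y (overwrite x u s)) s = overwrite x u s := by
    funext i
    by_cases hi : 0 ≤ i - y ∧ i - y < d'
    · rw [overwrite_apply_of_mem _ _ _ hi, window_apply_toNat _ _ hi]
    · rw [overwrite_apply_of_notMem _ _ _ hi, overwrite_apply_of_notMem _ _ _ (by omega)]
  refine ⟨Matrix.of fun w v => if off w v then M (res w) (res v) else 0, op_ext fun f s => ?_⟩
  rw [place_apply, place_apply]
  symm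
  refine Finset.sum_of_injOn (fun u => window d' y (overwrite x u s)) ?_ (by simp) ?_ ?_
  · intro u _ u' _ huu
    have := congrArg res huu
    simpa [hres] using this
  · intro v _ hv
    rw [Matrix.of_apply, if_neg, zero_mul]
    intro h
    exact hv ⟨res v, by simp, ((hoff s v).1 h).symm⟩
  · intro u _
    rw [Matrix.of_apply, if_pos ((hoff s _).2 (by simp [hres])), hover, hres, hres,
      window_overwrite]

end Place

/-! ### Translations. -/

section Shift

variable {N : ℕ}

/-- The configuration `s` translated by `a` sites to the left. -/
def shiftConfig (a : ℤ) (s : Config N) : Config N := fun i => s (i + a)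

theorem shiftConfig_shiftConfig (a b : ℤ) (s : Config N) :
    shiftConfig a (shiftConfig b s) = shiftConfig (a + b) s := by
  funext i
  simp only [shiftConfig, add_assoc]

@[simp] theorem shiftConfig_zero (s : Config N) : shiftConfig 0 s = s := by
  funext i
  simp [shiftConfig]

/-- Translation by `a` sites as a permutation of the configurations. -/
def shiftEquiv (N : ℕ) (a : ℤ) : Config N ≃ Config N where
  toFun := shiftConfig a
  invFun := shiftConfig (-a)
  left_inv s := by simp [shiftConfig_shiftConfig]
  right_inv s := by simp [shiftConfig_shiftConfig]

theorem memℓp_shift (a : ℤ) (f : Hil N) : Memℓp (fun s : Config N => f (shiftConfig a s)) 2 := by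
  have h2 : (0 : ℝ) < (2 : ENNReal).toReal := by norm_num
  have hf : Summable fun s : Config N => ‖f s‖ ^ (2 : ENNReal).toReal :=
    (memℓp_gen_iff h2).1 (lp.memℓp f)
  exact memℓp_gen (hf.comp_injective (shiftEquiv N a).injective)

/-- The unitary implementing translation by `a` sites. -/
def shiftOp (N : ℕ) (a : ℤ) : Op N :=
  LinearMap.mkContinuous
    { toFun := fun f => (⟨fun s => f (shiftConfig a s), memℓp_shift a f⟩ : Hil N)
      map_add' := fun _ _ => rfl
      map_smul' := fun _ _ => rfl } 1 (by
    intro f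
    have h2 : (0 : ℝ) < (2 : ENNReal).toReal := by norm_num
    rw [one_mul, lp.norm_eq_tsum_rpow h2, lp.norm_eq_tsum_rpow h2]
    exact (congrArg (fun r : ℝ => r ^ (1 / (2 : ENNReal).toReal))
      ((shiftEquiv N a).tsum_eq fun s => ‖f s‖ ^ (2 : ENNReal).toReal)).le)

theorem shiftOp_apply (a : ℤ) (f : Hil N) (s : Config N) :
    shiftOp N a f s = f (shiftConfig a s) := rfl

theorem norm_shiftOp_le (a : ℤ) : ‖shiftOp N a‖ ≤ 1 :=
  LinearMap.mkContinuous_norm_le _ zero_le_one _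

theorem shiftOp_mul_shiftOp_neg (a : ℤ) : shiftOp N a * shiftOp N (-a) = 1 := by
  refine op_ext fun f s => ?_
  rw [mul_apply_eq_comp, one_apply_eq_self, shiftOp_apply, shiftOp_apply, shiftConfig_shiftConfig]
  simp

theorem shiftOp_neg_mul_shiftOp (a : ℤ) : shiftOp N (-a) * shiftOp N a = 1 := by
  simpa using shiftOp_mul_shiftOp_neg (N := N) (-a)

theorem shiftOp_ket (a : ℤ) (s : Config N) : shiftOp N a (ket s) = ket (shiftConfig (-a) s) := by
  classical
  refine lp.ext (funext fun s' => ?_)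
  rw [shiftOp_apply, ket_apply, ket_apply]
  have : shiftConfig a s' = s ↔ s' = shiftConfig (-a) s := by
    constructor
    · rintro rfl; simp [shiftConfig_shiftConfig]
    · rintro rfl; simp [shiftConfig_shiftConfig]
  simp only [this]

/-- Translation of observables by `a` sites. -/
def translate (a : ℤ) (A : Op N) : Op N := shiftOp N a * A * shiftOp N (-a)

theorem translate_mul (a : ℤ) (A B : Op N) :
    translate a (A * B) = translate a A * translate a B := by
  simp only [translate, mul_assoc]
  rw [← mul_assoc (shiftOp N (-a)) (shiftOp N a), shiftOp_neg_mul_shiftOp, one_mul]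

theorem norm_translate_le (a : ℤ) (A : Op N) : ‖translate a A‖ ≤ ‖A‖ := by
  have h1 := norm_shiftOp_le (N := N) a
  have h2 := norm_shiftOp_le (N := N) (-a)
  calc ‖translate a A‖ ≤ ‖shiftOp N a‖ * ‖A‖ * ‖shiftOp N (-a)‖ := norm_mul₃_le
    _ ≤ 1 * ‖A‖ * 1 := by gcongr
    _ = ‖A‖ := by ring

/-- Translation of observables, as a continuous linear map. -/
def translateCLM (N : ℕ) (a : ℤ) : Op N →L[ℂ] Op N :=
  LinearMap.mkContinuous
    { toFun := translate a
      map_add' := fun A B => by simp only [translate, mul_add, add_mul]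
      map_smul' := fun c A => by simp [translate] } 1 (by
    intro A
    rw [one_mul]
    exact norm_translate_le a A)

theorem translateCLM_apply (a : ℤ) (A : Op N) : translateCLM N a A = translate a A := rfl

theorem continuous_translate (a : ℤ) : Continuous (translate a : Op N → Op N) :=
  (translateCLM N a).continuous

/-- Translation of observables, as a homomorphism of algebras. -/
def translateHom (N : ℕ) (a : ℤ) : Op N →ₐ[ℂ] Op N :=
  AlgHom.ofLinearMap (translateCLM N a : Op N →ₗ[ℂ] Op N)
    (by
      change translate a 1 = 1
      rw [translate, mul_one, shiftOp_mul_shiftOp_neg])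
    (translate_mul a)

theorem translateHom_apply (a : ℤ) (A : Op N) : translateHom N a A = translate a A := rfl

theorem translate_place {d : ℕ} (a x : ℤ) (M : LocalMatrix N d) :
    translate a (place x M) = place (x + a) M := by
  refine op_ext fun f s => ?_
  rw [translate, mul_apply_eq_comp, mul_apply_eq_comp, shiftOp_apply, place_apply, place_apply]
  have hw : window d x (shiftConfig a s) = window d (x + a) s := by
    funext k
    simp only [window, shiftConfig]
    congr 1
    ring
  refine Finset.sum_congr rfl fun v _ => ?_
  rw [shiftOp_apply, hw]
  refine congrArg (fun s' => M (window d (x + a) s) v * f s') (funext fun i => ?_)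
  simp only [shiftConfig]
  by_cases hi : 0 ≤ i - (x + a) ∧ i - (x + a) < d
  · rw [overwrite_apply_of_mem (x + a) v s hi, overwrite_apply_of_mem x v _ (by omega)]
    congr 2
    omega
  · rw [overwrite_apply_of_notMem (x + a) v s hi, overwrite_apply_of_notMem x v _ (by omega)]
    exact congrArg s (by ring)

theorem norm_place_le {d : ℕ} (x : ℤ) (M : LocalMatrix N d) : ‖place x M‖ ≤ ‖place 0 M‖ := by
  have := norm_translate_le x (place 0 M)
  rwa [translate_place, zero_add] at this

end Shift

/-! ### Local observables and their norm closure. -/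

section Local

variable {N : ℕ}

theorem exists_common_window {A B : Op N} (hA : ∃ x d, A ∈ localAlgebra N x d)
    (hB : ∃ x d, B ∈ localAlgebra N x d) :
    ∃ (x : ℤ) (d : ℕ) (M M' : LocalMatrix N d), place x M = A ∧ place x M' = B := by
  obtain ⟨x, d, M, rfl⟩ := hA
  obtain ⟨y, d', M', rfl⟩ := hB
  obtain ⟨L, hL⟩ := exists_place_enlarge (d' := ((max (x + d) (y + d')) - min x y).toNat)
    (x := x) (y := min x y) (by omega) (by omega) M
  obtain ⟨L', hL'⟩ := exists_place_enlarge (d' := ((max (x + d) (y + d')) - min x y).toNat)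
    (x := y) (y := min x y) (by omega) (by omega) M'
  exact ⟨_, _, L, L', hL, hL'⟩

/-- The *-algebra of all local observables. -/
def localSubalgebra (N : ℕ) : StarSubalgebra ℂ (Op N) where
  carrier := {A | ∃ x d, A ∈ localAlgebra N x d}
  mul_mem' {A B} hA hB := by
    obtain ⟨x, d, M, M', rfl, rfl⟩ := exists_common_window hA hB
    exact ⟨x, d, M * M', place_mul x M M'⟩
  add_mem' {A B} hA hB := by
    obtain ⟨x, d, M, M', rfl, rfl⟩ := exists_common_window hA hB
    exact ⟨x, d, M + M', place_add x M M'⟩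
  algebraMap_mem' c := ⟨0, 0, algebraMap ℂ _ c, (placeHom N 0 0).commutes c⟩
  star_mem' {A} hA := by
    obtain ⟨x, d, M, rfl⟩ := hA
    exact ⟨x, d, _, (star_place x M).symm⟩

/-- Any two local observables fit into a common window, so they already form a *-algebra and
adjoining adds nothing. Hence every quasi-local observable is a norm limit of single placed
matrices. -/
theorem quasiLocalAlgebra_eq : quasiLocalAlgebra N = (localSubalgebra N).topologicalClosure := by
  rw [quasiLocalAlgebra]
  congr 1
  refine le_antisymm (StarAlgebra.adjoin_le ?_) ?_
  · simp only [Set.iUnion_subset_iff]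
    exact fun x d A hA => ⟨x, d, hA⟩
  · rintro A ⟨x, d, hA⟩
    exact StarAlgebra.subset_adjoin ℂ _ (Set.mem_iUnion₂.2 ⟨x, d, hA⟩)

theorem isClosed_quasiLocalAlgebra : IsClosed (quasiLocalAlgebra N : Set (Op N)) :=
  StarSubalgebra.isClosed_topologicalClosure _

theorem localSubalgebra_le : localSubalgebra N ≤ quasiLocalAlgebra N :=
  quasiLocalAlgebra_eq (N := N) ▸ StarSubalgebra.le_topologicalClosure _

theorem place_mem {d : ℕ} (x : ℤ) (M : LocalMatrix N d) : place x M ∈ quasiLocalAlgebra N :=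
  localSubalgebra_le ⟨x, d, M, rfl⟩

theorem exists_local_near {A : Op N} (hA : A ∈ quasiLocalAlgebra N) {ε : ℝ} (hε : 0 < ε) :
    ∃ (x : ℤ) (d : ℕ) (M : LocalMatrix N d), ‖A - place x M‖ < ε := by
  rw [quasiLocalAlgebra_eq, ← SetLike.mem_coe, StarSubalgebra.topologicalClosure_coe] at hA
  obtain ⟨B, ⟨x, d, M, rfl⟩, hB⟩ := Metric.mem_closure_iff.1 hA ε hε
  exact ⟨x, d, M, by rwa [← dist_eq_norm]⟩

theorem quasiLocal_induction {p : Op N → Prop} (hp : IsClosed {A | p A})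
    (hloc : ∀ (x : ℤ) (d : ℕ) (M : LocalMatrix N d), p (place x M)) {A : Op N}
    (hA : A ∈ quasiLocalAlgebra N) : p A := by
  rw [quasiLocalAlgebra_eq] at hA
  refine closure_minimal (t := {A | p A}) ?_ hp hA
  rintro _ ⟨x, d, M, rfl⟩
  exact hloc x d M

theorem measurable_window {d : ℕ} (x : ℤ) : Measurable (window d x : Config N → Fin d → Fin N) :=
  measurable_pi_lambda _ fun _ => measurable_pi_apply _

theorem place_ket_self {d : ℕ} (x : ℤ) (M : LocalMatrix N d) (s : Config N) :
    place x M (ket s) s = M (window d x s) (window d x s) := by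
  classical
  rw [place_ket_apply, if_pos (overwrite_window x s)]

theorem norm_diag_le (A : Op N) (s : Config N) : ‖A (ket s) s‖ ≤ ‖A‖ := by
  rw [← inner_ket]
  calc _ ≤ ‖ket s‖ * ‖A (ket s)‖ := norm_inner_le_norm _ _
    _ ≤ 1 * (‖A‖ * 1) := by
      rw [norm_ket]
      gcongr
      simpa [norm_ket] using A.le_opNorm (ket s)
    _ = ‖A‖ := by ring

theorem measurable_diag_place {d : ℕ} (x : ℤ) (M : LocalMatrix N d) :
    Measurable fun s : Config N => place x M (ket s) s := by
  simp only [place_ket_self]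
  exact (measurable_of_countable fun w => M w w).comp (measurable_window x)

end Local

/-! ### The tracial state: product property, invariance, traciality, Hilbert–Schmidt norm. -/

section TracialState

variable {N : ℕ} [NeZero N] {d d' : ℕ}

instance : IsProbabilityMeasure (uniformConfig N) := by
  unfold uniformConfig; infer_instance

/-- The issue is measurability. The diagonal of a local observable depends on finitely many sites,
and norm approximation makes the diagonal of `A` a pointwise limit of such functions. -/
theorem integrable_diag {A : Op N} (hA : A ∈ quasiLocalAlgebra N) :
    Integrable (fun s => A (ket s) s) (uniformConfig N) := by
  refine Integrable.of_bound ?_ ‖A‖ (ae_of_all _ (norm_diag_le A))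
  have hn (n : ℕ) : (0 : ℝ) < 1 / (n + 1) := by positivity
  choose x d M hM using fun n : ℕ => exists_local_near hA (hn n)
  refine (measurable_of_tendsto_metrizable (fun n => measurable_diag_place (x n) (M n))
    (tendsto_pi_nhds.2 fun s => ?_)).aestronglyMeasurable
  rw [tendsto_iff_norm_sub_tendsto_zero]
  refine squeeze_zero (fun _ => norm_nonneg _) (fun n => ?_) tendsto_one_div_add_atTop_nhds_zero_nat
  rw [norm_sub_rev]
  exact (norm_diag_le (A - place (x n) (M n)) s).trans (hM n).le

theorem tracialState_place (x : ℤ) (M : LocalMatrix N d) :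
    tracialState (place x M) = ((N : ℂ) ^ d)⁻¹ * M.trace := by
  rw [tracialState_eq]
  simp only [place_ket_self]
  rw [← integral_map (φ := window d x) (f := fun w => M w w) (measurable_window x).aemeasurable
    (measurable_of_countable _).aestronglyMeasurable]
  have hmap : (uniformConfig N).map (window d x) =
      Measure.infinitePi fun _ : Fin d => (PMF.uniformOfFintype (Fin N)).toMeasure :=
    Measure.map_infinitePi_infinitePi_of_inj (f := fun k : Fin d => x + ((k : ℕ) : ℤ))
      (fun k l hkl => by ext; simpa using hkl)
  rw [hmap, integral_fintype (Integrable.of_finite), Matrix.trace, Finset.mul_sum]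
  refine Finset.sum_congr rfl fun w _ => ?_
  rw [Measure.real, Measure.infinitePi_singleton_of_fintype]
  simp [Matrix.diag]

/-- The diagonal of the product is the product of the diagonals, and these are functions of disjoint
sets of independent sites. -/
theorem tracialState_mul_place_of_disjoint {x y : ℤ} (hxy : DisjointWindows x d y d')
    (M : LocalMatrix N d) (M' : LocalMatrix N d') :
    tracialState (place x M * place y M') =
      tracialState (place x M) * tracialState (place y M') := by
  classical
  have hdiag (s : Config N) : (place x M * place y M') (ket s) s =
      M (window d x s) (window d x s) * M' (window d' y s) (window d' y s) := by
    rw [mul_apply_eq_comp, place_apply, Finset.sum_eq_single (window d x s)]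
    · rw [overwrite_window, place_ket_self]
    · intro v _ hv
      rw [place_ket_apply, if_neg, mul_zero]
      intro h
      refine hv ?_
      have := congrArg (window d x) h
      rw [window_overwrite_of_disjoint hxy.symm, window_overwrite] at this
      exact this.symm
    · simp
  have hind := (ProbabilityTheory.iIndepFun_infinitePi
    (P := fun _ : ℤ => (PMF.uniformOfFintype (Fin N)).toMeasure) (X := fun _ a => a)
    (fun _ => measurable_id)).indepFun_finset (Finset.Ico x (x + d)) (Finset.Ico y (y + d'))
      (by
        rw [Finset.disjoint_left]
        intro i hi hi'
        simp only [Finset.mem_Ico] at hi hi'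
        rcases hxy with h | h <;> omega)
      (fun i => measurable_pi_apply i)
  have hind' := hind.comp
    (φ := fun w => M (fun k => w ⟨x + (k : ℕ), by have := k.2; simp⟩)
      (fun k => w ⟨x + (k : ℕ), by have := k.2; simp⟩))
    (ψ := fun w => M' (fun k => w ⟨y + (k : ℕ), by have := k.2; simp⟩)
      (fun k => w ⟨y + (k : ℕ), by have := k.2; simp⟩))
    (measurable_of_countable _) (measurable_of_countable _)
  simp only [tracialState_eq, hdiag, place_ket_self]
  refine hind'.integral_fun_mul_eq_mul_integral ?_ ?_
  · exact (((measurable_of_countable fun w => M w w).comp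
      (measurable_window x))).aestronglyMeasurable
  · exact (((measurable_of_countable fun w => M' w w).comp
      (measurable_window y))).aestronglyMeasurable

theorem tracialState_translate (a : ℤ) (A : Op N) :
    tracialState (translate a A) = tracialState A := by
  have hmap : (uniformConfig N).map (shiftConfig a) = uniformConfig N :=
    Measure.map_infinitePi_infinitePi_of_inj (f := fun i : ℤ => i + a) (add_left_injective a)
  have hm : Measurable (shiftConfig a : Config N → Config N) :=
    measurable_pi_lambda _ fun _ => measurable_pi_apply _
  have hm' : Measurable (shiftConfig (-a) : Config N → Config N) :=
    measurable_pi_lambda _ fun _ => measurable_pi_apply _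
  let e : Config N ≃ᵐ Config N := ⟨shiftEquiv N a, hm, hm'⟩
  simp only [tracialState_eq]
  conv_rhs => rw [← hmap]
  refine Eq.trans ?_ (integral_map_equiv e _).symm
  refine integral_congr_ae (ae_of_all _ fun s => ?_)
  change (shiftOp N a * A * shiftOp N (-a)) (ket s) s = A (ket (shiftConfig a s)) (shiftConfig a s)
  rw [mul_apply_eq_comp, mul_apply_eq_comp, shiftOp_ket, shiftOp_apply, neg_neg]

theorem tracialState_star_mul_self (A : Op N) :
    tracialState (star A * A) = ((∫ s, ‖A (ket s)‖ ^ 2 ∂(uniformConfig N) : ℝ) : ℂ) := by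
  rw [tracialState_eq, ← integral_complex_ofReal]
  refine integral_congr_ae (ae_of_all _ fun s => ?_)
  simp only
  rw [mul_apply_eq_comp, ← inner_ket, ContinuousLinearMap.star_eq_adjoint,
    ContinuousLinearMap.adjoint_inner_right, inner_self_eq_norm_sq_to_K]
  simp

theorem tracialState_star (A : Op N) :
    tracialState (star A) = starRingEnd ℂ (tracialState A) := by
  rw [tracialState_eq, tracialState_eq, ← integral_conj]
  refine integral_congr_ae (ae_of_all _ fun s => ?_)
  simp only
  rw [← inner_ket, ← inner_ket, ContinuousLinearMap.star_eq_adjoint,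
    ContinuousLinearMap.adjoint_inner_right, inner_conj_symm]

/-- The restriction of the tracial state to the quasi-local algebra. -/
def quasiLocalState (N : ℕ) [NeZero N] :
    StrongDual ℂ (quasiLocalAlgebra N).toSubalgebra.toSubmodule :=
  LinearMap.mkContinuous
    { toFun := fun A => tracialState (A : Op N)
      map_add' := fun A B => integral_add (integrable_diag A.2) (integrable_diag B.2)
      map_smul' := fun c _ => integral_const_mul c _ } 1 (by
    intro A
    rw [one_mul]
    refine (norm_integral_le_of_norm_le_const (ae_of_all _ (norm_diag_le (A : Op N)))).trans ?_
    simp)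

/-- A bounded functional on all operators that is the tracial state on the quasi-local algebra. -/
def traceFun (N : ℕ) [NeZero N] : Op N →L[ℂ] ℂ :=
  (exists_extension_norm_eq _ (quasiLocalState N)).choose

theorem traceFun_eq {A : Op N} (hA : A ∈ quasiLocalAlgebra N) : traceFun N A = tracialState A :=
  (exists_extension_norm_eq _ (quasiLocalState N)).choose_spec.1 ⟨A, hA⟩

theorem norm_traceFun_le (A : Op N) : ‖traceFun N A‖ ≤ ‖A‖ := by
  have h1 : ‖traceFun N‖ ≤ 1 := by
    rw [traceFun, (exists_extension_norm_eq _ (quasiLocalState N)).choose_spec.2]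
    exact LinearMap.mkContinuous_norm_le _ zero_le_one _
  simpa using (traceFun N).le_of_opNorm_le h1 A

/-- On a common window this is cyclicity of the matrix trace; density and continuity extend it in
each variable separately. -/
theorem traceFun_mul_comm {A B : Op N} (hA : A ∈ quasiLocalAlgebra N)
    (hB : B ∈ quasiLocalAlgebra N) : traceFun N (A * B) = traceFun N (B * A) := by
  refine quasiLocal_induction (p := fun A => traceFun N (A * B) = traceFun N (B * A)) ?_ ?_ hA
  · exact isClosed_eq (by fun_prop) (by fun_prop)
  intro x d M
  refine quasiLocal_induction
    (p := fun B => traceFun N (place x M * B) = traceFun N (B * place x M)) ?_ ?_ hB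
  · exact isClosed_eq (by fun_prop) (by fun_prop)
  intro y d' M'
  obtain ⟨z, e, L, L', hL, hL'⟩ := exists_common_window ⟨x, d, M, rfl⟩ ⟨y, d', M', rfl⟩
  simp only at hL hL'
  rw [← hL, ← hL', ← place_mul, ← place_mul, traceFun_eq (place_mem _ _),
    traceFun_eq (place_mem _ _), tracialState_place, tracialState_place, Matrix.trace_mul_comm]

theorem traceFun_star {A : Op N} (hA : A ∈ quasiLocalAlgebra N) :
    traceFun N (star A) = starRingEnd ℂ (traceFun N A) := by
  rw [traceFun_eq hA, traceFun_eq (star_mem hA), tracialState_star]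

theorem traceFun_star_mul_self_nonneg {A : Op N} (hA : A ∈ quasiLocalAlgebra N) :
    0 ≤ (traceFun N (star A * A)).re := by
  rw [traceFun_eq (mul_mem (star_mem hA) hA), tracialState_star_mul_self, Complex.ofReal_re]
  exact integral_nonneg fun _ => by positivity

/-- The Hilbert–Schmidt norm of the tracial state. -/
def hsNorm (A : Op N) : ℝ := √(traceFun N (star A * A)).re

/-- Cauchy–Schwarz needs only a positive semidefinite form, so faithfulness of the state plays no
role here. -/
theorem norm_traceFun_star_mul_le {A B : Op N} (hA : A ∈ quasiLocalAlgebra N)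
    (hB : B ∈ quasiLocalAlgebra N) : ‖traceFun N (star A * B)‖ ≤ hsNorm A * hsNorm B := by
  let core : PreInnerProductSpace.Core ℂ (quasiLocalAlgebra N) :=
    { inner := fun A B => traceFun N (star (A : Op N) * B)
      conj_inner_symm := fun A B => by
        rw [← traceFun_star (mul_mem (star_mem B.2) A.2), star_mul, star_star]
      re_inner_nonneg := fun A => traceFun_star_mul_self_nonneg A.2
      add_left := fun A B C => by simp [add_mul]
      smul_left := fun A B c => by simp }
  exact InnerProductSpace.Core.norm_inner_le_norm (c := core)
    (⟨A, hA⟩ : quasiLocalAlgebra N) (⟨B, hB⟩ : quasiLocalAlgebra N)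

theorem hsNorm_nonneg (A : Op N) : 0 ≤ hsNorm A := Real.sqrt_nonneg _

theorem hsNorm_sq {A : Op N} (hA : A ∈ quasiLocalAlgebra N) :
    hsNorm A ^ 2 = (traceFun N (star A * A)).re := Real.sq_sqrt (traceFun_star_mul_self_nonneg hA)

theorem hsNorm_le (A : Op N) : hsNorm A ≤ ‖A‖ := by
  refine Real.sqrt_le_iff.2 ⟨norm_nonneg _, ?_⟩
  calc _ ≤ ‖traceFun N (star A * A)‖ := Complex.re_le_norm _
    _ ≤ ‖star A * A‖ := norm_traceFun_le _
    _ = ‖A‖ ^ 2 := by rw [sq]; exact ContinuousLinearMap.norm_adjoint_comp_self A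

theorem hsNorm_add_le {A B : Op N} (hA : A ∈ quasiLocalAlgebra N)
    (hB : B ∈ quasiLocalAlgebra N) : hsNorm (A + B) ≤ hsNorm A + hsNorm B := by
  refine abs_le_of_sq_le_sq' ?_ (add_nonneg (hsNorm_nonneg A) (hsNorm_nonneg B)) |>.2
  have h1 := (Complex.re_le_norm _).trans (norm_traceFun_star_mul_le hA hB)
  have h2 := (Complex.re_le_norm _).trans (norm_traceFun_star_mul_le hB hA)
  rw [hsNorm_sq (add_mem hA hB), add_sq, hsNorm_sq hA, hsNorm_sq hB]
  simp only [star_add, mul_add, add_mul, map_add, Complex.add_re]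
  linarith

end TracialState

/-! ### Heisenberg evolution by a bounded generator. -/

section Evolution

variable {E : Type*} [NormedAddCommGroup E] [InnerProductSpace ℂ E] [CompleteSpace E]

/-- The one-parameter group `e^{itH}`. -/
def expI (H : E →L[ℂ] E) (t : ℝ) : E →L[ℂ] E := NormedSpace.exp ((Complex.I * t) • H)

/-- Heisenberg evolution `e^{itH} A e^{-itH}` generated by `H`. -/
def heisenberg (H : E →L[ℂ] E) (t : ℝ) (A : E →L[ℂ] E) : E →L[ℂ] E :=
  expI H t * A * expI H (-t)

@[simp] theorem expI_zero (H : E →L[ℂ] E) : expI H 0 = 1 := by simp [expI]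

theorem expI_add (H : E →L[ℂ] E) (s t : ℝ) : expI H (s + t) = expI H s * expI H t := by
  let _ : NormedAlgebra ℚ (E →L[ℂ] E) := NormedAlgebra.restrictScalars ℚ ℂ (E →L[ℂ] E)
  rw [expI, expI, expI, ← NormedSpace.exp_add_of_commute]
  · congr 1
    rw [← add_smul]
    push_cast
    ring_nf
  · exact ((Commute.refl H).smul_left _).smul_right _

theorem expI_mul_expI_neg (H : E →L[ℂ] E) (t : ℝ) : expI H t * expI H (-t) = 1 := by
  rw [← expI_add, add_neg_cancel, expI_zero]

theorem expI_neg_mul_expI (H : E →L[ℂ] E) (t : ℝ) : expI H (-t) * expI H t = 1 := by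
  rw [← expI_add, neg_add_cancel, expI_zero]

theorem expI_neg_left (H : E →L[ℂ] E) (t : ℝ) : expI (-H) t = expI H (-t) := by
  simp [expI]

theorem star_expI {H : E →L[ℂ] E} (hH : IsSelfAdjoint H) (t : ℝ) :
    star (expI H t) = expI H (-t) := by
  rw [expI, NormedSpace.star_exp, expI, star_smul, hH.star_eq]
  simp

theorem hasDerivAt_expI (H : E →L[ℂ] E) (t : ℝ) :
    HasDerivAt (expI H) (Complex.I • (H * expI H t)) t := by
  have h := (hasDerivAt_exp_smul_const' (𝕂 := ℝ) (Complex.I • H) t)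
  have he : expI H = fun u : ℝ => NormedSpace.exp (u • Complex.I • H) := by
    funext u
    rw [expI, ← Complex.coe_smul u, smul_smul, mul_comm]
  rw [he]
  simpa only [smul_mul_assoc] using h

theorem hasDerivAt_expI_neg (H : E →L[ℂ] E) (t : ℝ) :
    HasDerivAt (fun u : ℝ => expI H (-u)) (-(Complex.I • (H * expI H (-t)))) t := by
  have h := hasDerivAt_expI (-H) t
  rw [funext (expI_neg_left H)] at h
  refine h.congr_deriv ?_
  rw [neg_mul, smul_neg]

theorem expI_commute (H : E →L[ℂ] E) (t : ℝ) : Commute H (expI H t) :=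
  (((Commute.refl H).smul_right _).exp_right)

theorem norm_expI_mul {H : E →L[ℂ] E} (hH : IsSelfAdjoint H) (t : ℝ) (A : E →L[ℂ] E) :
    ‖expI H t * A‖ = ‖A‖ := by
  have hu : expI H t ∈ unitary (E →L[ℂ] E) := by
    rw [Unitary.mem_iff, star_expI hH]
    exact ⟨expI_neg_mul_expI H t, expI_mul_expI_neg H t⟩
  exact CStarRing.norm_coe_unitary_mul ⟨_, hu⟩ A

theorem norm_mul_expI {H : E →L[ℂ] E} (hH : IsSelfAdjoint H) (t : ℝ) (A : E →L[ℂ] E) :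
    ‖A * expI H t‖ = ‖A‖ := by
  have hu : expI H t ∈ unitary (E →L[ℂ] E) := by
    rw [Unitary.mem_iff, star_expI hH]
    exact ⟨expI_neg_mul_expI H t, expI_mul_expI_neg H t⟩
  exact CStarRing.norm_mul_coe_unitary A ⟨_, hu⟩

theorem norm_heisenberg {H : E →L[ℂ] E} (hH : IsSelfAdjoint H) (t : ℝ) (A : E →L[ℂ] E) :
    ‖heisenberg H t A‖ = ‖A‖ := by
  rw [heisenberg, norm_mul_expI hH, norm_expI_mul hH]

@[simp] theorem heisenberg_zero_time (H A : E →L[ℂ] E) : heisenberg H 0 A = A := by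
  simp [heisenberg]

theorem heisenberg_add_time (H : E →L[ℂ] E) (s t : ℝ) (A : E →L[ℂ] E) :
    heisenberg H (s + t) A = heisenberg H s (heisenberg H t A) := by
  have h : -(s + t) = -t + -s := by ring
  simp only [heisenberg, expI_add, h, mul_assoc]

theorem heisenberg_neg_left (H : E →L[ℂ] E) (t : ℝ) (A : E →L[ℂ] E) :
    heisenberg (-H) t A = heisenberg H (-t) A := by
  simp only [heisenberg, expI_neg_left]

theorem heisenberg_mul (H : E →L[ℂ] E) (t : ℝ) (A B : E →L[ℂ] E) :
    heisenberg H t (A * B) = heisenberg H t A * heisenberg H t B := by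
  simp only [heisenberg, mul_assoc]
  rw [← mul_assoc (expI H (-t)) (expI H t), expI_neg_mul_expI, one_mul]

theorem star_heisenberg {H : E →L[ℂ] E} (hH : IsSelfAdjoint H) (t : ℝ) (A : E →L[ℂ] E) :
    star (heisenberg H t A) = heisenberg H t (star A) := by
  simp only [heisenberg, star_mul, star_expI hH, neg_neg, mul_assoc]

/-- Heisenberg evolution as a continuous linear map. -/
def heisenbergCLM (H : E →L[ℂ] E) (t : ℝ) : (E →L[ℂ] E) →L[ℂ] (E →L[ℂ] E) :=
  ((ContinuousLinearMap.mul ℂ (E →L[ℂ] E)).flip (expI H (-t))).comp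
    (ContinuousLinearMap.mul ℂ (E →L[ℂ] E) (expI H t))

theorem heisenbergCLM_apply (H : E →L[ℂ] E) (t : ℝ) (A : E →L[ℂ] E) :
    heisenbergCLM H t A = heisenberg H t A := rfl

theorem heisenberg_sub (H : E →L[ℂ] E) (t : ℝ) (A B : E →L[ℂ] E) :
    heisenberg H t (A - B) = heisenberg H t A - heisenberg H t B :=
  map_sub (heisenbergCLM H t) A B

theorem heisenberg_sum {ι : Type*} (H : E →L[ℂ] E) (t : ℝ) (s : Finset ι) (A : ι → E →L[ℂ] E) :
    heisenberg H t (∑ i ∈ s, A i) = ∑ i ∈ s, heisenberg H t (A i) :=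
  map_sum (heisenbergCLM H t) A s

theorem commute_heisenberg {H A V : E →L[ℂ] E} (hH : Commute V H) (hA : Commute V A) (t : ℝ) :
    Commute V (heisenberg H t A) := by
  have h (u : ℝ) : Commute V (expI H u) := (hH.smul_right _).exp_right
  exact ((h t).mul_right hA).mul_right (h (-t))

theorem hasDerivAt_heisenberg (H A : E →L[ℂ] E) (t : ℝ) :
    HasDerivAt (fun u => heisenberg H u A)
      (Complex.I • (H * heisenberg H t A - heisenberg H t A * H)) t := by
  have h1 := hasDerivAt_expI H t
  have h2 := hasDerivAt_expI_neg H t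
  refine ((h1.mul_const A).mul h2).congr_deriv ?_
  rw [heisenberg, (expI_commute H (-t)).eq]
  simp only [smul_mul_assoc, mul_neg, mul_smul_comm, smul_sub, mul_assoc]
  abel

theorem continuous_heisenberg (H A : E →L[ℂ] E) : Continuous fun t => heisenberg H t A :=
  continuous_iff_continuousAt.2 fun t => (hasDerivAt_heisenberg H A t).continuousAt

/-- Duhamel's principle: `s ↦ τ^H_{-s}(τ^{H'}_s(A))` interpolates between the two evolutions, and
its derivative has the norm of the commutator of `H' - H` with `τ^{H'}_s(A)`. The power `u ^ k` is
the form in which the bound can be iterated. -/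
theorem norm_heisenberg_sub_le {H H' A : E →L[ℂ] E} (hH : IsSelfAdjoint H) (c : ℝ) (k : ℕ)
    {t : ℝ} (ht : 0 ≤ t)
    (hc : ∀ u ∈ Set.Ico 0 t, ‖(H' - H) * heisenberg H' u A - heisenberg H' u A * (H' - H)‖ ≤
      c * u ^ k) :
    ‖heisenberg H t A - heisenberg H' t A‖ ≤ c * t ^ (k + 1) / (k + 1) := by
  let g (s : ℝ) : E →L[ℂ] E := heisenberg H (-s) (heisenberg H' s A)
  let g' (s : ℝ) : E →L[ℂ] E := heisenberg H (-s) (Complex.I •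
    ((H' - H) * heisenberg H' s A - heisenberg H' s A * (H' - H)))
  have hg (s : ℝ) : HasDerivAt g (g' s) s := by
    have h1 := hasDerivAt_heisenberg H' A s
    have h2 := hasDerivAt_expI_neg H s
    have h3 := hasDerivAt_expI H s
    have h4 := (h2.mul h1).mul h3
    have heq : g = ((fun u : ℝ => expI H (-u)) * fun u => heisenberg H' u A) * expI H := by
      funext u
      simp [g, heisenberg]
    rw [heq]
    refine h4.congr_deriv ?_
    simp only [g', heisenberg, neg_neg, (expI_commute H (-s)).eq, (expI_commute H s).eq,
      Pi.mul_apply]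
    simp only [smul_mul_assoc, mul_smul_comm, mul_sub, sub_mul, smul_sub, mul_assoc, neg_mul,
      add_mul]
    rw [(expI_commute H s).eq]
    abel
  have hk : (0 : ℝ) < (k : ℝ) + 1 := by positivity
  have hB (s : ℝ) : HasDerivAt (fun u : ℝ => c * u ^ (k + 1) / (k + 1)) (c * s ^ k) s := by
    refine (((hasDerivAt_pow (k + 1) s).const_mul c).div_const ((k : ℝ) + 1)).congr_deriv ?_
    rw [Nat.add_sub_cancel]
    push_cast
    field_simp
  have h0 : ‖(fun s => g s - g 0) 0‖ ≤ c * 0 ^ (k + 1) / ((k : ℝ) + 1) := by simp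
  have hmain := image_norm_le_of_norm_deriv_right_le_deriv_boundary
    (f := fun s => g s - g 0) (f' := g') (a := 0) (b := t)
    (fun s _ => ((hg s).sub_const _).continuousAt.continuousWithinAt)
    (fun s _ => ((hg s).sub_const _).hasDerivWithinAt) h0 hB
    (fun s hs => by
      rw [norm_heisenberg hH, norm_smul, Complex.norm_I, one_mul]
      exact hc s hs) (x := t) ⟨ht, le_rfl⟩
  refine le_trans (le_of_eq ?_) hmain
  rw [← norm_heisenberg hH t (g t - g 0), heisenberg_sub, ← heisenberg_add_time, norm_sub_rev]
  simp [g]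

theorem expI_mem {S : StarSubalgebra ℂ (E →L[ℂ] E)} (hS : IsClosed (S : Set (E →L[ℂ] E)))
    {H : E →L[ℂ] E} (hH : H ∈ S) (t : ℝ) : expI H t ∈ S := by
  let _ : Algebra ℚ (E →L[ℂ] E) := (NormedAlgebra.restrictScalars ℚ ℂ (E →L[ℂ] E)).toAlgebra
  have : IsScalarTower ℚ ℂ (E →L[ℂ] E) := ⟨fun q c A => by
    change ((q • c : ℂ)) • A = ((q : ℂ)) • c • A
    rw [Rat.smul_def, mul_smul]⟩
  exact NormedSpace.exp_mem (R := ℂ) hS (SMulMemClass.smul_mem _ hH)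

theorem heisenberg_mem {S : StarSubalgebra ℂ (E →L[ℂ] E)} (hS : IsClosed (S : Set (E →L[ℂ] E)))
    {H A : E →L[ℂ] E} (hH : H ∈ S) (hA : A ∈ S) (t : ℝ) : heisenberg H t A ∈ S :=
  mul_mem (mul_mem (expI_mem hS hH t) hA) (expI_mem hS hH (-t))

/-- The time integral of the evolved observable `J`. -/
def timeIntegral (H J : E →L[ℂ] E) (T : ℝ) : E →L[ℂ] E := ∫ s in (0 : ℝ)..T, heisenberg H s J

theorem timeIntegral_map {F : Type*} [NormedAddCommGroup F] [NormedSpace ℂ F] [CompleteSpace F]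
    (L : (E →L[ℂ] E) →L[ℂ] F) (H J : E →L[ℂ] E) (T : ℝ) :
    L (timeIntegral H J T) = ∫ s in (0 : ℝ)..T, L (heisenberg H s J) :=
  (L.intervalIntegral_comp_comm ((continuous_heisenberg H J).intervalIntegrable 0 T)).symm

/-- A closed subspace is complete, so the integral can be formed inside it and then included. -/
theorem timeIntegral_mem {S : StarSubalgebra ℂ (E →L[ℂ] E)} (hS : IsClosed (S : Set (E →L[ℂ] E)))
    {H J : E →L[ℂ] E} (hH : H ∈ S) (hJ : J ∈ S) (T : ℝ) : timeIntegral H J T ∈ S := by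
  let S' : Submodule ℂ (E →L[ℂ] E) := S.toSubalgebra.toSubmodule
  have hS' : IsClosed (S' : Set (E →L[ℂ] E)) := hS
  have : CompleteSpace S' := hS'.completeSpace_coe
  let f (s : ℝ) : S' := ⟨heisenberg H s J, heisenberg_mem hS hH hJ s⟩
  have hf : Continuous f := (continuous_heisenberg H J).subtype_mk _
  have h := S'.subtypeL.intervalIntegral_comp_comm (hf.intervalIntegrable (μ := volume) 0 T)
  have h' : timeIntegral H J T = S'.subtypeL (∫ s in (0 : ℝ)..T, f s) := h
  rw [h']
  exact (∫ s in (0 : ℝ)..T, f s).2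

theorem isSelfAdjoint_timeIntegral {H J : E →L[ℂ] E} (hH : IsSelfAdjoint H)
    (hJ : IsSelfAdjoint J) (T : ℝ) : IsSelfAdjoint (timeIntegral H J T) := by
  have h := ((starL' ℝ : (E →L[ℂ] E) ≃L[ℝ] (E →L[ℂ] E)) :
    (E →L[ℂ] E) →L[ℝ] (E →L[ℂ] E)).intervalIntegral_comp_comm
      ((continuous_heisenberg H J).intervalIntegrable (μ := volume) 0 T)
  have h' : star (timeIntegral H J T) = ∫ s in (0 : ℝ)..T, star (heisenberg H s J) := h.symm
  rw [IsSelfAdjoint, h']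
  simp only [star_heisenberg hH, hJ.star_eq]
  rfl

/-- This cocycle identity is the source of the subadditivity in time. -/
theorem timeIntegral_add (H J : E →L[ℂ] E) (S T : ℝ) :
    timeIntegral H J (S + T) = timeIntegral H J S + heisenberg H S (timeIntegral H J T) := by
  have hcont := continuous_heisenberg H J
  rw [← heisenbergCLM_apply, timeIntegral_map]
  simp only [heisenbergCLM_apply, ← heisenberg_add_time]
  rw [intervalIntegral.integral_comp_add_left (fun s => heisenberg H s J) S, add_zero,
    timeIntegral, timeIntegral, intervalIntegral.integral_add_adjacent_intervals
      (hcont.intervalIntegrable _ _) (hcont.intervalIntegrable _ _)]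

end Evolution

/-! ### The Lieb–Robinson bound. -/

section LiebRobinson

variable {N d dh : ℕ}

/-- The Hamiltonian with the interaction terms located at the points of `S`. -/
def hamiltonian (h : LocalMatrix N dh) (S : Finset ℤ) : Op N := ∑ x ∈ S, place x h

theorem homogeneousSum_eq (h : LocalMatrix N dh) (a b : ℤ) :
    homogeneousSum h a b = hamiltonian h (Finset.Icc a (b - dh + 1)) := rfl

theorem finiteEvolution_eq (h : LocalMatrix N dh) (a b : ℤ) (t : ℝ) (A : Op N) :
    finiteEvolution h a b t A = heisenberg (hamiltonian h (Finset.Icc a (b - dh + 1))) t A := by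
  rw [finiteEvolution, heisenberg, expI, expI, homogeneousSum_eq]
  simp

theorem isSelfAdjoint_hamiltonian {h : LocalMatrix N dh} (hh : h.IsHermitian) (S : Finset ℤ) :
    IsSelfAdjoint (hamiltonian h S) :=
  isSelfAdjoint_sum _ fun x _ => isSelfAdjoint_place x hh

theorem hamiltonian_neg (h : LocalMatrix N dh) (S : Finset ℤ) :
    hamiltonian (-h) S = -hamiltonian h S := by
  simp only [hamiltonian, place_neg, Finset.sum_neg_distrib]

theorem commute_hamiltonian {h : LocalMatrix N dh} {S : Finset ℤ} {A : Op N}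
    (hA : ∀ x ∈ S, Commute (place x h) A) : Commute (hamiltonian h S) A :=
  Commute.sum_left _ _ _ hA

theorem norm_hamiltonian_le (h : LocalMatrix N dh) (S : Finset ℤ) :
    ‖hamiltonian h S‖ ≤ S.card * ‖place 0 h‖ := by
  rw [hamiltonian, ← nsmul_eq_mul]
  exact norm_sum_le_of_le _ (fun x _ => norm_place_le x h) |>.trans (by simp)

/-- The points of `S` at distance at most about `k * D` from the window `y, …, y + d - 1`. -/
def near (S : Finset ℤ) (y : ℤ) (d D k : ℕ) : Finset ℤ :=
  S.filter fun x => y - (k + 1) * D < x ∧ x < y + d + k * D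

theorem mem_near {S : Finset ℤ} {y x : ℤ} {D k : ℕ} :
    x ∈ near S y d D k ↔ x ∈ S ∧ y - (k + 1) * D < x ∧ x < y + d + k * D := Finset.mem_filter

/-- This lets the induction hypothesis of the Lieb–Robinson bound be applied to the truncated set at
level `k + 1` while still comparing with level `k`. -/
theorem near_near_succ (S : Finset ℤ) (y : ℤ) (D k : ℕ) :
    near (near S y d D (k + 1)) y d D k = near S y d D k := by
  ext x
  simp only [mem_near]
  push_cast
  constructor
  · rintro ⟨⟨h1, -⟩, h2⟩
    exact ⟨h1, h2⟩
  · rintro ⟨h1, h2, h3⟩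
    exact ⟨⟨h1, by nlinarith, by nlinarith⟩, h2, h3⟩

theorem norm_commutator_le {E : Type*} [NormedAddCommGroup E] [InnerProductSpace ℂ E]
    (V X : E →L[ℂ] E) : ‖V * X - X * V‖ ≤ 2 * ‖V‖ * ‖X‖ := by
  calc _ ≤ ‖V * X‖ + ‖X * V‖ := norm_sub_le _ _
    _ ≤ ‖V‖ * ‖X‖ + ‖X‖ * ‖V‖ := add_le_add (norm_mul_le _ _) (norm_mul_le _ _)
    _ = _ := by ring

/-- The Lieb–Robinson bound for a chain with finite-range interaction: terms of the Hamiltonian at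
distance `k * D` influence the evolution of a local observable only in order `t ^ k / k!`. -/
theorem norm_heisenberg_sub_near_le_of_nonneg {h : LocalMatrix N dh} (hh : h.IsHermitian)
    (M : LocalMatrix N d) (y : ℤ) {D : ℕ} (hD : dh ≤ D) (k : ℕ) (S : Finset ℤ) {t : ℝ}
    (ht : 0 ≤ t) :
    ‖heisenberg (hamiltonian h S) t (place y M) -
        heisenberg (hamiltonian h (near S y d D k)) t (place y M)‖ ≤
      2 * ‖place y M‖ * ((2 * (2 * D * ‖place 0 h‖) * t) ^ k / k.factorial) := by
  induction k generalizing S t with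
  | zero =>
    refine (norm_sub_le _ _).trans ?_
    rw [norm_heisenberg (isSelfAdjoint_hamiltonian hh _),
      norm_heisenberg (isSelfAdjoint_hamiltonian hh _)]
    simp [two_mul]
  | succ k ih =>
    set A := place y M with hA
    -- The shell between two consecutive levels has at most `D` points on each side, so `v` bounds
    -- the norm of its Hamiltonian `V`.
    set v : ℝ := 2 * D * ‖place 0 h‖ with hv
    have hv0 : 0 ≤ v := by positivity
    set H' := hamiltonian h (near S y d D (k + 1)) with hH'
    set V := hamiltonian h (near S y d D (k + 2) \ near S y d D (k + 1)) with hV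
    set W := hamiltonian h (S \ near S y d D (k + 2)) with hW
    have hsub1 : near S y d D (k + 1) ⊆ near S y d D (k + 2) := by
      intro x
      simp only [mem_near]
      push_cast
      rintro ⟨h1, h2, h3⟩
      exact ⟨h1, by nlinarith, by nlinarith⟩
    have hsub2 : near S y d D (k + 2) ⊆ S := Finset.filter_subset _ _
    have hsum : H' - hamiltonian h S = -(V + W) := by
      have h1 : hamiltonian h S = W + hamiltonian h (near S y d D (k + 2)) :=
        (Finset.sum_sdiff hsub2).symm
      have h2 : hamiltonian h (near S y d D (k + 2)) = V + H' := (Finset.sum_sdiff hsub1).symm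
      rw [h1, h2]
      abel
    have hDz : (dh : ℤ) ≤ D := by exact_mod_cast hD
    have hfar (l : ℕ) {x : ℤ} (hxS : x ∈ S) (hx : x ∉ near S y d D l) :
        x ≤ y - (l + 1) * D ∨ y + d + l * D ≤ x := by
      by_contra hc
      push Not at hc
      exact hx (mem_near.2 ⟨hxS, hc.1, hc.2⟩)
    -- The far part `W` commutes with `A` and with `H'`, hence with `A` evolved by `H'`. The shell
    -- `V` commutes with `A` and with the Hamiltonian of level `k`, but not necessarily with `H'`.
    have hWA : Commute W A := commute_hamiltonian fun x hx => by
      obtain ⟨hxS, hx⟩ := Finset.mem_sdiff.1 hx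
      refine commute_place_of_disjoint ?_ _ _
      rcases hfar _ hxS hx with hx | hx <;> push_cast at hx
      · left; nlinarith
      · right; nlinarith
    have hVA : Commute V A := commute_hamiltonian fun x hx => by
      obtain ⟨hxS, hx⟩ := Finset.mem_sdiff.1 hx
      refine commute_place_of_disjoint ?_ _ _
      rcases hfar _ (hsub2 hxS) hx with hx | hx <;> push_cast at hx
      · left; nlinarith
      · right; nlinarith
    have hWH : Commute W H' := commute_hamiltonian fun x hx => by
      obtain ⟨hxS, hx⟩ := Finset.mem_sdiff.1 hx
      refine (commute_hamiltonian fun x' hx' => ?_).symm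
      refine commute_place_of_disjoint ?_ _ _
      have hx' := mem_near.1 hx'
      push_cast at hx'
      rcases hfar _ hxS hx with hx | hx <;> push_cast at hx
      · right; nlinarith
      · left; nlinarith
    have hVH : Commute V (hamiltonian h (near S y d D k)) := commute_hamiltonian fun x hx => by
      obtain ⟨hxS, hx⟩ := Finset.mem_sdiff.1 hx
      refine (commute_hamiltonian fun x' hx' => ?_).symm
      refine commute_place_of_disjoint ?_ _ _
      have hx' := mem_near.1 hx'
      rcases hfar _ (hsub2 hxS) hx with hx | hx <;> push_cast at hx
      · right; nlinarith
      · left; nlinarith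
    have hVn : ‖V‖ ≤ v := by
      refine (norm_hamiltonian_le _ _).trans (mul_le_mul_of_nonneg_right ?_ (norm_nonneg _))
      have hss : near S y d D (k + 2) \ near S y d D (k + 1) ⊆
          Finset.Ioc (y - (k + 3) * D) (y - (k + 2) * D) ∪
            Finset.Ico (y + d + (k + 1) * D) (y + d + (k + 2) * D) := by
        intro x hx
        obtain ⟨hxS, hx⟩ := Finset.mem_sdiff.1 hx
        have h1 := mem_near.1 hxS
        have h2 := hfar _ h1.1 hx
        push_cast at h1 h2
        simp only [Finset.mem_union, Finset.mem_Ioc, Finset.mem_Ico]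
        rcases h2 with h2 | h2
        · left; constructor <;> nlinarith
        · right; constructor <;> nlinarith
      have hcard := (Finset.card_le_card hss).trans (Finset.card_union_le _ _)
      rw [Int.card_Ioc, Int.card_Ico] at hcard
      have e1 : y - (k + 2) * D - (y - (k + 3) * D) = (D : ℤ) := by ring
      have e2 : y + d + (k + 2) * D - (y + d + (k + 1) * D) = (D : ℤ) := by ring
      rw [e1, e2, Int.toNat_natCast] at hcard
      have : ((near S y d D (k + 2) \ near S y d D (k + 1)).card : ℝ) ≤ ((D + D : ℕ) : ℝ) := by
        exact_mod_cast hcard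
      refine this.trans (le_of_eq ?_)
      push_cast
      ring
    have hmain := norm_heisenberg_sub_le (H := hamiltonian h S) (H' := H') (A := A)
      (isSelfAdjoint_hamiltonian hh S) (2 * v * (2 * ‖A‖ * ((2 * v) ^ k / k.factorial))) k ht (by
        intro u hu
        set X := heisenberg H' u A with hX
        set Y := heisenberg (hamiltonian h (near S y d D k)) u A with hY
        have hih := ih (near S y d D (k + 1)) hu.1
        rw [near_near_succ] at hih
        have hWX : W * X = X * W := (commute_heisenberg hWH hWA u).eq
        have hVY : V * Y = Y * V := (commute_heisenberg hVH hVA u).eq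
        -- Only the shell contributes to the commutator with `X`. Since it commutes with `Y`, `X`
        -- may be replaced by `X - Y`, which the induction hypothesis bounds; one time integration
        -- supplies the next power of `t`.
        have hcomm : (H' - hamiltonian h S) * X - X * (H' - hamiltonian h S) =
            -(V * (X - Y) - (X - Y) * V) := by
          rw [hsum, mul_sub, sub_mul, hVY, neg_mul, mul_neg, add_mul, mul_add, hWX]
          abel
        rw [hcomm, norm_neg]
        calc _ ≤ 2 * ‖V‖ * ‖X - Y‖ := norm_commutator_le _ _
          _ ≤ 2 * v * (2 * ‖A‖ * ((2 * v * u) ^ k / k.factorial)) := by gcongr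
          _ = _ := by rw [mul_pow (2 * v) u]; ring)
    refine hmain.trans (le_of_eq ?_)
    rw [Nat.factorial_succ]
    push_cast
    have : (k.factorial : ℝ) ≠ 0 := by positivity
    have : (k : ℝ) + 1 ≠ 0 := by positivity
    field_simp
    ring

/-- Negative times follow by reversing the sign of `h`. -/
theorem norm_heisenberg_sub_near_le {h : LocalMatrix N dh} (hh : h.IsHermitian)
    (M : LocalMatrix N d) (y : ℤ) {D : ℕ} (hD : dh ≤ D) (k : ℕ) (S : Finset ℤ) (t : ℝ) :
    ‖heisenberg (hamiltonian h S) t (place y M) -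
        heisenberg (hamiltonian h (near S y d D k)) t (place y M)‖ ≤
      2 * ‖place y M‖ * ((2 * (2 * D * ‖place 0 h‖) * |t|) ^ k / k.factorial) := by
  rcases le_total 0 t with ht | ht
  · rw [abs_of_nonneg ht]
    exact norm_heisenberg_sub_near_le_of_nonneg hh M y hD k S ht
  · rw [abs_of_nonpos ht]
    have := norm_heisenberg_sub_near_le_of_nonneg hh.neg M y hD k S (neg_nonneg.2 ht)
    simpa only [hamiltonian_neg, heisenberg_neg_left, neg_neg, place_neg, norm_neg] using this

/-- The constant in the exponential form of the Lieb–Robinson bound. -/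
def lrConst (h : LocalMatrix N dh) (M : LocalMatrix N d) (T : ℝ) : ℝ :=
  2 * ‖place 0 M‖ *
    Real.exp (2 * (2 * (dh + 1 : ℕ) * ‖place 0 h‖) * T * Real.exp (dh + 1 : ℕ))

theorem lrConst_nonneg (h : LocalMatrix N dh) (M : LocalMatrix N d) (T : ℝ) :
    0 ≤ lrConst h M T := by unfold lrConst; positivity

theorem two_mul_norm_le_lrConst (h : LocalMatrix N dh) (M : LocalMatrix N d) {T : ℝ} (hT : 0 ≤ T) :
    2 * ‖place 0 M‖ ≤ lrConst h M T :=
  le_mul_of_one_le_right (by positivity) (Real.one_le_exp (by positivity))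

/-- With `D = dh + 1`, write `x ^ k / k!` as `(x e^D) ^ k / k! * e^{-D k}` and bound the first
factor by `exp (x e^D)`. Taking `dh + 1` rather than `dh` keeps the step positive when `dh = 0`. -/
theorem norm_heisenberg_sub_near_le_exp {h : LocalMatrix N dh} (hh : h.IsHermitian)
    (M : LocalMatrix N d) (y : ℤ) (k : ℕ) (S : Finset ℤ) {t T : ℝ} (ht : |t| ≤ T) :
    ‖heisenberg (hamiltonian h S) t (place y M) -
        heisenberg (hamiltonian h (near S y d (dh + 1) k)) t (place y M)‖ ≤
      lrConst h M T * Real.exp (-((dh + 1) * k : ℕ)) := by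
  refine (norm_heisenberg_sub_near_le hh M y (Nat.le_succ dh) k S t).trans ?_
  rw [lrConst, mul_assoc (2 * ‖place 0 M‖)]
  have hT : 0 ≤ T := (abs_nonneg t).trans ht
  set v : ℝ := 2 * (2 * (dh + 1 : ℕ) * ‖place 0 h‖) with hv
  have hv0 : 0 ≤ v := by positivity
  have h1 : (v * |t|) ^ k / k.factorial ≤ (v * T) ^ k / k.factorial := by gcongr
  have h2 := Real.pow_div_factorial_le_exp (v * T * Real.exp (dh + 1 : ℕ)) (by positivity) k
  have h3 : (v * T) ^ k / k.factorial =
      (v * T * Real.exp (dh + 1 : ℕ)) ^ k / k.factorial * Real.exp (-((dh + 1) * k : ℕ)) := by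
    have he : Real.exp ((dh + 1 : ℕ) : ℝ) ^ k * Real.exp (-((dh + 1) * k : ℕ)) = 1 := by
      rw [← Real.exp_nat_mul, ← Real.exp_add]
      push_cast
      rw [Real.exp_eq_one_iff]
      ring
    rw [mul_pow _ (Real.exp _)]
    linear_combination (-(v * T) ^ k / k.factorial) * he
  gcongr
  · exact norm_place_le y M
  · rw [h3] at h1
    exact h1.trans (mul_le_mul_of_nonneg_right h2 (Real.exp_nonneg _))

/-- Two Hamiltonians that agree within distance `r` of a local observable evolve it alike. -/
theorem norm_heisenberg_sub_heisenberg_le {h : LocalMatrix N dh} (hh : h.IsHermitian)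
    (M : LocalMatrix N d) (y : ℤ) (r : ℕ) {S S' : Finset ℤ}
    (hS : ∀ x, |x - y| < r → (x ∈ S ↔ x ∈ S')) {t T : ℝ} (ht : |t| ≤ T) :
    ‖heisenberg (hamiltonian h S) t (place y M) - heisenberg (hamiltonian h S') t (place y M)‖ ≤
      2 * lrConst h M T * Real.exp (d + 2 * (dh + 1)) * Real.exp (-r) := by
  have hT : 0 ≤ T := (abs_nonneg t).trans ht
  have hK := lrConst_nonneg h M T
  rw [mul_assoc _ (Real.exp _), ← Real.exp_add]
  -- For small `r` the trivial norm bound suffices, because the exponential factor is then at least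
  -- one.
  by_cases hr : r < d + (dh + 1)
  · refine (norm_sub_le _ _).trans ?_
    rw [norm_heisenberg (isSelfAdjoint_hamiltonian hh _),
      norm_heisenberg (isSelfAdjoint_hamiltonian hh _)]
    have h1 := two_mul_norm_le_lrConst h M hT
    have h2 := norm_place_le y M
    have h3 : (1 : ℝ) ≤ Real.exp (d + 2 * (dh + 1) + -r) := by
      refine Real.one_le_exp ?_
      have : (r : ℝ) < d + (dh + 1) := by exact_mod_cast hr
      have : (0 : ℝ) ≤ dh := by positivity
      linarith
    have h4 := le_mul_of_one_le_right (by positivity : 0 ≤ 2 * lrConst h M T) h3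
    linarith
  · push Not at hr
    -- This choice keeps the level-`k` neighbourhood within distance `r`, where `S` and `S'` agree.
    -- Rounding down costs less than `dh + 1` in the exponent.
    set k := (r - (d + (dh + 1))) / (dh + 1) with hk
    have hk1 : (dh + 1) * k ≤ r - (d + (dh + 1)) := Nat.mul_div_le _ _
    have hk2 : r - (d + (dh + 1)) < (dh + 1) * k + (dh + 1) := Nat.lt_mul_div_succ _ (by omega)
    have hnear : near S y d (dh + 1) k = near S' y d (dh + 1) k := by
      ext x
      simp only [mem_near]
      refine and_congr_left fun hx => hS x ?_
      have h5 : ((dh + 1 : ℕ) : ℤ) * k + (d + (dh + 1)) ≤ r := by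
        have : (dh + 1) * k + (d + (dh + 1)) ≤ r := by omega
        exact_mod_cast this
      push_cast at hx h5
      rw [abs_lt]
      constructor <;> nlinarith
    have h1 := norm_heisenberg_sub_near_le_exp hh M y k S ht
    have h2 := norm_heisenberg_sub_near_le_exp hh M y k S' ht
    rw [← hnear, norm_sub_rev] at h2
    have h3 := norm_sub_le_norm_sub_add_norm_sub
      (heisenberg (hamiltonian h S) t (place y M))
      (heisenberg (hamiltonian h (near S y d (dh + 1) k)) t (place y M))
      (heisenberg (hamiltonian h S') t (place y M))
    have h4 : Real.exp (-((dh + 1) * k : ℕ)) ≤ Real.exp (d + 2 * (dh + 1) + -r) := by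
      refine Real.exp_le_exp.2 ?_
      have : r ≤ (dh + 1) * k + (d + 2 * (dh + 1)) := by omega
      have : (r : ℝ) ≤ ((dh + 1) * k : ℕ) + (d + 2 * (dh + 1)) := by exact_mod_cast this
      linarith
    have h5 := mul_le_mul_of_nonneg_left h4 hK
    linarith

end LiebRobinson

/-! ### Localization of truncated evolutions and decay of correlations. -/

section WindowAlgebra

variable {N d d' dh : ℕ}

/-- The local algebra of a window, as a *-subalgebra. -/
def windowAlgebra (N : ℕ) (x : ℤ) (d : ℕ) : StarSubalgebra ℂ (Op N) where
  toSubalgebra := (placeHom N d x).range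
  star_mem' := by
    rintro _ ⟨M, rfl⟩
    exact ⟨_, (star_place x M).symm⟩

theorem mem_windowAlgebra {x : ℤ} {A : Op N} :
    A ∈ windowAlgebra N x d ↔ ∃ M : LocalMatrix N d, place x M = A := Iff.rfl

theorem isClosed_windowAlgebra (x : ℤ) : IsClosed (windowAlgebra N x d : Set (Op N)) := by
  have : (windowAlgebra N x d : Set (Op N)) =
      (LinearMap.range (placeHom N d x).toLinearMap : Set (Op N)) := rfl
  rw [this]
  exact Submodule.closed_of_finiteDimensional _

/-- The algebra of a window is finite-dimensional, hence closed, so it contains the exponentials of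
its elements. The truncated Hamiltonian and the observable both lie in the stated window. -/
theorem heisenberg_near_mem (h : LocalMatrix N dh) (M : LocalMatrix N d) (y : ℤ) (k : ℕ)
    (S : Finset ℤ) (t : ℝ) :
    heisenberg (hamiltonian h (near S y d (dh + 1) k)) t (place y M) ∈
      windowAlgebra N (y - (k + 1) * (dh + 1)) (d + (2 * k + 2) * (dh + 1)) := by
  refine heisenberg_mem (isClosed_windowAlgebra _) (sum_mem fun x hx => ?_) ?_ t
  · have hx := mem_near.1 hx
    push_cast at hx
    refine mem_windowAlgebra.2 (exists_place_enlarge ?_ ?_ h)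
    · nlinarith
    · push_cast
      nlinarith
  · refine mem_windowAlgebra.2 (exists_place_enlarge ?_ ?_ M)
    · have : (0 : ℤ) ≤ (k + 1) * (dh + 1) := by positivity
      linarith
    · have : (0 : ℤ) ≤ (k + 1) * (dh + 1) := by positivity
      push_cast
      nlinarith

theorem hamiltonian_mem (h : LocalMatrix N dh) (S : Finset ℤ) :
    hamiltonian h S ∈ quasiLocalAlgebra N := sum_mem fun x _ => place_mem x h

/-- Correlations with a traceless local observable decay exponentially in the distance. -/
theorem norm_traceFun_place_mul_heisenberg_le [NeZero N] {h : LocalMatrix N dh}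
    (hh : h.IsHermitian) (M : LocalMatrix N d) (M' : LocalMatrix N d')
    (hM' : tracialState (place 0 M') = 0) (x y : ℤ) (S : Finset ℤ) {t T : ℝ} (ht : |t| ≤ T) :
    ‖traceFun N (place x M' * heisenberg (hamiltonian h S) t (place y M))‖ ≤
      ‖place 0 M'‖ * lrConst h M T * Real.exp (d + d' + 3 * (dh + 1)) *
        Real.exp (-(|x - y| : ℤ)) := by
  have hT : 0 ≤ T := (abs_nonneg t).trans ht
  have hK := lrConst_nonneg h M T
  rw [mul_assoc _ (Real.exp _), ← Real.exp_add]
  obtain ⟨r, hr⟩ : ∃ r : ℕ, |x - y| = r := ⟨(x - y).natAbs, (Int.natCast_natAbs _).symm⟩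
  rw [hr]
  by_cases hrs : r < d + d' + 2 * (dh + 1)
  · refine (norm_traceFun_le _).trans ((norm_mul_le _ _).trans ?_)
    rw [norm_heisenberg (isSelfAdjoint_hamiltonian hh _)]
    have h3 : (1 : ℝ) ≤ Real.exp (d + d' + 3 * (dh + 1) + -((r : ℤ) : ℝ)) := by
      refine Real.one_le_exp ?_
      have : (r : ℝ) < d + d' + 2 * (dh + 1) := by exact_mod_cast hrs
      have : (0 : ℝ) ≤ dh := by positivity
      rw [Int.cast_natCast]
      linarith
    have h1 := two_mul_norm_le_lrConst h M hT
    calc _ ≤ ‖place 0 M'‖ * lrConst h M T := by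
          gcongr
          · exact norm_place_le x M'
          · have := norm_place_le y M
            have := norm_nonneg (place 0 M)
            linarith
      _ ≤ _ := le_mul_of_one_le_right (by positivity) h3
  · push Not at hrs
    -- This level keeps the window of the truncated evolution disjoint from that of `M'`. The
    -- product state then factorizes, and tracelessness of `M'` leaves only the Lieb–Robinson error.
    set k := (r - (d + d' + 2 * (dh + 1))) / (dh + 1) with hk
    have hk1 : (dh + 1) * k ≤ r - (d + d' + 2 * (dh + 1)) := Nat.mul_div_le _ _
    have hk2 : r - (d + d' + 2 * (dh + 1)) < (dh + 1) * k + (dh + 1) :=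
      Nat.lt_mul_div_succ _ (by omega)
    obtain ⟨L, hL⟩ := mem_windowAlgebra.1 (heisenberg_near_mem h M y k S t)
    have hdisj : DisjointWindows x d' (y - (k + 1) * (dh + 1)) (d + (2 * k + 2) * (dh + 1)) := by
      have h5 : ((dh + 1 : ℕ) : ℤ) * k + (d + d' + 2 * (dh + 1)) ≤ r := by
        have : (dh + 1) * k + (d + d' + 2 * (dh + 1)) ≤ r := by omega
        exact_mod_cast this
      push_cast at h5
      unfold DisjointWindows
      push_cast
      rcases abs_cases (x - y) with ⟨h6, h7⟩ | ⟨h6, h7⟩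
      · right; nlinarith
      · left; nlinarith
    have hzero : traceFun N (place x M' *
        heisenberg (hamiltonian h (near S y d (dh + 1) k)) t (place y M)) = 0 := by
      rw [← hL, traceFun_eq (mul_mem (place_mem _ _) (place_mem _ _)),
        tracialState_mul_place_of_disjoint hdisj, tracialState_place, ← tracialState_place 0, hM',
        zero_mul]
    rw [← sub_zero (traceFun N _), ← hzero, ← map_sub, ← mul_sub]
    refine (norm_traceFun_le _).trans ((norm_mul_le _ _).trans ?_)
    rw [mul_assoc]
    have h1 := norm_heisenberg_sub_near_le_exp hh M y k S ht
    have h4 : Real.exp (-((dh + 1) * k : ℕ)) ≤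
        Real.exp (d + d' + 3 * (dh + 1) + -((r : ℤ) : ℝ)) := by
      refine Real.exp_le_exp.2 ?_
      have : r ≤ (dh + 1) * k + (d + d' + 3 * (dh + 1)) := by omega
      have : (r : ℝ) ≤ ((dh + 1) * k : ℕ) + (d + d' + 3 * (dh + 1)) := by exact_mod_cast this
      rw [Int.cast_natCast]
      linarith
    have h5 := mul_le_mul_of_nonneg_left h4 hK
    have h6 := norm_place_le x M'
    gcongr
    exact h1.trans h5

end WindowAlgebra

/-! ### The infinite-volume dynamics. -/

section InfiniteVolume

variable {N d d' dh : ℕ}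

theorem exists_tendsto_of_eventually_near {α ι : Type*} [MetricSpace α] [CompleteSpace α]
    {l : Filter ι} [l.NeBot] {f : ι → α} (hf : ∀ ε > 0, ∃ z, ∀ᶠ i in l, dist (f i) z < ε) :
    ∃ z, Tendsto f l (𝓝 z) := by
  have hc : Cauchy (map f l) := by
    refine Metric.cauchy_iff.2 ⟨inferInstance, fun ε hε => ?_⟩
    obtain ⟨z, hz⟩ := hf (ε / 2) (by positivity)
    refine ⟨Metric.ball z (ε / 2), hz, fun x hx y hy => ?_⟩
    rw [Metric.mem_ball] at hx hy
    have := dist_triangle_right x y z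
    linarith
  exact CompleteSpace.complete hc

/-- Approximate `A` by a local observable, at a cost independent of the volume since each finite
evolution is isometric. For the local observable, all large intervals give nearly the evolution of
one fixed interval around it, so the evolutions are Cauchy. -/
theorem tendsto_finiteEvolution {h : LocalMatrix N dh} (hh : h.IsHermitian) (t : ℝ) {A : Op N}
    (hA : A ∈ quasiLocalAlgebra N) :
    Tendsto (fun p : ℤ × ℤ => finiteEvolution h p.1 p.2 t A) (atBot ×ˢ atTop)
      (𝓝 (evolution h t A)) := by
  refine tendsto_nhds_limUnder (exists_tendsto_of_eventually_near fun ε hε => ?_)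
  obtain ⟨y, d, M, hM⟩ := exists_local_near hA (half_pos hε)
  have hlim : Tendsto (fun r : ℕ => 2 * lrConst h M |t| * Real.exp (d + 2 * (dh + 1)) *
      Real.exp (-(r : ℝ))) atTop (𝓝 0) := by
    have := (Real.tendsto_exp_neg_atTop_nhds_zero.comp tendsto_natCast_atTop_atTop).const_mul
      (2 * lrConst h M |t| * Real.exp (d + 2 * (dh + 1)))
    simpa using this
  obtain ⟨r, hr⟩ := (hlim.eventually (gt_mem_nhds (half_pos hε))).exists
  refine ⟨heisenberg (hamiltonian h (Finset.Icc (y - r) (y + r))) t (place y M), ?_⟩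
  filter_upwards [(eventually_le_atBot (y - r)).prod_mk (eventually_ge_atTop (y + r + dh))]
    with p hp
  rw [finiteEvolution_eq, dist_eq_norm]
  have h1 := norm_heisenberg_sub_heisenberg_le hh M y r
    (S := Finset.Icc p.1 (p.2 - dh + 1)) (S' := Finset.Icc (y - r) (y + r)) (t := t) (fun x hx => by
      rw [abs_lt] at hx
      simp only [Finset.mem_Icc]
      omega) le_rfl
  have h2 : ‖heisenberg (hamiltonian h (Finset.Icc p.1 (p.2 - dh + 1))) t A -
      heisenberg (hamiltonian h (Finset.Icc p.1 (p.2 - dh + 1))) t (place y M)‖ < ε / 2 := by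
    rwa [← heisenberg_sub, norm_heisenberg (isSelfAdjoint_hamiltonian hh _)]
  have h3 := norm_sub_le_norm_sub_add_norm_sub
    (heisenberg (hamiltonian h (Finset.Icc p.1 (p.2 - dh + 1))) t A)
    (heisenberg (hamiltonian h (Finset.Icc p.1 (p.2 - dh + 1))) t (place y M))
    (heisenberg (hamiltonian h (Finset.Icc (y - r) (y + r))) t (place y M))
  linarith

theorem evolution_mem {h : LocalMatrix N dh} (hh : h.IsHermitian) (t : ℝ) {A : Op N}
    (hA : A ∈ quasiLocalAlgebra N) : evolution h t A ∈ quasiLocalAlgebra N := by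
  refine isClosed_quasiLocalAlgebra.mem_of_tendsto (tendsto_finiteEvolution hh t hA)
    (Eventually.of_forall fun p => ?_)
  rw [finiteEvolution_eq]
  exact heisenberg_mem isClosed_quasiLocalAlgebra (hamiltonian_mem _ _) hA t

theorem evolution_sum {ι : Type*} {h : LocalMatrix N dh} (hh : h.IsHermitian) (t : ℝ)
    (s : Finset ι) {A : ι → Op N} (hA : ∀ i ∈ s, A i ∈ quasiLocalAlgebra N) :
    evolution h t (∑ i ∈ s, A i) = ∑ i ∈ s, evolution h t (A i) := by
  refine tendsto_nhds_unique (tendsto_finiteEvolution hh t (sum_mem hA)) ?_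
  have := tendsto_finsetSum s fun i hi => tendsto_finiteEvolution hh t (hA i hi)
  refine this.congr fun p => ?_
  simp only [finiteEvolution_eq, heisenberg_sum]

theorem translate_homogeneousSum (h : LocalMatrix N dh) (a b c : ℤ) :
    translate c (homogeneousSum h a b) = homogeneousSum h (a + c) (b + c) := by
  have e : b + c - dh + 1 = (b - dh + 1) + c := by ring
  rw [homogeneousSum, homogeneousSum, ← translateCLM_apply, map_sum, e,
    ← Finset.image_add_right_Icc, Finset.sum_image (fun _ _ _ _ => by simp)]
  simp only [translateCLM_apply, translate_place]

theorem translate_heisenberg (c : ℤ) (H A : Op N) (t : ℝ) :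
    translate c (heisenberg H t A) = heisenberg (translate c H) t (translate c A) := by
  let _ : NormedAlgebra ℚ (Op N) := NormedAlgebra.restrictScalars ℚ ℂ (Op N)
  have hexp (u : ℝ) : translate c (expI H u) = expI (translate c H) u := by
    rw [expI, expI, ← translateHom_apply, NormedSpace.map_exp (translateHom N c)
      (continuous_translate c), map_smul, translateHom_apply]
  rw [heisenberg, translate_mul, translate_mul, hexp, hexp, heisenberg]

theorem translate_mem (c : ℤ) {A : Op N} (hA : A ∈ quasiLocalAlgebra N) :
    translate c A ∈ quasiLocalAlgebra N := by
  refine quasiLocal_induction (p := fun A => translate c A ∈ quasiLocalAlgebra N) ?_ ?_ hA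
  · exact isClosed_quasiLocalAlgebra.preimage (continuous_translate c)
  · intro x d M
    rw [translate_place]
    exact place_mem _ _

/-- Translation carries the dynamics of `[a, b]` to that of `[a + c, b + c]`, and shifted intervals
still exhaust the chain. -/
theorem translate_evolution {h : LocalMatrix N dh} (hh : h.IsHermitian) (c : ℤ) (t : ℝ) {A : Op N}
    (hA : A ∈ quasiLocalAlgebra N) :
    translate c (evolution h t A) = evolution h t (translate c A) := by
  have h1 := ((continuous_translate c).tendsto _).comp (tendsto_finiteEvolution hh t hA)
  have h2 := tendsto_finiteEvolution hh t (translate_mem c hA)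
  have hc : Tendsto (fun p : ℤ × ℤ => (p.1 + c, p.2 + c)) (atBot ×ˢ atTop) (atBot ×ˢ atTop) :=
    (tendsto_atBot_add_const_right _ c tendsto_id).prodMap
      (tendsto_atTop_add_const_right _ c tendsto_id)
  refine tendsto_nhds_unique h1 ((h2.comp hc).congr fun p => ?_)
  simp only [Function.comp_apply, finiteEvolution_eq, ← homogeneousSum_eq, translate_heisenberg,
    translate_homogeneousSum]

theorem norm_evolution_sub_heisenberg_le {h : LocalMatrix N dh} (hh : h.IsHermitian)
    (M : LocalMatrix N d) (y : ℤ) (r : ℕ) {S : Finset ℤ} (hS : ∀ x, |x - y| < r → x ∈ S)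
    {t T : ℝ} (ht : |t| ≤ T) :
    ‖evolution h t (place y M) - heisenberg (hamiltonian h S) t (place y M)‖ ≤
      2 * lrConst h M T * Real.exp (d + 2 * (dh + 1)) * Real.exp (-r) := by
  refine le_of_tendsto ((tendsto_finiteEvolution hh t (place_mem y M)).sub_const _).norm ?_
  filter_upwards [(eventually_le_atBot (y - r)).prod_mk (eventually_ge_atTop (y + r + dh))]
    with p hp
  rw [finiteEvolution_eq]
  refine norm_heisenberg_sub_heisenberg_le hh M y r (fun x hx => ?_) ht
  have hx' := hS x hx
  rw [abs_lt] at hx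
  simp only [Finset.mem_Icc, hx', iff_true]
  omega

/-- The finite-volume evolutions are continuous in time, and the Lieb–Robinson bound makes their
convergence locally uniform. -/
theorem continuous_evolution_place {h : LocalMatrix N dh} (hh : h.IsHermitian)
    (M : LocalMatrix N d) (y : ℤ) : Continuous fun t => evolution h t (place y M) := by
  refine continuous_iff_continuousAt.2 fun t => ?_
  refine continuousAt_of_locally_uniform_approx_of_continuousAt fun u hu => ?_
  obtain ⟨ε, hε, hεu⟩ := Metric.mem_uniformity_dist.1 hu
  have hlim : Tendsto (fun r : ℕ => 2 * lrConst h M (|t| + 1) * Real.exp (d + 2 * (dh + 1)) *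
      Real.exp (-(r : ℝ))) atTop (𝓝 0) := by
    have := (Real.tendsto_exp_neg_atTop_nhds_zero.comp tendsto_natCast_atTop_atTop).const_mul
      (2 * lrConst h M (|t| + 1) * Real.exp (d + 2 * (dh + 1)))
    simpa using this
  obtain ⟨r, hr⟩ := (hlim.eventually (gt_mem_nhds hε)).exists
  refine ⟨Metric.ball t 1, Metric.ball_mem_nhds t one_pos,
    fun s => heisenberg (hamiltonian h (Finset.Icc (y - r) (y + r))) s (place y M),
    (continuous_heisenberg _ _).continuousAt, fun s hs => hεu ?_⟩
  rw [dist_eq_norm]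
  refine (norm_evolution_sub_heisenberg_le hh M y r (fun x hx => ?_) ?_).trans_lt hr
  · rw [abs_lt] at hx
    rw [Finset.mem_Icc]
    omega
  · rw [Metric.mem_ball, Real.dist_eq] at hs
    have := abs_sub_abs_le_abs_sub s t
    linarith

theorem norm_traceFun_place_mul_evolution_le [NeZero N] {h : LocalMatrix N dh}
    (hh : h.IsHermitian) (M : LocalMatrix N d) (M' : LocalMatrix N d')
    (hM' : tracialState (place 0 M') = 0) (x y : ℤ) {t T : ℝ} (ht : |t| ≤ T) :
    ‖traceFun N (place x M' * evolution h t (place y M))‖ ≤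
      ‖place 0 M'‖ * lrConst h M T * Real.exp (d + d' + 3 * (dh + 1)) *
        Real.exp (-(|x - y| : ℤ)) := by
  have hcont : Continuous fun A => traceFun N (place x M' * A) := by fun_prop
  refine le_of_tendsto ((hcont.tendsto _).comp
    (tendsto_finiteEvolution hh t (place_mem y M))).norm (Eventually.of_forall fun p => ?_)
  rw [Function.comp_apply, finiteEvolution_eq]
  exact norm_traceFun_place_mul_heisenberg_le hh M M' hM' x y _ ht

theorem traceFun_place_mul_evolution_add [NeZero N] {h : LocalMatrix N dh}
    (hh : h.IsHermitian) (M : LocalMatrix N d) (M' : LocalMatrix N d') (x y c : ℤ) (t : ℝ) :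
    traceFun N (place (x + c) M' * evolution h t (place (y + c) M)) =
      traceFun N (place x M' * evolution h t (place y M)) := by
  have h1 := mul_mem (place_mem x M') (evolution_mem hh t (place_mem y M))
  have h2 := mul_mem (place_mem (x + c) M') (evolution_mem hh t (place_mem (y + c) M))
  rw [traceFun_eq h1, traceFun_eq h2, ← tracialState_translate c (place x M' * _), translate_mul,
    translate_place, translate_evolution hh c t (place_mem y M), translate_place]

theorem traceFun_place_mul_place_add [NeZero N] (M : LocalMatrix N d) (M' : LocalMatrix N d')
    (x y c : ℤ) :
    traceFun N (place (x + c) M' * place (y + c) M) = traceFun N (place x M' * place y M) := by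
  rw [traceFun_eq (mul_mem (place_mem _ _) (place_mem _ _)),
    traceFun_eq (mul_mem (place_mem _ _) (place_mem _ _)),
    ← tracialState_translate c (place x M' * _), translate_mul, translate_place, translate_place]

theorem summable_exp_neg_abs : Summable fun z : ℤ => Real.exp (-(|z| : ℤ)) := by
  have h := summable_geometric_of_lt_one (Real.exp_nonneg (-1))
    (by rw [← Real.exp_zero]; exact Real.exp_lt_exp.2 (by norm_num))
  have h' : Summable fun n : ℕ => Real.exp (-(n : ℝ)) := by
    refine h.congr fun n => ?_
    rw [← Real.exp_nat_mul]
    ring_nf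
  refine Summable.of_nat_of_neg ?_ ?_ <;> simpa using h'

end InfiniteVolume

/-! ### Averages of kernels over pairs of sites. -/

section Averages

variable {ι : Type*}

/-- The contribution of pairs at distance `z` to the average of `c` over pairs of sites. -/
def diagonalAverage (ℓ ℓ' : ι → ℕ) (c : ℕ → ι → ℤ → ℤ → ℂ) (n : ℕ) (p : ι × ℤ) : ℂ :=
  1 / (n : ℂ) * ∑ y ∈ Finset.Icc (1 : ℤ) (n - ℓ' p.1 + 1),
    if y + p.2 ∈ Finset.Icc (1 : ℤ) (n - ℓ p.1 + 1) then c n p.1 (y + p.2) y else 0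

theorem norm_diagonalAverage_le {ℓ ℓ' : ι → ℕ} {c : ℕ → ι → ℤ → ℤ → ℂ} {g : ι × ℤ → ℝ}
    (hc : ∀ n i x y, ‖c n i x y‖ ≤ g (i, x - y)) (n : ℕ) (p : ι × ℤ) :
    ‖diagonalAverage ℓ ℓ' c n p‖ ≤ 2 * g p := by
  have hg : 0 ≤ g p := (norm_nonneg _).trans (by simpa using hc n p.1 p.2 0)
  rcases Nat.eq_zero_or_pos n with rfl | hn
  · simpa [diagonalAverage] using hg
  have hsum : ‖∑ y ∈ Finset.Icc (1 : ℤ) (n - ℓ' p.1 + 1),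
      (if y + p.2 ∈ Finset.Icc (1 : ℤ) (n - ℓ p.1 + 1) then c n p.1 (y + p.2) y else 0)‖ ≤
      (2 * n) * g p := by
    refine (norm_sum_le_of_le _ (f := fun y => if y + p.2 ∈ Finset.Icc (1 : ℤ) (n - ℓ p.1 + 1)
      then c n p.1 (y + p.2) y else 0) (n := fun _ => g p) fun y _ => ?_).trans ?_
    · split_ifs
      · simpa using hc n p.1 (y + p.2) y
      · simpa using hg
    · rw [Finset.sum_const, nsmul_eq_mul]
      gcongr
      rw [Int.card_Icc]
      -- A window of length zero has `n + 1` positions; hence the factor `2`, valid since `n` is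
      -- positive.
      have : (n - ℓ' p.1 + 1 + 1 - 1 : ℤ).toNat ≤ 2 * n := by omega
      exact_mod_cast this
  rw [diagonalAverage, norm_mul, norm_div, norm_one, Complex.norm_natCast]
  have hn' : (0 : ℝ) < n := by exact_mod_cast hn
  calc _ ≤ 1 / (n : ℝ) * ((2 * n) * g p) := by gcongr
    _ = 2 * g p := by field_simp

theorem tendsto_diagonalAverage {ℓ ℓ' : ι → ℕ} {c : ℕ → ι → ℤ → ℤ → ℂ} {c' : ι × ℤ → ℂ}
    {g : ι × ℤ → ℝ} (hc : ∀ n i x y, ‖c n i x y‖ ≤ g (i, x - y)) (p : ι × ℤ)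
    (hbulk : ∀ ε > 0, ∃ r : ℕ, ∀ (n : ℕ) (y : ℤ), (r : ℤ) ≤ y → y ≤ n - r →
      ‖c n p.1 (y + p.2) y - c' p‖ ≤ ε) :
    Tendsto (fun n => diagonalAverage ℓ ℓ' c n p) atTop (𝓝 (c' p)) := by
  have hg : 0 ≤ g p := (norm_nonneg _).trans (by simpa using hc 0 p.1 p.2 0)
  rw [Metric.tendsto_atTop']
  intro ε hε
  obtain ⟨r, hr⟩ := hbulk (ε / 2) (half_pos hε)
  -- For `y` in `[R, n - R]` both windows lie in `[1, n]` and the bulk estimate applies. At most `2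
  -- * R` positions remain, negligible after division by `n`.
  set R : ℕ := r + p.2.natAbs + ℓ p.1 + ℓ' p.1 + 2 with hR
  have hlim : Tendsto (fun n : ℕ => 2 * R * (g p + ‖c' p‖) / (n : ℝ)) atTop (𝓝 0) :=
    tendsto_const_div_atTop_nhds_zero_nat _
  obtain ⟨n₀, hn₀⟩ := eventually_atTop.1 (hlim.eventually (gt_mem_nhds (half_pos hε)))
  refine ⟨max n₀ (2 * R), fun n hn => ?_⟩
  have hn1 : n₀ ≤ n := by omega
  have hn2 : 2 * R < n := by omega
  have hn' : (0 : ℝ) < n := by exact_mod_cast (by omega : 0 < n)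
  set I := Finset.Icc (1 : ℤ) (n - ℓ' p.1 + 1) with hI
  set B := Finset.Icc (R : ℤ) (n - R) with hB
  set u : ℤ → ℂ := fun y =>
    if y + p.2 ∈ Finset.Icc (1 : ℤ) (n - ℓ p.1 + 1) then c n p.1 (y + p.2) y else 0 with hu
  have hBI : B ⊆ I := by
    intro y
    simp only [hB, hI, Finset.mem_Icc]
    omega
  have hBcard : (B.card : ℤ) = n - 2 * R + 1 := by
    rw [hB, Int.card_Icc]
    omega
  have hIcard : ((I \ B).card : ℤ) ≤ 2 * R := by
    have h1 := Finset.card_sdiff_add_card_eq_card hBI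
    have h2 : (I.card : ℤ) ≤ n + 1 := by
      rw [hI, Int.card_Icc]
      omega
    omega
  have huB : ∀ y ∈ B, ‖u y - c' p‖ ≤ ε / 2 := by
    intro y hy
    simp only [hB, Finset.mem_Icc] at hy
    rw [hu]
    simp only
    rw [if_pos (by simp only [Finset.mem_Icc]; omega)]
    exact hr n y (by omega) (by omega)
  have hug (y : ℤ) : ‖u y‖ ≤ g p := by
    rw [hu]
    simp only
    split_ifs
    · simpa using hc n p.1 (y + p.2) y
    · simpa using hg
  have hdecomp : ∑ y ∈ I, u y - n * c' p =
      ∑ y ∈ B, (u y - c' p) + ∑ y ∈ I \ B, u y + (B.card - n : ℂ) * c' p := by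
    rw [← Finset.sum_sdiff hBI, Finset.sum_sub_distrib, Finset.sum_const, nsmul_eq_mul]
    ring
  have hcardn : ‖(B.card - n : ℂ)‖ ≤ 2 * R := by
    have : ((B.card : ℂ) - n) = ((1 - 2 * R : ℤ) : ℂ) := by
      have h1 : ((B.card : ℤ) : ℂ) = ((n - 2 * R + 1 : ℤ) : ℂ) := by rw [hBcard]
      push_cast at h1 ⊢
      rw [h1]
      ring
    rw [this, Complex.norm_intCast]
    have h2 : |(1 - 2 * R : ℤ)| ≤ 2 * R := by rw [abs_le]; omega
    exact_mod_cast h2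
  have hnorm : ‖∑ y ∈ I, u y - n * c' p‖ ≤ n * (ε / 2) + 2 * R * (g p + ‖c' p‖) := by
    rw [hdecomp]
    have h1 : ‖∑ y ∈ B, (u y - c' p)‖ ≤ n * (ε / 2) := by
      refine (norm_sum_le_of_le _ huB).trans ?_
      rw [Finset.sum_const, nsmul_eq_mul]
      gcongr
      omega
    have h2 : ‖∑ y ∈ I \ B, u y‖ ≤ 2 * R * g p := by
      refine (norm_sum_le_of_le _ fun y _ => hug y).trans ?_
      rw [Finset.sum_const, nsmul_eq_mul]
      gcongr
      exact_mod_cast hIcard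
    have h3 : ‖(B.card - n : ℂ) * c' p‖ ≤ 2 * R * ‖c' p‖ := by
      rw [norm_mul]
      gcongr
    refine (norm_add₃_le).trans ?_
    linarith
  have heq : diagonalAverage ℓ ℓ' c n p - c' p = 1 / (n : ℂ) * (∑ y ∈ I, u y - n * c' p) := by
    rw [diagonalAverage, mul_sub, ← mul_assoc, one_div_mul_cancel, one_mul]
    exact_mod_cast hn'.ne'
  rw [dist_eq_norm, heq, norm_mul, norm_div, norm_one, Complex.norm_natCast]
  calc _ ≤ 1 / (n : ℝ) * (n * (ε / 2) + 2 * R * (g p + ‖c' p‖)) := by gcongr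
    _ = ε / 2 + 2 * R * (g p + ‖c' p‖) / n := by field_simp
    _ < ε := by linarith [hn₀ n hn1]

/-- Pairs are regrouped by distance `x - y`. The hypothesis on `s` says that an index outside `s n`
has a window longer than the chain, so its sum is empty. -/
theorem tsum_diagonalAverage {ℓ ℓ' : ι → ℕ} {s : ℕ → Finset ι}
    (hs : ∀ n, ∀ i ∉ s n, n < ℓ i ∨ n < ℓ' i) (c : ℕ → ι → ℤ → ℤ → ℂ) (n : ℕ) :
    ∑' p, diagonalAverage ℓ ℓ' c n p =
      1 / (n : ℂ) * ∑ i ∈ s n, ∑ x ∈ Finset.Icc (1 : ℤ) (n - ℓ i + 1),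
        ∑ y ∈ Finset.Icc (1 : ℤ) (n - ℓ' i + 1), c n i x y := by
  rw [tsum_eq_sum (s := s n ×ˢ Finset.Icc (-(n : ℤ)) n), Finset.sum_product, Finset.mul_sum]
  · refine Finset.sum_congr rfl fun i _ => ?_
    simp only [diagonalAverage]
    rw [← Finset.mul_sum, Finset.sum_comm, Finset.sum_comm (s := Finset.Icc (1 : ℤ) (n - ℓ i + 1))]
    congr 1
    refine Finset.sum_congr rfl fun y hy => ?_
    rw [← Finset.sum_filter]
    refine Finset.sum_nbij' (fun z => y + z) (fun x => x - y) ?_ ?_ ?_ ?_ ?_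
    · intro z hz
      exact (Finset.mem_filter.1 hz).2
    · intro x hx
      simp only [Finset.mem_filter, Finset.mem_Icc] at hx hy ⊢
      omega
    · intro z _
      simp
    · intro x _
      simp
    · intro z _
      rfl
  · rintro ⟨i, z⟩ hp
    simp only [Finset.mem_product, not_and_or] at hp
    rw [diagonalAverage, Finset.sum_eq_zero, mul_zero]
    intro y hy
    refine if_neg fun hyz => ?_
    simp only [Finset.mem_Icc] at hy hyz hp
    rcases hp with hp | hp
    · rcases hs n i hp with h | h <;> omega
    · omega

/-- Averages of a decaying, asymptotically translation-invariant kernel over pairs of sites of a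
long interval converge to the sum of the kernel over all distances. -/
theorem tendsto_pair_average {ℓ ℓ' : ι → ℕ} {s : ℕ → Finset ι}
    (hs : ∀ n, ∀ i ∉ s n, n < ℓ i ∨ n < ℓ' i) {c : ℕ → ι → ℤ → ℤ → ℂ} {c' : ι × ℤ → ℂ}
    {g : ι × ℤ → ℝ} (hg : Summable g) (hc : ∀ n i x y, ‖c n i x y‖ ≤ g (i, x - y))
    (hbulk : ∀ p : ι × ℤ, ∀ ε > 0, ∃ r : ℕ, ∀ (n : ℕ) (y : ℤ), (r : ℤ) ≤ y → y ≤ n - r →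
      ‖c n p.1 (y + p.2) y - c' p‖ ≤ ε) :
    Tendsto (fun n : ℕ => 1 / (n : ℂ) * ∑ i ∈ s n, ∑ x ∈ Finset.Icc (1 : ℤ) (n - ℓ i + 1),
      ∑ y ∈ Finset.Icc (1 : ℤ) (n - ℓ' i + 1), c n i x y) atTop (𝓝 (∑' p, c' p)) := by
  have h := tendsto_tsum_of_dominated_convergence (hg.mul_left 2)
    (fun p => tendsto_diagonalAverage (ℓ := ℓ) (ℓ' := ℓ') hc p (hbulk p))
    (Eventually.of_forall fun n p => norm_diagonalAverage_le hc n p)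
  exact h.congr fun n => tsum_diagonalAverage hs c n

end Averages

/-! ### Fekete and Tauberian arguments for time averages. -/

section TimeAverage

variable {C : ℝ → ℝ}

/-- The primitive of `C` vanishing at `0`. -/
def primitive (C : ℝ → ℝ) (t : ℝ) : ℝ := ∫ s in (0 : ℝ)..t, C s

/-- The double integral of `C (s' - s)` over the square `[0, T]²`. -/
def squareIntegral (C : ℝ → ℝ) (T : ℝ) : ℝ := ∫ s in (0 : ℝ)..T, ∫ s' in (0 : ℝ)..T, C (s' - s)

theorem hasDerivAt_primitive (hC : Continuous C) (t : ℝ) : HasDerivAt (primitive C) (C t) t :=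
  intervalIntegral.integral_hasDerivAt_right (hC.intervalIntegrable _ _)
    (hC.stronglyMeasurableAtFilter _ _) hC.continuousAt

theorem continuous_primitive (hC : Continuous C) : Continuous (primitive C) :=
  continuous_iff_continuousAt.2 fun t => (hasDerivAt_primitive hC t).continuousAt

theorem abs_primitive_sub_le (hC : Continuous C) {K : ℝ} (hK : ∀ t, |C t| ≤ K) (s t : ℝ) :
    |primitive C t - primitive C s| ≤ K * |t - s| := by
  rw [primitive, primitive, intervalIntegral.integral_interval_sub_left
    (hC.intervalIntegrable _ _) (hC.intervalIntegrable _ _)]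
  exact intervalIntegral.norm_integral_le_of_norm_le_const (f := C) fun u _ => hK u

theorem primitive_neg (heven : ∀ t, C (-t) = C t) (t : ℝ) : primitive C (-t) = -primitive C t := by
  have h := intervalIntegral.integral_comp_neg (a := 0) (b := t) C
  simp only [heven, neg_zero] at h
  rw [primitive, primitive, h, intervalIntegral.integral_symm]

/-- As `C` is even its primitive `F` is odd, so the inner integral is `F (T - s) + F s`; the two
terms have equal integrals by reflection. -/
theorem squareIntegral_eq (hC : Continuous C) (heven : ∀ t, C (-t) = C t) (T : ℝ) :
    squareIntegral C T = 2 * ∫ s in (0 : ℝ)..T, primitive C s := by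
  have hF := continuous_primitive hC
  have hin (s : ℝ) : ∫ s' in (0 : ℝ)..T, C (s' - s) = primitive C (T - s) + primitive C s := by
    rw [intervalIntegral.integral_comp_sub_right (fun u => C u) s, zero_sub, primitive,
      ← neg_neg (primitive C s), ← primitive_neg heven, primitive, ← sub_eq_add_neg,
      intervalIntegral.integral_interval_sub_left (hC.intervalIntegrable _ _)
        (hC.intervalIntegrable _ _)]
  have hrev : ∫ s in (0 : ℝ)..T, primitive C (T - s) = ∫ s in (0 : ℝ)..T, primitive C s := by
    rw [intervalIntegral.integral_comp_sub_left (fun u => primitive C u) T, sub_self, sub_zero]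
  rw [squareIntegral]
  simp only [hin]
  rw [intervalIntegral.integral_add, hrev, two_mul]
  · exact (hF.comp (by fun_prop : Continuous fun s : ℝ => T - s)).intervalIntegrable _ _
  · exact hF.intervalIntegrable _ _

theorem abs_integral_primitive_le (hC : Continuous C) {K : ℝ} (hK : ∀ t, |C t| ≤ K) (a b r : ℝ)
    (hr : ∀ u ∈ Set.uIoc a b, |u| ≤ r) :
    |∫ s in a..b, primitive C s| ≤ K * r * |b - a| := by
  have hK0 : 0 ≤ K := (abs_nonneg _).trans (hK 0)
  refine intervalIntegral.norm_integral_le_of_norm_le_const (f := primitive C) fun u hu => ?_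
  have h := abs_primitive_sub_le hC hK 0 u
  rw [sub_zero] at h
  have h0 : primitive C 0 = 0 := intervalIntegral.integral_same
  rw [h0, sub_zero] at h
  exact h.trans (mul_le_mul_of_nonneg_left (hr u hu) hK0)

/-- Fekete's lemma for the square integral. -/
theorem tendsto_squareIntegral_div_sq (hC : Continuous C) (heven : ∀ t, C (-t) = C t) {K : ℝ}
    (hK : ∀ t, |C t| ≤ K) (hpos : ∀ T, 0 ≤ squareIntegral C T)
    (hsub : ∀ S T,
      √(squareIntegral C (S + T)) ≤ √(squareIntegral C S) + √(squareIntegral C T)) :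
    ∃ D, Tendsto (fun T => squareIntegral C T / T ^ 2) atTop (𝓝 D) := by
  have hF := continuous_primitive hC
  have hK0 : 0 ≤ K := (abs_nonneg _).trans (hK 0)
  have hu : Subadditive fun n : ℕ => √(squareIntegral C n) := fun m n => by
    have := hsub m n
    exact_mod_cast this
  have hlim := hu.tendsto_lim ⟨0, by rintro _ ⟨n, rfl⟩; positivity⟩
  refine ⟨hu.lim ^ 2, ?_⟩
  have h1 : Tendsto (fun T : ℝ => squareIntegral C (⌊T⌋₊ : ℝ) / (⌊T⌋₊ : ℝ) ^ 2) atTop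
      (𝓝 (hu.lim ^ 2)) := by
    refine ((hlim.pow 2).comp tendsto_nat_floor_atTop).congr fun T => ?_
    simp only [Function.comp_apply]
    rw [div_pow, Real.sq_sqrt (hpos _)]
  have h2 : Tendsto (fun T : ℝ => squareIntegral C (⌊T⌋₊ : ℝ) / (⌊T⌋₊ : ℝ) ^ 2 *
      ((⌊T⌋₊ : ℝ) / T) ^ 2) atTop (𝓝 (hu.lim ^ 2)) := by
    simpa using h1.mul ((tendsto_nat_floor_div_atTop (R := ℝ)).pow 2)
  -- Fekete's lemma is applied at integer times. Passing from `⌊T⌋₊` to `T` changes the square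
  -- integral by `2 ∫ F` over an interval of length at most one on which `|F| ≤ K T`, so the change
  -- is `O(1 / T)` after division.
  have h3 : Tendsto (fun T : ℝ => squareIntegral C T / T ^ 2 -
      squareIntegral C (⌊T⌋₊ : ℝ) / (⌊T⌋₊ : ℝ) ^ 2 * ((⌊T⌋₊ : ℝ) / T) ^ 2) atTop (𝓝 0) := by
    refine squeeze_zero_norm' (a := fun T : ℝ => 2 * K / T) ?_
      (tendsto_const_nhds.div_atTop tendsto_id)
    filter_upwards [eventually_ge_atTop 1] with T hT
    have hT0 : 0 < T := by linarith
    have hfl : (⌊T⌋₊ : ℝ) ≤ T := Nat.floor_le hT0.le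
    have hfl' : T < ⌊T⌋₊ + 1 := Nat.lt_floor_add_one T
    have hfl0 : (0 : ℝ) < ⌊T⌋₊ := by exact_mod_cast Nat.floor_pos.2 hT
    have heq : squareIntegral C T / T ^ 2 -
        squareIntegral C (⌊T⌋₊ : ℝ) / (⌊T⌋₊ : ℝ) ^ 2 * ((⌊T⌋₊ : ℝ) / T) ^ 2 =
        2 * (∫ s in (⌊T⌋₊ : ℝ)..T, primitive C s) / T ^ 2 := by
      rw [squareIntegral_eq hC heven, squareIntegral_eq hC heven,
        ← intervalIntegral.integral_interval_sub_left (hF.intervalIntegrable 0 T)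
          (hF.intervalIntegrable 0 (⌊T⌋₊ : ℝ))]
      field_simp
    rw [heq, norm_div, norm_mul, Real.norm_eq_abs, Real.norm_eq_abs, Real.norm_eq_abs,
      abs_of_pos (by positivity : (0 : ℝ) < T ^ 2), abs_two]
    have hb := abs_integral_primitive_le hC hK (⌊T⌋₊ : ℝ) T T (fun u hu => by
      rw [Set.uIoc_of_le hfl] at hu
      rw [abs_of_pos (hfl0.trans hu.1)]
      exact hu.2)
    have hb' : |T - (⌊T⌋₊ : ℝ)| ≤ 1 := by
      rw [abs_of_nonneg (by linarith)]
      linarith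
    rw [div_le_div_iff₀ (by positivity) hT0]
    have : |∫ s in (⌊T⌋₊ : ℝ)..T, primitive C s| ≤ K * T :=
      hb.trans (mul_le_of_le_one_right (by positivity) hb')
    nlinarith
  simpa using h3.add h2

/-- A Tauberian step: convergence of the quadratic means implies convergence of the means. -/
theorem tendsto_primitive_div (hC : Continuous C) (heven : ∀ t, C (-t) = C t) {K D : ℝ}
    (hK : ∀ t, |C t| ≤ K) (hD : Tendsto (fun T => squareIntegral C T / T ^ 2) atTop (𝓝 D)) :
    Tendsto (fun T => primitive C T / T) atTop (𝓝 D) := by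
  have hF := continuous_primitive hC
  have hK0 : 0 ≤ K := (abs_nonneg _).trans (hK 0)
  -- This quotient is the average of the primitive over `[T, (1 + ε) T]`, divided by `T`. Its limit
  -- comes from `((1 + ε)² - 1) / (2 ε) = 1 + ε / 2`.
  have hquot (ε : ℝ) (hε : 0 < ε) : Tendsto (fun T => (squareIntegral C ((1 + ε) * T) -
      squareIntegral C T) / (2 * ε * T ^ 2)) atTop (𝓝 (D * (1 + ε / 2))) := by
    have h1 : Tendsto (fun T => squareIntegral C ((1 + ε) * T) / ((1 + ε) * T) ^ 2) atTop (𝓝 D) :=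
      hD.comp (tendsto_id.const_mul_atTop (by positivity))
    have h2 := ((h1.mul_const ((1 + ε) ^ 2)).sub hD).div_const (2 * ε)
    have e : (D * (1 + ε) ^ 2 - D) / (2 * ε) = D * (1 + ε / 2) := by
      field_simp
      ring
    rw [e] at h2
    refine h2.congr' ?_
    filter_upwards [eventually_gt_atTop 0] with T hT
    have : 1 + ε ≠ 0 := by positivity
    field_simp
  -- The primitive is `K`-Lipschitz, so it varies by at most `K ε T` on that interval.
  have hclose (ε T : ℝ) (hε : 0 < ε) (hT : 0 < T) :
      |(squareIntegral C ((1 + ε) * T) - squareIntegral C T) / (2 * ε * T ^ 2) -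
        primitive C T / T| ≤ K * ε := by
    have hle : T ≤ (1 + ε) * T := by nlinarith
    have hint : ∫ u in T..((1 + ε) * T), (primitive C u - primitive C T) =
        (squareIntegral C ((1 + ε) * T) - squareIntegral C T) / 2 - ε * T * primitive C T := by
      rw [intervalIntegral.integral_sub (hF.intervalIntegrable _ _)
        (continuous_const.intervalIntegrable _ _), intervalIntegral.integral_const,
        squareIntegral_eq hC heven, squareIntegral_eq hC heven,
        ← intervalIntegral.integral_interval_sub_left (hF.intervalIntegrable 0 _)
          (hF.intervalIntegrable 0 _), smul_eq_mul]
      ring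
    have hb : ‖∫ u in T..((1 + ε) * T), (primitive C u - primitive C T)‖ ≤
        K * (ε * T) * |(1 + ε) * T - T| := by
      refine intervalIntegral.norm_integral_le_of_norm_le_const fun u hu => ?_
      rw [Set.uIoc_of_le hle] at hu
      refine (abs_primitive_sub_le hC hK T u).trans ?_
      rw [abs_of_nonneg (by linarith [hu.1])]
      gcongr
      linarith [hu.2]
    rw [hint, Real.norm_eq_abs, abs_of_nonneg (by linarith : 0 ≤ (1 + ε) * T - T)] at hb
    have e : (squareIntegral C ((1 + ε) * T) - squareIntegral C T) / (2 * ε * T ^ 2) -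
        primitive C T / T = ((squareIntegral C ((1 + ε) * T) - squareIntegral C T) / 2 -
          ε * T * primitive C T) / (ε * T ^ 2) := by
      field_simp
    rw [e, abs_div, abs_of_pos (by positivity : 0 < ε * T ^ 2), div_le_iff₀ (by positivity)]
    refine hb.trans (le_of_eq ?_)
    ring
  rw [Metric.tendsto_atTop']
  intro δ hδ
  -- The three terms are the oscillation of the primitive, the bias of the limit `D (1 + ε / 2)`,
  -- and the distance of the quotient from that limit.
  obtain ⟨ε, hε, hεδ⟩ : ∃ ε > 0, K * ε + |D| * ε / 2 + ε ≤ δ / 2 := by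
    refine ⟨δ / 2 / (K + |D| / 2 + 1), by positivity, le_of_eq ?_⟩
    field_simp
  obtain ⟨T₀, hT₀⟩ := Metric.tendsto_atTop'.1 (hquot ε hε) ε hε
  refine ⟨max T₀ 0, fun T hT => ?_⟩
  have h1 := hT₀ T (lt_of_le_of_lt (le_max_left _ _) hT)
  have h2 := hclose ε T hε (lt_of_le_of_lt (le_max_right _ _) hT)
  rw [Real.dist_eq] at h1 ⊢
  set q := (squareIntegral C ((1 + ε) * T) - squareIntegral C T) / (2 * ε * T ^ 2)
  have h3 : |D * (1 + ε / 2) - D| = |D| * ε / 2 := by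
    rw [show D * (1 + ε / 2) - D = D * (ε / 2) by ring, abs_mul, abs_of_pos (half_pos hε)]
    ring
  have h4 : |primitive C T / T - D| ≤
      |q - primitive C T / T| + |q - D * (1 + ε / 2)| + |D * (1 + ε / 2) - D| := by
    rw [abs_sub_comm q]
    have e : primitive C T / T - D = (primitive C T / T - q) + (q - D * (1 + ε / 2)) +
      (D * (1 + ε / 2) - D) := by ring
    rw [e]
    exact abs_add_three _ _ _
  linarith

end TimeAverage

section Membership

variable {N : ℕ} {H J : Op N}

theorem heisenberg_mem_quasiLocal (hH : H ∈ quasiLocalAlgebra N) (hJ : J ∈ quasiLocalAlgebra N)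
    (t : ℝ) : heisenberg H t J ∈ quasiLocalAlgebra N :=
  heisenberg_mem isClosed_quasiLocalAlgebra hH hJ t

end Membership

/-! ### Autocorrelations in finite volume. -/

section Autocorrelation

variable {N : ℕ} [NeZero N]

/-- The autocorrelation `ω(J τ_t(J))` of `J` under the dynamics generated by `H`. -/
def autocorr (H J : Op N) (t : ℝ) : ℝ := (traceFun N (J * heisenberg H t J)).re

variable {H J : Op N}

theorem traceFun_heisenberg (hH : H ∈ quasiLocalAlgebra N) (hJ : J ∈ quasiLocalAlgebra N)
    (t : ℝ) : traceFun N (heisenberg H t J) = traceFun N J := by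
  have h (u : ℝ) := expI_mem isClosed_quasiLocalAlgebra hH u
  rw [heisenberg, traceFun_mul_comm (mul_mem (h t) hJ) (h (-t)), ← mul_assoc, expI_neg_mul_expI,
    one_mul]

theorem traceFun_heisenberg_mul_heisenberg (hH : H ∈ quasiLocalAlgebra N)
    (hJ : J ∈ quasiLocalAlgebra N) (s t : ℝ) :
    traceFun N (heisenberg H s J * heisenberg H t J) =
      traceFun N (J * heisenberg H (t - s) J) := by
  rw [← traceFun_heisenberg hH (mul_mem hJ (heisenberg_mem_quasiLocal hH hJ (t - s))) s,
    heisenberg_mul, ← heisenberg_add_time]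
  congr 4
  ring

/-- Taking adjoints reverses the two self-adjoint factors and cyclicity restores their order, so the
trace equals its conjugate. -/
theorem traceFun_mul_heisenberg_eq (hH : H ∈ quasiLocalAlgebra N) (hHsa : IsSelfAdjoint H)
    (hJ : J ∈ quasiLocalAlgebra N) (hJsa : IsSelfAdjoint J) (t : ℝ) :
    traceFun N (J * heisenberg H t J) = autocorr H J t := by
  have hJt := heisenberg_mem_quasiLocal hH hJ t
  have h := traceFun_star (mul_mem hJ hJt)
  rw [star_mul, star_heisenberg hHsa, hJsa.star_eq, traceFun_mul_comm hJt hJ] at h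
  exact (Complex.conj_eq_iff_re.1 h.symm).symm

theorem autocorr_neg (hH : H ∈ quasiLocalAlgebra N) (hJ : J ∈ quasiLocalAlgebra N) (t : ℝ) :
    autocorr H J (-t) = autocorr H J t := by
  have h1 := traceFun_heisenberg_mul_heisenberg hH hJ t 0
  have h2 := traceFun_heisenberg_mul_heisenberg hH hJ 0 t
  rw [traceFun_mul_comm (heisenberg_mem_quasiLocal hH hJ t) (heisenberg_mem_quasiLocal hH hJ 0),
    h2, sub_zero, zero_sub] at h1
  rw [autocorr, autocorr, h1]

theorem continuous_autocorr (H J : Op N) : Continuous (autocorr H J) :=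
  Complex.continuous_re.comp ((traceFun N).continuous.comp
    (continuous_const.mul (continuous_heisenberg H J)))

theorem hsNorm_heisenberg (hH : H ∈ quasiLocalAlgebra N) (hHsa : IsSelfAdjoint H)
    (hJ : J ∈ quasiLocalAlgebra N) (t : ℝ) : hsNorm (heisenberg H t J) = hsNorm J := by
  rw [hsNorm, star_heisenberg hHsa, ← heisenberg_mul,
    traceFun_heisenberg hH (mul_mem (star_mem hJ) hJ), hsNorm]

theorem abs_autocorr_le (hH : H ∈ quasiLocalAlgebra N) (hHsa : IsSelfAdjoint H)
    (hJ : J ∈ quasiLocalAlgebra N) (hJsa : IsSelfAdjoint J) (t : ℝ) :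
    |autocorr H J t| ≤ autocorr H J 0 := by
  have h1 := norm_traceFun_star_mul_le hJ (heisenberg_mem_quasiLocal hH hJ t)
  rw [hsNorm_heisenberg hH hHsa hJ, ← sq, hsNorm_sq hJ, hJsa.star_eq] at h1
  rw [autocorr, autocorr, heisenberg_zero_time]
  exact (Complex.abs_re_le_norm _).trans h1

theorem traceFun_timeIntegral_mul (H J Q : Op N) (T : ℝ) :
    traceFun N (timeIntegral H J T * Q) =
      ∫ s in (0 : ℝ)..T, traceFun N (heisenberg H s J * Q) :=
  timeIntegral_map ((traceFun N).comp ((ContinuousLinearMap.mul ℂ (Op N)).flip Q)) H J T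

theorem traceFun_mul_timeIntegral (H J Q : Op N) (T : ℝ) :
    traceFun N (Q * timeIntegral H J T) =
      ∫ s in (0 : ℝ)..T, traceFun N (Q * heisenberg H s J) :=
  timeIntegral_map ((traceFun N).comp (ContinuousLinearMap.mul ℂ (Op N) Q)) H J T

/-- Expanding the square gives a double time integral whose integrand depends only on `s' - s`, by
invariance of the trace. This makes the square integral nonnegative and its root a norm. -/
theorem hsNorm_timeIntegral_sq (hH : H ∈ quasiLocalAlgebra N) (hHsa : IsSelfAdjoint H)
    (hJ : J ∈ quasiLocalAlgebra N) (hJsa : IsSelfAdjoint J) (T : ℝ) :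
    hsNorm (timeIntegral H J T) ^ 2 = squareIntegral (autocorr H J) T := by
  rw [hsNorm_sq (timeIntegral_mem isClosed_quasiLocalAlgebra hH hJ T),
    (isSelfAdjoint_timeIntegral hHsa hJsa T).star_eq,
    traceFun_timeIntegral_mul]
  simp only [traceFun_mul_timeIntegral, traceFun_heisenberg_mul_heisenberg hH hJ,
    traceFun_mul_heisenberg_eq hH hHsa hJ hJsa, intervalIntegral.integral_ofReal,
    Complex.ofReal_re]
  rfl

theorem hsNorm_timeIntegral_add_le (hH : H ∈ quasiLocalAlgebra N) (hHsa : IsSelfAdjoint H)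
    (hJ : J ∈ quasiLocalAlgebra N) (S T : ℝ) :
    hsNorm (timeIntegral H J (S + T)) ≤
      hsNorm (timeIntegral H J S) + hsNorm (timeIntegral H J T) := by
  have hT := timeIntegral_mem isClosed_quasiLocalAlgebra hH hJ T
  rw [timeIntegral_add, ← hsNorm_heisenberg hH hHsa hT S]
  exact hsNorm_add_le (timeIntegral_mem isClosed_quasiLocalAlgebra hH hJ S)
    (heisenberg_mem_quasiLocal hH hT S)

end Autocorrelation

/-! ### The current autocorrelation in the thermodynamic limit. -/

section CurrentCorrelation

theorem tendsto_pair_average_single {ℓ : ℕ} {c : ℕ → ℤ → ℤ → ℂ} {c' : ℤ → ℂ} {g : ℤ → ℝ}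
    (hg : Summable g) (hc : ∀ n x y, ‖c n x y‖ ≤ g (x - y))
    (hbulk : ∀ z : ℤ, ∀ ε > 0, ∃ r : ℕ, ∀ (n : ℕ) (y : ℤ), (r : ℤ) ≤ y → y ≤ n - r →
      ‖c n (y + z) y - c' z‖ ≤ ε) :
    Tendsto (fun n : ℕ => 1 / (n : ℂ) * ∑ x ∈ Finset.Icc (1 : ℤ) (n - ℓ + 1),
      ∑ y ∈ Finset.Icc (1 : ℤ) (n - ℓ + 1), c n x y) atTop (𝓝 (∑' z, c' z)) := by
  have h := tendsto_pair_average (ι := Unit) (ℓ := fun _ => ℓ) (ℓ' := fun _ => ℓ)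
    (s := fun _ => Finset.univ) (by simp) (c := fun n _ => c n) (c' := fun p => c' p.2)
    (g := fun p => g p.2) ((Equiv.punitProd ℤ).summable_iff.2 hg) (fun n _ => hc n)
    (fun p => hbulk p.2)
  have e : ∑' p : Unit × ℤ, c' p.2 = ∑' z, c' z := (Equiv.punitProd ℤ).tsum_eq c'
  rw [e] at h
  simpa using h

variable {N dh dj : ℕ}

theorem homogeneousSum_mem (j : LocalMatrix N dj) (a b : ℤ) :
    homogeneousSum j a b ∈ quasiLocalAlgebra N := hamiltonian_mem j _

theorem isSelfAdjoint_homogeneousSum {j : LocalMatrix N dj} (hj : j.IsHermitian) (a b : ℤ) :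
    IsSelfAdjoint (homogeneousSum j a b) := isSelfAdjoint_hamiltonian hj _

variable [NeZero N]

/-- The sum over all sites of the correlations `ω(j_x τ_t(j_0))`. -/
def currentCorr (h : LocalMatrix N dh) (j : LocalMatrix N dj) (t : ℝ) : ℂ :=
  ∑' z : ℤ, traceFun N (place z j * evolution h t (place 0 j))

variable {h : LocalMatrix N dh} {j : LocalMatrix N dj}

theorem summable_const_mul_exp_neg_abs (K : ℝ) :
    Summable fun z : ℤ => K * Real.exp (-(|z| : ℤ)) := summable_exp_neg_abs.mul_left K

theorem hasSum_currentCorr (hh : h.IsHermitian) (hj0 : tracialState (place 0 j) = 0) (t : ℝ) :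
    HasSum (fun z : ℤ => traceFun N (place z j * evolution h t (place 0 j)))
      (currentCorr h j t) := by
  refine (Summable.of_norm_bounded (summable_const_mul_exp_neg_abs
    (‖place 0 j‖ * lrConst h j |t| * Real.exp (dj + dj + 3 * (dh + 1)))) fun z => ?_).hasSum
  have := norm_traceFun_place_mul_evolution_le hh j j hj0 z 0 (le_refl |t|)
  rwa [sub_zero] at this

theorem continuous_currentCorr (hh : h.IsHermitian) (hj0 : tracialState (place 0 j) = 0) :
    Continuous (currentCorr h j) := by
  refine continuous_iff_continuousAt.2 fun t => ?_
  have hcont (z : ℤ) : Continuous fun t => traceFun N (place z j * evolution h t (place 0 j)) :=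
    (traceFun N).continuous.comp (continuous_const.mul (continuous_evolution_place hh j 0))
  refine (continuousOn_tsum (s := Set.Icc (-(|t| + 1)) (|t| + 1)) (fun z => (hcont z).continuousOn)
    (summable_const_mul_exp_neg_abs
      (‖place 0 j‖ * lrConst h j (|t| + 1) * Real.exp (dj + dj + 3 * (dh + 1))))
    fun z s hs => ?_).continuousAt (Icc_mem_nhds ?_ ?_)
  · have := norm_traceFun_place_mul_evolution_le hh j j hj0 z 0 (abs_le.2 hs)
    rwa [sub_zero] at this
  · linarith [neg_abs_le t]
  · linarith [le_abs_self t]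

/-- Under the infinite dynamics the kernel is exactly translation invariant, so the bulk condition
holds with no error. -/
theorem tendsto_infinite_autocorr (hh : h.IsHermitian) (hj0 : tracialState (place 0 j) = 0)
    (t : ℝ) :
    Tendsto (fun n : ℕ => 1 / (n : ℂ) * traceFun N (homogeneousSum j 1 n *
      evolution h t (homogeneousSum j 1 n))) atTop (𝓝 (currentCorr h j t)) := by
  have hlim := tendsto_pair_average_single (ℓ := dj)
    (c := fun _ x y => traceFun N (place x j * evolution h t (place y j)))
    (c' := fun z => traceFun N (place z j * evolution h t (place 0 j)))
    (summable_const_mul_exp_neg_abs _)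
    (fun _ x y => norm_traceFun_place_mul_evolution_le hh j j hj0 x y (le_refl |t|))
    (fun z ε hε => ⟨0, fun n y _ _ => by
      have := traceFun_place_mul_evolution_add hh j j z 0 y t
      rw [zero_add, add_comm z y] at this
      rw [this, sub_self, norm_zero]
      exact hε.le⟩)
  refine hlim.congr fun n => ?_
  simp only [homogeneousSum, evolution_sum hh t _ fun x _ => place_mem x j, Finset.sum_mul_sum,
    map_sum]

/-- Away from the ends of the chain the finite and infinite evolutions of a density nearly coincide,
so the limit is unchanged. Through it `C` inherits evenness, boundedness and the norm inequalities
of finite volume. -/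
theorem tendsto_finite_autocorr (hh : h.IsHermitian) (hj0 : tracialState (place 0 j) = 0)
    (t : ℝ) :
    Tendsto (fun n : ℕ => 1 / (n : ℂ) * traceFun N (homogeneousSum j 1 n *
      heisenberg (homogeneousSum h 1 n) t (homogeneousSum j 1 n))) atTop
      (𝓝 (currentCorr h j t)) := by
  have hexp (K : ℝ) : Tendsto (fun r : ℕ => K * Real.exp (-(r : ℝ))) atTop (𝓝 0) := by
    simpa using (Real.tendsto_exp_neg_atTop_nhds_zero.comp tendsto_natCast_atTop_atTop).const_mul K
  have hlim := tendsto_pair_average_single (ℓ := dj)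
    (c := fun n x y => traceFun N (place x j * heisenberg (homogeneousSum h 1 n) t (place y j)))
    (c' := fun z => traceFun N (place z j * evolution h t (place 0 j)))
    (summable_const_mul_exp_neg_abs _)
    (fun n x y => norm_traceFun_place_mul_heisenberg_le hh j j hj0 x y _ (le_refl |t|))
    (fun z ε hε => by
      obtain ⟨r, hr⟩ := ((hexp (‖place 0 j‖ * (2 * lrConst h j |t| *
        Real.exp (dj + 2 * (dh + 1))))).eventually (gt_mem_nhds hε)).exists
      -- The interaction terms of `[1, n]` start no later than `n - dh + 1`; the extra `dh` ensures
      -- that all those within `r` of `y` are present.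
      refine ⟨r + dh, fun n y hy hy' => ?_⟩
      have hinv := traceFun_place_mul_evolution_add hh j j z 0 y t
      rw [zero_add, add_comm z y] at hinv
      rw [← hinv, ← map_sub, ← mul_sub]
      refine (norm_traceFun_le _).trans ((norm_mul_le _ _).trans (le_trans ?_ hr.le))
      rw [norm_sub_rev, mul_assoc]
      have hle := norm_evolution_sub_heisenberg_le hh j y r
        (S := Finset.Icc 1 ((n : ℤ) - dh + 1)) (fun x hx => by
          rw [abs_lt] at hx
          rw [Finset.mem_Icc]
          push_cast at hy hy'
          omega) (le_refl |t|)
      rw [homogeneousSum_eq]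
      exact mul_le_mul (norm_place_le _ _) hle (norm_nonneg _) (norm_nonneg _))
  refine hlim.congr fun n => ?_
  simp only [homogeneousSum_eq j, hamiltonian, heisenberg_sum, Finset.sum_mul_sum, map_sum]

theorem tendsto_ofReal_re {α : Type*} {l : Filter α} [l.NeBot] {u : α → ℂ} {z : ℂ}
    (hu : ∀ a, (u a).im = 0) (hz : Tendsto u l (𝓝 z)) : ((z.re : ℝ) : ℂ) = z := by
  have him : Tendsto (fun a => (u a).im) l (𝓝 z.im) := (Complex.continuous_im.tendsto z).comp hz
  simp only [hu] at him
  exact Complex.ext rfl (tendsto_nhds_unique tendsto_const_nhds him)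

/-- The autocorrelation per site of the current of the finite chain `[1, n]`. -/
def siteCorr (h : LocalMatrix N dh) (j : LocalMatrix N dj) (n : ℕ) (t : ℝ) : ℝ :=
  1 / n * autocorr (homogeneousSum h 1 n) (homogeneousSum j 1 n) t

theorem traceFun_current_eq (hh : h.IsHermitian) (hj : j.IsHermitian) (n : ℕ) (t : ℝ) :
    1 / (n : ℂ) * traceFun N (homogeneousSum j 1 n *
      heisenberg (homogeneousSum h 1 n) t (homogeneousSum j 1 n)) = siteCorr h j n t := by
  rw [traceFun_mul_heisenberg_eq (homogeneousSum_mem h 1 n) (isSelfAdjoint_homogeneousSum hh 1 n)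
    (homogeneousSum_mem j 1 n) (isSelfAdjoint_homogeneousSum hj 1 n), siteCorr]
  push_cast
  rfl

theorem ofReal_currentCorr_re (hh : h.IsHermitian) (hj : j.IsHermitian)
    (hj0 : tracialState (place 0 j) = 0) (t : ℝ) :
    (((currentCorr h j t).re : ℝ) : ℂ) = currentCorr h j t := by
  refine tendsto_ofReal_re (fun n => ?_) (tendsto_finite_autocorr hh hj0 t)
  rw [traceFun_current_eq hh hj, Complex.ofReal_im]

theorem tendsto_siteCorr (hh : h.IsHermitian) (hj : j.IsHermitian)
    (hj0 : tracialState (place 0 j) = 0) (t : ℝ) :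
    Tendsto (fun n => siteCorr h j n t) atTop (𝓝 (currentCorr h j t).re) := by
  refine ((Complex.continuous_re.tendsto _).comp (tendsto_finite_autocorr hh hj0 t)).congr
    fun n => ?_
  rw [Function.comp_apply, traceFun_current_eq hh hj, Complex.ofReal_re]

theorem continuous_siteCorr (h : LocalMatrix N dh) (j : LocalMatrix N dj) (n : ℕ) :
    Continuous (siteCorr h j n) :=
  continuous_const.mul (continuous_autocorr _ _)

theorem siteCorr_neg (h : LocalMatrix N dh) (j : LocalMatrix N dj) (n : ℕ) (t : ℝ) :
    siteCorr h j n (-t) = siteCorr h j n t := by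
  rw [siteCorr, siteCorr, autocorr_neg (homogeneousSum_mem h 1 n) (homogeneousSum_mem j 1 n)]

theorem abs_siteCorr_le (hh : h.IsHermitian) (hj : j.IsHermitian) (n : ℕ) (t : ℝ) :
    |siteCorr h j n t| ≤ siteCorr h j n 0 := by
  rw [siteCorr, siteCorr, abs_mul, abs_of_nonneg (by positivity : (0 : ℝ) ≤ 1 / n)]
  have := abs_autocorr_le (homogeneousSum_mem h 1 n) (isSelfAdjoint_homogeneousSum hh 1 n)
    (homogeneousSum_mem j 1 n) (isSelfAdjoint_homogeneousSum hj 1 n) t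
  gcongr

/-- The value at time zero dominates all times, and the values at time zero converge as `n` grows.
-/
theorem exists_siteCorr_bound (hh : h.IsHermitian) (hj : j.IsHermitian)
    (hj0 : tracialState (place 0 j) = 0) : ∃ K, ∀ n t, |siteCorr h j n t| ≤ K := by
  obtain ⟨K, hK⟩ := (tendsto_siteCorr hh hj hj0 0).bddAbove_range
  exact ⟨K, fun n t => (abs_siteCorr_le hh hj n t).trans (hK ⟨n, rfl⟩)⟩

theorem squareIntegral_siteCorr (hh : h.IsHermitian) (hj : j.IsHermitian) (n : ℕ) (T : ℝ) :
    squareIntegral (siteCorr h j n) T =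
      hsNorm (timeIntegral (homogeneousSum h 1 n) (homogeneousSum j 1 n) T) ^ 2 / n := by
  rw [hsNorm_timeIntegral_sq (homogeneousSum_mem h 1 n) (isSelfAdjoint_homogeneousSum hh 1 n)
    (homogeneousSum_mem j 1 n) (isSelfAdjoint_homogeneousSum hj 1 n)]
  simp only [squareIntegral, siteCorr, intervalIntegral.integral_const_mul]
  ring

theorem squareIntegral_siteCorr_nonneg (hh : h.IsHermitian) (hj : j.IsHermitian) (n : ℕ) (T : ℝ) :
    0 ≤ squareIntegral (siteCorr h j n) T := by
  rw [squareIntegral_siteCorr hh hj]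
  positivity

theorem hsNorm_timeIntegral_div_sqrt (hh : h.IsHermitian) (hj : j.IsHermitian) (n : ℕ) (T : ℝ) :
    hsNorm (timeIntegral (homogeneousSum h 1 n) (homogeneousSum j 1 n) T) / √n =
      √(squareIntegral (siteCorr h j n) T) := by
  rw [squareIntegral_siteCorr hh hj, Real.sqrt_div (sq_nonneg _), Real.sqrt_sq (hsNorm_nonneg _)]

/-- Dominated convergence in each of the two time variables, using the bound uniform in `n` and
time. -/
theorem tendsto_squareIntegral (hh : h.IsHermitian) (hj : j.IsHermitian)
    (hj0 : tracialState (place 0 j) = 0) (T : ℝ) :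
    Tendsto (fun n => squareIntegral (siteCorr h j n) T) atTop
      (𝓝 (squareIntegral (fun t => (currentCorr h j t).re) T)) := by
  obtain ⟨K, hK⟩ := exists_siteCorr_bound hh hj hj0
  have hcont (n : ℕ) := continuous_siteCorr h j n
  have hin (s : ℝ) : Tendsto (fun n => ∫ s' in (0 : ℝ)..T, siteCorr h j n (s' - s)) atTop
      (𝓝 (∫ s' in (0 : ℝ)..T, (currentCorr h j (s' - s)).re)) := by
    refine intervalIntegral.tendsto_integral_filter_of_dominated_convergence (fun _ => K)
      (Eventually.of_forall fun n => ?_) (Eventually.of_forall fun n => ae_of_all _ fun s' _ => ?_)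
      intervalIntegrable_const (ae_of_all _ fun s' _ => tendsto_siteCorr hh hj hj0 _)
    · exact ((hcont n).comp (by fun_prop : Continuous fun s' : ℝ => s' - s)).aestronglyMeasurable
    · exact hK n _
  refine intervalIntegral.tendsto_integral_filter_of_dominated_convergence (fun _ => K * |T - 0|)
    (Eventually.of_forall fun n => ?_) (Eventually.of_forall fun n => ae_of_all _ fun s _ => ?_)
    intervalIntegrable_const (ae_of_all _ fun s _ => hin s)
  · refine Continuous.aestronglyMeasurable ?_
    refine intervalIntegral.continuous_parametric_intervalIntegral_of_continuous' ?_ 0 T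
    exact (hcont n).comp (by fun_prop : Continuous fun p : ℝ × ℝ => p.2 - p.1)
  · exact intervalIntegral.norm_integral_le_of_norm_le_const fun s' _ => hK n _

theorem tendsto_hsNorm_timeIntegral (hh : h.IsHermitian) (hj : j.IsHermitian)
    (hj0 : tracialState (place 0 j) = 0) (T : ℝ) :
    Tendsto (fun n : ℕ =>
      hsNorm (timeIntegral (homogeneousSum h 1 n) (homogeneousSum j 1 n) T) / √n) atTop
      (𝓝 √(squareIntegral (fun t => (currentCorr h j t).re) T)) := by
  refine ((Real.continuous_sqrt.tendsto _).comp (tendsto_squareIntegral hh hj hj0 T)).congr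
    fun n => ?_
  rw [hsNorm_timeIntegral_div_sqrt hh hj]
  rfl

/-- The time averages of the current autocorrelation converge, to the limit of the mean square of
the averaged current. -/
theorem exists_drude (hh : h.IsHermitian) (hj : j.IsHermitian)
    (hj0 : tracialState (place 0 j) = 0) :
    ∃ D, Tendsto (fun T => squareIntegral (fun t => (currentCorr h j t).re) T / T ^ 2) atTop
        (𝓝 D) ∧
      Tendsto (fun T => primitive (fun t => (currentCorr h j t).re) T / T) atTop (𝓝 D) := by
  set C : ℝ → ℝ := fun t => (currentCorr h j t).re with hC
  have hcont : Continuous C := Complex.continuous_re.comp (continuous_currentCorr hh hj0)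
  have heven (t : ℝ) : C (-t) = C t := by
    refine tendsto_nhds_unique (tendsto_siteCorr hh hj hj0 (-t)) ?_
    simp only [siteCorr_neg]
    exact tendsto_siteCorr hh hj hj0 t
  obtain ⟨K, hK⟩ := exists_siteCorr_bound hh hj hj0
  have hbd (t : ℝ) : |C t| ≤ K :=
    le_of_tendsto (tendsto_siteCorr hh hj hj0 t).abs (Eventually.of_forall fun n => hK n t)
  have hpos (T : ℝ) : 0 ≤ squareIntegral C T := by
    refine ge_of_tendsto (tendsto_squareIntegral hh hj hj0 T) (Eventually.of_forall fun n => ?_)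
    exact squareIntegral_siteCorr_nonneg hh hj n T
  have hsub (S T : ℝ) :
      √(squareIntegral C (S + T)) ≤ √(squareIntegral C S) + √(squareIntegral C T) := by
    refine le_of_tendsto_of_tendsto' (tendsto_hsNorm_timeIntegral hh hj hj0 (S + T))
      ((tendsto_hsNorm_timeIntegral hh hj hj0 S).add (tendsto_hsNorm_timeIntegral hh hj hj0 T))
      fun n => ?_
    rw [← add_div]
    gcongr
    exact hsNorm_timeIntegral_add_le (homogeneousSum_mem h 1 n)
      (isSelfAdjoint_homogeneousSum hh 1 n) (homogeneousSum_mem j 1 n) S T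
  obtain ⟨D, hD⟩ := tendsto_squareIntegral_div_sq hcont heven hbd hpos hsub
  exact ⟨D, hD, tendsto_primitive_div hcont heven hbd hD⟩

end CurrentCorrelation

/-! ### Commutators with a boundary observable. -/

section Commutator

variable {N dh db : ℕ}

/-- Terms starting beyond `db` are disjoint from the window `1, …, db`, so at most `db` terms
contribute whatever the length of the chain. -/
theorem norm_commutator_hamiltonian_place_le (h : LocalMatrix N dh) (b : LocalMatrix N db) (n : ℕ) :
    ‖homogeneousSum h 1 n * place 1 b - place 1 b * homogeneousSum h 1 n‖ ≤
      2 * (db * ‖place 0 h‖) * ‖place 0 b‖ := by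
  set S := Finset.Icc (1 : ℤ) (n - dh + 1) with hS
  set V := hamiltonian h (S.filter fun x => x ≤ (db : ℤ)) with hV
  set W := hamiltonian h (S.filter fun x => ¬ x ≤ (db : ℤ)) with hW
  have hsum : homogeneousSum h 1 n = V + W := (Finset.sum_filter_add_sum_filter_not _ _ _).symm
  have hWb : W * place 1 b = place 1 b * W := by
    refine (commute_hamiltonian fun x hx => commute_place_of_disjoint ?_ _ _).eq
    have hx := (Finset.mem_filter.1 hx).2
    right
    omega
  have hVn : ‖V‖ ≤ db * ‖place 0 h‖ := by
    refine (norm_hamiltonian_le _ _).trans (mul_le_mul_of_nonneg_right ?_ (norm_nonneg _))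
    have hsub : S.filter (fun x => x ≤ (db : ℤ)) ⊆ Finset.Icc (1 : ℤ) db := by
      intro x hx
      simp only [hS, Finset.mem_filter, Finset.mem_Icc] at hx ⊢
      omega
    have := Finset.card_le_card hsub
    rw [Int.card_Icc] at this
    have : (S.filter fun x => x ≤ (db : ℤ)).card ≤ db := by omega
    exact_mod_cast this
  have heq : homogeneousSum h 1 n * place 1 b - place 1 b * homogeneousSum h 1 n =
      V * place 1 b - place 1 b * V := by
    rw [hsum, add_mul, mul_add, hWb]
    abel
  rw [heq]
  refine (norm_commutator_le _ _).trans ?_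
  gcongr
  exact norm_place_le _ _

end Commutator

/-! ### The Mazur bound. -/

section Mazur

variable {N dh dj db : ℕ} [NeZero N] {h : LocalMatrix N dh} {j : LocalMatrix N dj}

theorem norm_traceFun_mul_le {A B : Op N} (hA : A ∈ quasiLocalAlgebra N)
    (hB : B ∈ quasiLocalAlgebra N) : ‖traceFun N (A * B)‖ ≤ hsNorm A * hsNorm B := by
  have h1 : hsNorm (star A) = hsNorm A := by
    rw [hsNorm, hsNorm, star_star, traceFun_mul_comm hA (star_mem hA)]
  have h2 := norm_traceFun_star_mul_le (star_mem hA) hB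
  rwa [star_star, h1] at h2

/-- Overlap of the evolved current with a traceless local observable, uniformly in the volume. -/
theorem norm_traceFun_heisenberg_current_mul_le (hh : h.IsHermitian) (j : LocalMatrix N dj)
    {b : LocalMatrix N db} (hb : tracialState (place 0 b) = 0) {t T : ℝ} (ht : |t| ≤ T) (n : ℕ)
    (w : ℤ) :
    ‖traceFun N (heisenberg (homogeneousSum h 1 n) t (homogeneousSum j 1 n) * place w b)‖ ≤
      ‖place 0 b‖ * lrConst h j T * Real.exp (dj + db + 3 * (dh + 1)) *
        ∑' z : ℤ, Real.exp (-(|z| : ℤ)) := by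
  rw [homogeneousSum_eq j, hamiltonian, heisenberg_sum, Finset.sum_mul, map_sum]
  set K := ‖place 0 b‖ * lrConst h j T * Real.exp (dj + db + 3 * (dh + 1)) with hK
  have hK0 : 0 ≤ K := by
    have := lrConst_nonneg h j T
    positivity
  have hs : Summable fun x : ℤ => Real.exp (-(|w - x| : ℤ)) :=
    (Equiv.subLeft w).summable_iff.2 summable_exp_neg_abs
  have he : ∑' x : ℤ, Real.exp (-(|w - x| : ℤ)) = ∑' z : ℤ, Real.exp (-(|z| : ℤ)) :=
    (Equiv.subLeft w).tsum_eq fun z : ℤ => Real.exp (-(|z| : ℤ))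
  refine (norm_sum_le_of_le (n := fun x : ℤ => K * Real.exp (-(|w - x| : ℤ))) _
    fun x _ => ?_).trans ?_
  · rw [traceFun_mul_comm (heisenberg_mem_quasiLocal (homogeneousSum_mem h 1 n) (place_mem x j) t)
      (place_mem w b), homogeneousSum_eq]
    exact norm_traceFun_place_mul_heisenberg_le hh j b hb w x _ ht
  · rw [← Finset.mul_sum, ← he]
    exact mul_le_mul_of_nonneg_left (hs.sum_le_tsum _ fun _ _ => Real.exp_nonneg _) hK0

theorem traceFun_commutator_mul {H A Q : Op N} (hH : H ∈ quasiLocalAlgebra N)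
    (hA : A ∈ quasiLocalAlgebra N) (hQ : Q ∈ quasiLocalAlgebra N) :
    traceFun N ((H * A - A * H) * Q) = -traceFun N (A * (H * Q - Q * H)) := by
  have h1 := traceFun_mul_comm hH (mul_mem hA hQ)
  simp only [sub_mul, mul_sub, map_sub, mul_assoc] at h1 ⊢
  rw [h1]
  ring

/-- If `[H, Q]` has bounded overlap with the evolved current, then the overlap of `Q` with the
current integrated over `[0, T]` is `T` times the overlap with the current, up to a bounded
error. -/
theorem norm_traceFun_timeIntegral_mul_sub_le {H J Q : Op N} (hH : H ∈ quasiLocalAlgebra N)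
    (hJ : J ∈ quasiLocalAlgebra N) (hQ : Q ∈ quasiLocalAlgebra N) {K T : ℝ} (hT : 0 ≤ T)
    (hK : ∀ u, |u| ≤ T → ‖traceFun N (heisenberg H u J * (H * Q - Q * H))‖ ≤ K) :
    ‖traceFun N (timeIntegral H J T * Q) - T * traceFun N (J * Q)‖ ≤ K * T * T := by
  have hK0 : 0 ≤ K := (norm_nonneg _).trans (hK 0 (by simpa using hT))
  have hderiv (u : ℝ) : HasDerivAt (fun u => traceFun N (heisenberg H u J * Q))
      (traceFun N ((Complex.I • (H * heisenberg H u J - heisenberg H u J * H)) * Q)) u :=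
    (((traceFun N).comp ((ContinuousLinearMap.mul ℂ (Op N)).flip Q)).restrictScalars ℝ
      ).hasFDerivAt.comp_hasDerivAt u (hasDerivAt_heisenberg H J u)
  have hdiff (s : ℝ) (hs : s ∈ Set.Icc 0 T) :
      ‖traceFun N (heisenberg H s J * Q) - traceFun N (J * Q)‖ ≤ K * s := by
    have := norm_image_sub_le_of_norm_deriv_le_segment' (a := 0) (b := T) (C := K)
      (fun u _ => (hderiv u).hasDerivWithinAt) (fun u hu => by
        rw [smul_mul_assoc, map_smul, norm_smul, Complex.norm_I, one_mul,
          traceFun_commutator_mul hH (heisenberg_mem_quasiLocal hH hJ u) hQ, norm_neg]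
        exact hK u (abs_le.2 ⟨by linarith [hu.1], hu.2.le⟩)) s hs
    simpa using this
  have hcont : Continuous fun s => traceFun N (heisenberg H s J * Q) :=
    continuous_iff_continuousAt.2 fun u => (hderiv u).continuousAt
  have hint : traceFun N (timeIntegral H J T * Q) - T * traceFun N (J * Q) =
      ∫ s in (0 : ℝ)..T, (traceFun N (heisenberg H s J * Q) - traceFun N (J * Q)) := by
    rw [intervalIntegral.integral_sub (hcont.intervalIntegrable _ _)
      (continuous_const.intervalIntegrable _ _), traceFun_timeIntegral_mul,
      intervalIntegral.integral_const, sub_zero, Complex.real_smul]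
  rw [hint]
  have := intervalIntegral.norm_integral_le_of_norm_le_const (a := 0) (b := T) (C := K * T)
    (f := fun s => traceFun N (heisenberg H s J * Q) - traceFun N (J * Q)) fun s hs => by
      rw [Set.uIoc_of_le hT] at hs
      exact (hdiff s ⟨hs.1.le, hs.2⟩).trans (mul_le_mul_of_nonneg_left hs.2 hK0)
  rwa [sub_zero, abs_of_nonneg hT] at this

/-- The trace of `b^* b` is the sum of the squared moduli of the entries of `b`. -/
theorem traceFun_star_place_mul_self_pos {b : LocalMatrix N db} (hb : b ≠ 0) (x : ℤ) :
    0 < (traceFun N (star (place x b) * place x b)).re := by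
  rw [star_place, ← place_mul, traceFun_eq (place_mem _ _), tracialState_place]
  have hN : (0 : ℝ) < N := by exact_mod_cast Nat.pos_of_ne_zero (NeZero.ne N)
  have h1 : ((b.conjTranspose * b).trace) = ((∑ v, ∑ w, ‖b w v‖ ^ 2 : ℝ) : ℂ) := by
    simp only [Matrix.trace, Matrix.diag_apply, Matrix.mul_apply, Matrix.conjTranspose_apply]
    push_cast
    refine Finset.sum_congr rfl fun v _ => Finset.sum_congr rfl fun w _ => ?_
    exact Complex.conj_mul' (b w v)
  have h2 : 0 < ∑ v, ∑ w, ‖b w v‖ ^ 2 := by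
    obtain ⟨w, v, hwv⟩ : ∃ w v, b w v ≠ 0 := by
      by_contra hc
      push Not at hc
      exact hb (Matrix.ext hc)
    refine Finset.sum_pos' (fun v _ => Finset.sum_nonneg fun w _ => by positivity)
      ⟨v, Finset.mem_univ _, Finset.sum_pos' (fun w _ => by positivity)
        ⟨w, Finset.mem_univ _, by positivity⟩⟩
  have h3 : ((N : ℂ) ^ db)⁻¹ = ((((N : ℝ) ^ db)⁻¹ : ℝ) : ℂ) := by push_cast; rfl
  rw [h1, h3, ← Complex.ofReal_mul, Complex.ofReal_re]
  positivity

/-- If the boundary term of an almost conserved charge does not vanish, the charge cannot be small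
in Hilbert–Schmidt norm. -/
theorem exists_hsNorm_lower_bound {b : LocalMatrix N db} (hb : b ≠ 0)
    (hb0 : tracialState (place 0 b) = 0) {Q : ℕ → Op N} (hQ : ∀ n, Q n ∈ quasiLocalAlgebra N)
    (hcomm : ∀ n : ℕ, db ≤ n → homogeneousSum h 1 n * Q n - Q n * homogeneousSum h 1 n =
      place 1 b - place ((n : ℤ) - db + 1) b) :
    ∃ c > 0, ∀ n, 2 * db ≤ n → c ≤ hsNorm (Q n) := by
  set γ := (traceFun N (star (place 1 b) * place 1 b)).re with hγ
  have hγ0 : 0 < γ := traceFun_star_place_mul_self_pos hb 1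
  set K : ℝ := 2 * (db * ‖place 0 h‖) * ‖place 0 b.conjTranspose‖ with hK
  have hK0 : 0 ≤ K := by positivity
  -- The argument gives `γ ≤ K * hsNorm (Q n)`; `K + 1` avoids division by zero.
  refine ⟨γ / (K + 1), by positivity, fun n hn => ?_⟩
  have hB : star (place 1 b) ∈ quasiLocalAlgebra N := star_mem (place_mem 1 b)
  have hH := homogeneousSum_mem h 1 (n : ℤ)
  -- Pairing with `b_1^*` isolates the left end: the two boundary windows are disjoint once `2 * db
  -- ≤ n`, and `b` is traceless. Cyclicity then moves the commutator from `Q n` onto `b_1^*`, where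
  -- its norm is bounded uniformly in `n`.
  have h1 : traceFun N (star (place 1 b) * (homogeneousSum h 1 n * Q n -
      Q n * homogeneousSum h 1 n)) = traceFun N (star (place 1 b) * place 1 b) := by
    have hdisj : DisjointWindows 1 db ((n : ℤ) - db + 1) db := by left; omega
    rw [hcomm n (by omega), mul_sub, map_sub, star_place,
      traceFun_eq (mul_mem (place_mem 1 _) (place_mem ((n : ℤ) - db + 1) b)),
      tracialState_mul_place_of_disjoint hdisj, tracialState_place ((n : ℤ) - db + 1),
      ← tracialState_place 0, hb0, mul_zero, sub_zero]
  have h2 := traceFun_commutator_mul hH hB (hQ n)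
  rw [h1] at h2
  have h3 : γ ≤ K * hsNorm (Q n) := by
    calc γ ≤ ‖traceFun N (star (place 1 b) * place 1 b)‖ := Complex.re_le_norm _
      _ = ‖traceFun N ((homogeneousSum h 1 n * star (place 1 b) -
            star (place 1 b) * homogeneousSum h 1 n) * Q n)‖ := by rw [h2, norm_neg]
      _ ≤ hsNorm (homogeneousSum h 1 n * star (place 1 b) -
            star (place 1 b) * homogeneousSum h 1 n) * hsNorm (Q n) :=
          norm_traceFun_mul_le (sub_mem (mul_mem hH hB) (mul_mem hB hH)) (hQ n)
      _ ≤ K * hsNorm (Q n) := by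
          refine mul_le_mul_of_nonneg_right ?_ (hsNorm_nonneg _)
          refine (hsNorm_le _).trans ?_
          rw [star_place]
          exact norm_commutator_hamiltonian_place_le h _ n
  rw [div_le_iff₀ (by positivity)]
  linarith [hsNorm_nonneg (Q n)]

/-- Only a difference of two translates of `b` enters, so a multiple of the identity may be
subtracted from `b`. -/
theorem exists_traceless_boundary {Q : ℕ → Op N} (hQ : IsAlmostConserved h Q) :
    ∃ (db : ℕ) (b : LocalMatrix N db), tracialState (place 0 b) = 0 ∧ ∀ n : ℕ, db ≤ n →
      homogeneousSum h 1 n * Q n - Q n * homogeneousSum h 1 n =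
        place 1 b - place ((n : ℤ) - db + 1) b := by
  obtain ⟨db, b, hb⟩ := hQ
  set c := tracialState (place 0 b) with hc
  have hpl (x : ℤ) : place x (b - c • 1) = place x b - c • 1 := by
    rw [place_sub, place_smul, place_one]
  refine ⟨db, b - c • 1, ?_, fun n hn => ?_⟩
  · rw [← traceFun_eq (place_mem _ _), hpl, map_sub, map_smul, traceFun_eq (place_mem _ _), ← hc,
      traceFun_eq (one_mem _), ← place_one (N := N) (d := 0) 0, tracialState_place]
    simp
  · rw [hb n hn, hpl, hpl]
    abel

/-- The finite-volume Mazur inequality. -/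
theorem exists_mazur_bound (hh : h.IsHermitian) (j : LocalMatrix N dj) {Q : ℕ → Op N}
    (hQm : ∀ n, Q n ∈ quasiLocalAlgebra N) (hQ : IsAlmostConserved h Q) {T : ℝ}
    (hT : 0 ≤ T) :
    ∃ K, ∀ᶠ n : ℕ in atTop, T * ‖traceFun N (homogeneousSum j 1 n * Q n)‖ ≤
      (hsNorm (timeIntegral (homogeneousSum h 1 n) (homogeneousSum j 1 n) T) + K) *
        hsNorm (Q n) := by
  obtain ⟨db, b, hb0, hcomm⟩ := exists_traceless_boundary hQ
  have hmain (n : ℕ) (K : ℝ) (hK : ∀ u, |u| ≤ T →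
      ‖traceFun N (heisenberg (homogeneousSum h 1 n) u (homogeneousSum j 1 n) *
        (homogeneousSum h 1 n * Q n - Q n * homogeneousSum h 1 n))‖ ≤ K) :
      T * ‖traceFun N (homogeneousSum j 1 n * Q n)‖ ≤
        hsNorm (timeIntegral (homogeneousSum h 1 n) (homogeneousSum j 1 n) T) * hsNorm (Q n) +
          K * T * T := by
    have hH := homogeneousSum_mem h 1 (n : ℤ)
    have hJ := homogeneousSum_mem j 1 (n : ℤ)
    have h1 := norm_traceFun_timeIntegral_mul_sub_le hH hJ (hQm n) hT hK
    have h2 := norm_traceFun_mul_le (timeIntegral_mem isClosed_quasiLocalAlgebra hH hJ T) (hQm n)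
    have h3 := norm_sub_norm_le ((T : ℂ) * traceFun N (homogeneousSum j 1 n * Q n))
      (traceFun N (timeIntegral (homogeneousSum h 1 n) (homogeneousSum j 1 n) T * Q n))
    rw [norm_sub_rev, norm_mul, Complex.norm_of_nonneg hT] at h3
    linarith
  -- With `b = 0` there is no error term, and `Q n` may be arbitrarily small. Otherwise the lower
  -- bound on `hsNorm (Q n)` lets the bounded error be absorbed as a multiple of that norm.
  by_cases hb : b = 0
  · refine ⟨0, ?_⟩
    filter_upwards [eventually_ge_atTop db] with n hn
    have := hmain n 0 fun u _ => by
      rw [hcomm n hn, hb, place_zero, place_zero, sub_zero, mul_zero, map_zero, norm_zero]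
    simpa using this
  · obtain ⟨c, hc, hcQ⟩ := exists_hsNorm_lower_bound hb hb0 hQm hcomm
    set K₁ := ‖place 0 b‖ * lrConst h j T * Real.exp (dj + db + 3 * (dh + 1)) *
      ∑' z : ℤ, Real.exp (-(|z| : ℤ)) with hK₁
    have hK₁0 : 0 ≤ K₁ := by
      have := lrConst_nonneg h j T
      have : 0 ≤ ∑' z : ℤ, Real.exp (-(|z| : ℤ)) := tsum_nonneg fun _ => Real.exp_nonneg _
      positivity
    refine ⟨2 * K₁ * T * T / c, ?_⟩
    filter_upwards [eventually_ge_atTop (2 * db)] with n hn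
    have h1 := hmain n (2 * K₁) fun u hu => by
      rw [hcomm n (by omega), mul_sub, map_sub]
      refine (norm_sub_le _ _).trans ?_
      rw [two_mul]
      exact add_le_add (norm_traceFun_heisenberg_current_mul_le hh j hb0 hu n _)
        (norm_traceFun_heisenberg_current_mul_le hh j hb0 hu n _)
    have h2 : 2 * K₁ * T * T ≤ 2 * K₁ * T * T / c * hsNorm (Q n) := by
      rw [div_mul_eq_mul_div, le_div_iff₀ hc]
      exact mul_le_mul_of_nonneg_left (hcQ n hn) (by positivity)
    rw [add_mul]
    linarith

theorem mazurRatio_eq {Q : ℕ → Op N} (hQm : ∀ n, Q n ∈ quasiLocalAlgebra N)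
    (hQsa : ∀ n, IsSelfAdjoint (Q n)) (n : ℕ) :
    mazurRatio j Q n = 1 / n * ((traceFun N (homogeneousSum j 1 n * Q n)).re ^ 2 /
      hsNorm (Q n) ^ 2) := by
  rw [mazurRatio, hsNorm_sq (hQm n), (hQsa n).star_eq,
    traceFun_eq (mul_mem (homogeneousSum_mem j 1 n) (hQm n)), traceFun_eq (mul_mem (hQm n) (hQm n))]

theorem mazurRatio_nonneg {Q : ℕ → Op N} (hQm : ∀ n, Q n ∈ quasiLocalAlgebra N)
    (hQsa : ∀ n, IsSelfAdjoint (Q n)) (n : ℕ) : 0 ≤ mazurRatio j Q n := by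
  rw [mazurRatio_eq hQm hQsa]
  positivity

/-- Cauchy–Schwarz for the current and the charge at time zero. A charge of zero norm gives ratio
`0` by the convention for division. -/
theorem mazurRatio_le_siteCorr (h : LocalMatrix N dh) (hj : j.IsHermitian) {Q : ℕ → Op N}
    (hQm : ∀ n, Q n ∈ quasiLocalAlgebra N) (hQsa : ∀ n, IsSelfAdjoint (Q n)) (n : ℕ) :
    mazurRatio j Q n ≤ siteCorr h j n 0 := by
  have hJ := homogeneousSum_mem j 1 (n : ℤ)
  have hJsa := isSelfAdjoint_homogeneousSum hj 1 (n : ℤ)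
  rw [mazurRatio_eq hQm hQsa, siteCorr, autocorr, heisenberg_zero_time]
  gcongr
  have h1 := (Complex.abs_re_le_norm _).trans (norm_traceFun_mul_le hJ (hQm n))
  have h2 := hsNorm_sq hJ
  rw [hJsa.star_eq] at h2
  rw [← h2]
  refine div_le_of_le_mul₀ (sq_nonneg _) (sq_nonneg _) ?_
  rw [← mul_pow, ← sq_abs (Complex.re _)]
  gcongr

theorem sq_mul_mazurRatio_le {Q : ℕ → Op N} (hQm : ∀ n, Q n ∈ quasiLocalAlgebra N)
    (hQsa : ∀ n, IsSelfAdjoint (Q n)) {n : ℕ} {T X K : ℝ} (hT : 0 ≤ T)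
    (hle : T * ‖traceFun N (homogeneousSum j 1 n * Q n)‖ ≤ (X + K) * hsNorm (Q n)) :
    T ^ 2 * mazurRatio j Q n ≤ (X / √n + K / √n) ^ 2 := by
  rw [mazurRatio_eq hQm hQsa, ← add_div, div_pow, Real.sq_sqrt (Nat.cast_nonneg n)]
  have h1 : (T * (traceFun N (homogeneousSum j 1 n * Q n)).re) ^ 2 ≤
      (X + K) ^ 2 * hsNorm (Q n) ^ 2 := by
    rw [← mul_pow, ← sq_abs (T * _), abs_mul, abs_of_nonneg hT]
    refine pow_le_pow_left₀ (by positivity) (le_trans ?_ hle) 2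
    gcongr
    exact Complex.abs_re_le_norm _
  have h2 : T ^ 2 * ((traceFun N (homogeneousSum j 1 n * Q n)).re ^ 2 / hsNorm (Q n) ^ 2) ≤
      (X + K) ^ 2 := by
    rw [← mul_div_assoc, ← mul_pow]
    exact div_le_of_le_mul₀ (sq_nonneg _) (sq_nonneg _) h1
  calc _ = 1 / n * (T ^ 2 * ((traceFun N (homogeneousSum j 1 n * Q n)).re ^ 2 /
        hsNorm (Q n) ^ 2)) := by ring
    _ ≤ 1 / n * (X + K) ^ 2 := by gcongr
    _ = _ := by ring

theorem bddAbove_mazurRatio (hh : h.IsHermitian) (hj : j.IsHermitian)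
    (hj0 : tracialState (place 0 j) = 0) {Q : ℕ → Op N} (hQm : ∀ n, Q n ∈ quasiLocalAlgebra N)
    (hQsa : ∀ n, IsSelfAdjoint (Q n)) : BddAbove (Set.range (mazurRatio j Q)) := by
  obtain ⟨K, hK⟩ := exists_siteCorr_bound hh hj hj0
  refine ⟨K, ?_⟩
  rintro _ ⟨n, rfl⟩
  exact (mazurRatio_le_siteCorr h hj hQm hQsa n).trans ((le_abs_self _).trans (hK n 0))

/-- Here `T` is fixed while `n → ∞`: the constant of the finite-volume inequality depends on `T` but
not on `n`, and dies after division by `√n`. -/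
theorem limsup_mazurRatio_le (hh : h.IsHermitian) (hj : j.IsHermitian)
    (hj0 : tracialState (place 0 j) = 0) {Q : ℕ → Op N} (hQm : ∀ n, Q n ∈ quasiLocalAlgebra N)
    (hQsa : ∀ n, IsSelfAdjoint (Q n)) (hQ : IsAlmostConserved h Q) {T : ℝ} (hT : 0 < T) :
    limsup (mazurRatio j Q) atTop ≤
      squareIntegral (fun t => (currentCorr h j t).re) T / T ^ 2 := by
  obtain ⟨K, hK⟩ := exists_mazur_bound hh j hQm hQ hT.le
  have hcob : IsCoboundedUnder (· ≤ ·) atTop (mazurRatio j Q) :=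
    (isBoundedUnder_of ⟨0, fun n => mazurRatio_nonneg hQm hQsa n⟩ :
      IsBoundedUnder (· ≥ ·) atTop (mazurRatio j Q)).isCoboundedUnder_le
  have hKlim : Tendsto (fun n : ℕ => K / √(n : ℝ)) atTop (𝓝 0) :=
    tendsto_const_nhds.div_atTop (Real.tendsto_sqrt_atTop.comp tendsto_natCast_atTop_atTop)
  have hlim := (((tendsto_hsNorm_timeIntegral hh hj hj0 T).add hKlim).pow 2).div_const (T ^ 2)
  have hpos : 0 ≤ squareIntegral (fun t => (currentCorr h j t).re) T := by
    refine ge_of_tendsto (tendsto_squareIntegral hh hj hj0 T) (Eventually.of_forall fun n => ?_)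
    exact squareIntegral_siteCorr_nonneg hh hj n T
  rw [add_zero, Real.sq_sqrt hpos] at hlim
  rw [← hlim.limsup_eq]
  refine limsup_le_limsup ?_ hcob hlim.isBoundedUnder_le
  filter_upwards [hK] with n hn
  rw [le_div_iff₀ (by positivity), mul_comm]
  exact sq_mul_mazurRatio_le hQm hQsa hT.le hn

end Mazur

/-! ### Limits per site for pseudo-local charges. -/

section PseudoLocal

variable {N d d' dj : ℕ} [NeZero N]

theorem summable_exp_neg_mul_nat {δ : ℝ} (hδ : 0 < δ) :
    Summable fun n : ℕ => Real.exp (-(δ * n)) := by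
  have h := summable_geometric_of_lt_one (Real.exp_nonneg (-δ))
    (by rw [← Real.exp_zero]; exact Real.exp_lt_exp.2 (by linarith))
  refine h.congr fun n => ?_
  rw [← Real.exp_nat_mul]
  ring_nf

theorem summable_exp_neg_mul_abs {δ : ℝ} (hδ : 0 < δ) :
    Summable fun z : ℤ => Real.exp (-(δ * (|z| : ℤ))) := by
  refine Summable.of_nat_of_neg ?_ ?_ <;> simpa using summable_exp_neg_mul_nat hδ

theorem hsNorm_place (x : ℤ) (M : LocalMatrix N d) : hsNorm (place x M) = hsNorm (place 0 M) := by
  have h := traceFun_place_mul_place_add M M.conjTranspose 0 0 x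
  rw [zero_add] at h
  rw [hsNorm, hsNorm, star_place, star_place, h]

/-- Disjoint windows give zero. Overlapping ones have `|x - y| ≤ d + d'`, so Cauchy–Schwarz in
Hilbert–Schmidt norm is enough once the factor `exp (δ (d + d'))` is allowed. -/
theorem norm_traceFun_place_mul_place_le {M : LocalMatrix N d}
    (hM0 : tracialState (place 0 M) = 0) (M' : LocalMatrix N d') {δ : ℝ} (hδ : 0 ≤ δ) (x y : ℤ) :
    ‖traceFun N (place x M * place y M')‖ ≤
      hsNorm (place 0 M) * hsNorm (place 0 M') * Real.exp (δ * (d + d')) *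
        Real.exp (-(δ * (|x - y| : ℤ))) := by
  have h0 : 0 ≤ hsNorm (place 0 M) * hsNorm (place 0 M') :=
    mul_nonneg (hsNorm_nonneg _) (hsNorm_nonneg _)
  by_cases hxy : DisjointWindows x d y d'
  · rw [traceFun_eq (mul_mem (place_mem _ _) (place_mem _ _)),
      tracialState_mul_place_of_disjoint hxy, tracialState_place, ← tracialState_place 0, hM0,
      zero_mul, norm_zero]
    positivity
  · have h1 := norm_traceFun_mul_le (place_mem x M) (place_mem y M')
    rw [hsNorm_place x, hsNorm_place y] at h1
    refine h1.trans ?_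
    rw [mul_assoc _ (Real.exp _), ← Real.exp_add]
    refine le_mul_of_one_le_right h0 (Real.one_le_exp ?_)
    have h2 : |x - y| ≤ (d : ℤ) + d' := by
      unfold DisjointWindows at hxy
      push Not at hxy
      rw [abs_le]
      constructor <;> omega
    have h3 : ((|x - y| : ℤ) : ℝ) ≤ d + d' := by exact_mod_cast h2
    have := mul_le_mul_of_nonneg_left h3 hδ
    linarith

/-- Traceless densities with exponentially decaying Hilbert–Schmidt norms. -/
structure IsDensity (q : ∀ d : ℕ, LocalMatrix N d) (ζ ξ : ℝ) : Prop where
  trace_zero : ∀ d, tracialState (place 0 (q d)) = 0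
  hsNorm_le : ∀ d, hsNorm (place 0 (q d)) ≤ √ζ * Real.exp (-(ξ / 2 * d))

theorem IsPseudoLocal.exists_density {Q : ℕ → Op N} (hQ : IsPseudoLocal Q) :
    ∃ (q : ∀ d : ℕ, LocalMatrix N d) (ζ ξ : ℝ), 0 < ξ ∧ IsDensity q ζ ξ ∧
      ∀ n : ℕ, Q n = ∑ d ∈ Finset.range (n + 1), homogeneousSum (q d) 1 n := by
  obtain ⟨q, ζ, ξ, hζ, hξ, hq, hQq⟩ := hQ
  -- The hypotheses say nothing about `q 0`, which the charge does not contain; setting it to zero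
  -- makes the estimates hold for every `d`.
  let q' : ∀ d : ℕ, LocalMatrix N d := fun d => if d = 0 then 0 else q d
  have hq'0 : q' 0 = 0 := if_pos rfl
  have hq' {d : ℕ} (hd : d ≠ 0) : q' d = q d := if_neg hd
  refine ⟨q', ζ, ξ, hξ, ⟨fun d => ?_, fun d => ?_⟩, fun n => ?_⟩
  · rcases eq_or_ne d 0 with rfl | hd
    · rw [hq'0, tracialState_place]
      simp
    · rw [hq' hd]
      exact (hq d (Nat.one_le_iff_ne_zero.2 hd)).2.1
  · rcases eq_or_ne d 0 with rfl | hd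
    · rw [hq'0, place_zero, hsNorm]
      simp
    · rw [hq' hd]
      obtain ⟨h1, -, h3⟩ := hq d (Nat.one_le_iff_ne_zero.2 hd)
      rw [hsNorm, (isSelfAdjoint_place 0 h1).star_eq,
        traceFun_eq (mul_mem (place_mem _ _) (place_mem _ _))]
      refine (Real.sqrt_le_sqrt h3).trans (le_of_eq ?_)
      rw [Real.sqrt_mul hζ.le, ← Real.exp_half]
      ring_nf
  · rw [hQq n, Finset.range_eq_Ico, Finset.sum_eq_sum_Ico_succ_bot (Nat.succ_pos n)]
    have : homogeneousSum (q' 0) 1 (n : ℤ) = 0 :=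
      Finset.sum_eq_zero fun x _ => by rw [hq'0, place_zero]
    rw [this, zero_add]
    refine Finset.sum_congr rfl fun d hd => ?_
    have hd := (Finset.mem_Ico.1 hd).1
    rw [hq' (by omega)]

variable {q : ∀ d : ℕ, LocalMatrix N d} {ζ ξ : ℝ}

/-- The pair average runs over the density size `d` too. Norms decay like `exp (-ξ d / 2)`, so the
spatial rate `ξ / 4` costs only `exp (ξ d / 4)` and leaves a summable majorant in `d` and `x - y`.
-/
theorem exists_tendsto_charge_overlap {j : LocalMatrix N dj} (hj0 : tracialState (place 0 j) = 0)
    (hξ : 0 < ξ) (hq : IsDensity q ζ ξ) {Q : ℕ → Op N}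
    (hQ : ∀ n : ℕ, Q n = ∑ d ∈ Finset.range (n + 1), homogeneousSum (q d) 1 n) :
    ∃ z : ℂ, Tendsto (fun n : ℕ => 1 / (n : ℂ) * traceFun N (homogeneousSum j 1 n * Q n)) atTop
      (𝓝 z) := by
  set K := hsNorm (place 0 j) * √ζ * Real.exp (ξ / 4 * dj) with hK
  have hsum : Summable fun p : ℕ × ℤ =>
      K * (Real.exp (-(ξ / 4 * p.1)) * Real.exp (-(ξ / 4 * (|p.2| : ℤ)))) :=
    ((summable_exp_neg_mul_nat (by positivity)).mul_of_nonneg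
      (summable_exp_neg_mul_abs (by positivity)) (fun _ => Real.exp_nonneg _)
      (fun _ => Real.exp_nonneg _)).mul_left K
  have hlim := tendsto_pair_average (ℓ := fun _ : ℕ => dj) (ℓ' := fun d : ℕ => d)
    (s := fun n => Finset.range (n + 1)) (fun n d hd => Or.inr (by simpa using hd))
    (c := fun _ d x y => traceFun N (place x j * place y (q d)))
    (c' := fun p => traceFun N (place p.2 j * place 0 (q p.1))) hsum
    (fun _ d x y => by
      refine (norm_traceFun_place_mul_place_le hj0 (q d)
        (by positivity : (0 : ℝ) ≤ ξ / 4) x y).trans ?_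
      have h1 := hq.hsNorm_le d
      have h0 := hsNorm_nonneg (place 0 j)
      calc _ ≤ hsNorm (place 0 j) * (√ζ * Real.exp (-(ξ / 2 * d))) *
            Real.exp (ξ / 4 * (dj + d)) * Real.exp (-(ξ / 4 * (|x - y| : ℤ))) := by gcongr
        _ = K * ((Real.exp (-(ξ / 2 * d)) * Real.exp (ξ / 4 * d)) *
            Real.exp (-(ξ / 4 * (|x - y| : ℤ)))) := by
          rw [hK, mul_add, Real.exp_add]
          ring
        _ = _ := by
          rw [← Real.exp_add]
          ring_nf)
    (fun p ε hε => ⟨0, fun n y _ _ => by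
      have := traceFun_place_mul_place_add (q p.1) j p.2 0 y
      rw [zero_add, add_comm p.2 y] at this
      rw [this, sub_self, norm_zero]
      exact hε.le⟩)
  refine ⟨_, hlim.congr fun n => ?_⟩
  rw [hQ n, Finset.mul_sum _ _ (homogeneousSum j 1 n), map_sum]
  simp only [homogeneousSum, Finset.sum_mul_sum, map_sum]

/-- The same majorant works with pairs of density sizes as index, each size keeping a factor `exp
(-ξ d / 4)`. -/
theorem exists_tendsto_charge_norm (hξ : 0 < ξ) (hq : IsDensity q ζ ξ) {Q : ℕ → Op N}
    (hQ : ∀ n : ℕ, Q n = ∑ d ∈ Finset.range (n + 1), homogeneousSum (q d) 1 n) :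
    ∃ z : ℂ, Tendsto (fun n : ℕ => 1 / (n : ℂ) * traceFun N (Q n * Q n)) atTop (𝓝 z) := by
  have hs := summable_exp_neg_mul_nat (by positivity : 0 < ξ / 4)
  have hsum : Summable fun p : (ℕ × ℕ) × ℤ =>
      √ζ * √ζ * ((Real.exp (-(ξ / 4 * p.1.1)) * Real.exp (-(ξ / 4 * p.1.2))) *
        Real.exp (-(ξ / 4 * (|p.2| : ℤ)))) :=
    ((hs.mul_of_nonneg hs (fun _ => Real.exp_nonneg _) (fun _ => Real.exp_nonneg _)).mul_of_nonneg
      (summable_exp_neg_mul_abs (by positivity)) (fun _ => by positivity)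
      (fun _ => Real.exp_nonneg _)).mul_left _
  have hlim := tendsto_pair_average (ℓ := fun i : ℕ × ℕ => i.1) (ℓ' := fun i : ℕ × ℕ => i.2)
    (s := fun n => Finset.range (n + 1) ×ˢ Finset.range (n + 1))
    (fun n i hi => by
      simp only [Finset.mem_product, Finset.mem_range] at hi
      omega)
    (c := fun _ i x y => traceFun N (place x (q i.1) * place y (q i.2)))
    (c' := fun p => traceFun N (place p.2 (q p.1.1) * place 0 (q p.1.2))) hsum
    (fun _ i x y => by
      refine (norm_traceFun_place_mul_place_le (hq.trace_zero i.1) (q i.2)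
        (by positivity : (0 : ℝ) ≤ ξ / 4) x y).trans ?_
      have h1 := hq.hsNorm_le i.1
      have h2 := hq.hsNorm_le i.2
      have h0 := hsNorm_nonneg (place 0 (q i.2))
      calc _ ≤ (√ζ * Real.exp (-(ξ / 2 * i.1))) * (√ζ * Real.exp (-(ξ / 2 * i.2))) *
            Real.exp (ξ / 4 * (i.1 + i.2)) * Real.exp (-(ξ / 4 * (|x - y| : ℤ))) := by gcongr
        _ = √ζ * √ζ * ((Real.exp (-(ξ / 2 * i.1)) * Real.exp (ξ / 4 * i.1)) *
            (Real.exp (-(ξ / 2 * i.2)) * Real.exp (ξ / 4 * i.2)) *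
            Real.exp (-(ξ / 4 * (|x - y| : ℤ)))) := by
          rw [mul_add (ξ / 4), Real.exp_add]
          ring
        _ = _ := by
          rw [← Real.exp_add, ← Real.exp_add]
          ring_nf)
    (fun p ε hε => ⟨0, fun n y _ _ => by
      have := traceFun_place_mul_place_add (q p.1.2) (q p.1.1) p.2 0 y
      rw [zero_add, add_comm p.2 y] at this
      rw [this, sub_self, norm_zero]
      exact hε.le⟩)
  refine ⟨_, hlim.congr fun n => ?_⟩
  rw [hQ n]
  simp only [homogeneousSum, Finset.sum_mul_sum, map_sum, Finset.sum_product]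

theorem traceFun_mul_im_eq_zero {A B : Op N} (hA : A ∈ quasiLocalAlgebra N)
    (hB : B ∈ quasiLocalAlgebra N) (hAsa : IsSelfAdjoint A) (hBsa : IsSelfAdjoint B) :
    (traceFun N (A * B)).im = 0 := by
  have h := traceFun_star (mul_mem hA hB)
  rw [star_mul, hAsa.star_eq, hBsa.star_eq, traceFun_mul_comm hB hA] at h
  exact Complex.conj_eq_iff_im.1 h.symm

/-- For a pseudo-local charge, overlap and norm per site converge. -/
theorem exists_pseudoLocal_limits {j : LocalMatrix N dj} (hj : j.IsHermitian)
    (hj0 : tracialState (place 0 j) = 0) {Q : ℕ → Op N} (hQm : ∀ n, Q n ∈ quasiLocalAlgebra N)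
    (hQsa : ∀ n, IsSelfAdjoint (Q n)) (hQ : IsPseudoLocal Q) :
    ∃ r χ : ℝ,
      Tendsto (fun n : ℕ => 1 / (n : ℂ) * tracialState (homogeneousSum j 1 n * Q n)) atTop
        (𝓝 (r : ℂ)) ∧
      Tendsto (fun n : ℕ => 1 / (n : ℂ) * tracialState (Q n * Q n)) atTop (𝓝 (χ : ℂ)) ∧
      (χ ≠ 0 → Tendsto (mazurRatio j Q) atTop (𝓝 (r ^ 2 / χ))) := by
  obtain ⟨q, ζ, ξ, hξ, hq, hQq⟩ := hQ.exists_density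
  have hJ (n : ℕ) := homogeneousSum_mem j 1 (n : ℤ)
  obtain ⟨z, hz⟩ := exists_tendsto_charge_overlap hj0 hξ hq hQq
  obtain ⟨w, hw⟩ := exists_tendsto_charge_norm hξ hq hQq
  have hre (n : ℕ) (u : ℂ) : (1 / (n : ℂ) * u).re = 1 / n * u.re := by
    rw [← Complex.re_ofReal_mul]
    push_cast
    rfl
  have him (n : ℕ) (u : ℂ) (hu : u.im = 0) : (1 / (n : ℂ) * u).im = 0 := by
    have : (1 / (n : ℂ) * u).im = (((1 / n : ℝ) : ℂ) * u).im := by push_cast; rfl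
    rw [this, Complex.im_ofReal_mul, hu, mul_zero]
  have hzr := tendsto_ofReal_re (fun n => him n _ (traceFun_mul_im_eq_zero (hJ n) (hQm n)
    (isSelfAdjoint_homogeneousSum hj 1 n) (hQsa n))) hz
  have hwr := tendsto_ofReal_re (fun n => him n _ (traceFun_mul_im_eq_zero (hQm n) (hQm n)
    (hQsa n) (hQsa n))) hw
  simp only [fun n => traceFun_eq (mul_mem (hJ n) (hQm n)),
    fun n => traceFun_eq (mul_mem (hQm n) (hQm n))] at hz hw
  refine ⟨z.re, w.re, by rwa [hzr], by rwa [hwr], fun hχ => ?_⟩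
  have hz' := (Complex.continuous_re.tendsto z).comp hz
  have hw' := (Complex.continuous_re.tendsto w).comp hw
  refine ((hz'.pow 2).div hw' hχ).congr' ?_
  filter_upwards [eventually_gt_atTop 0] with n hn
  have hn' : (n : ℝ) ≠ 0 := by exact_mod_cast hn.ne'
  simp only [Function.comp_apply, hre, mazurRatio, Pi.div_apply]
  rw [mul_pow, mul_div_mul_comm, sq (1 / (n : ℝ)), mul_div_cancel_right₀]
  exact one_div_ne_zero hn'

end PseudoLocal

end SpinChain
end

/-! ### Assembly of the theorem. -/

theorem mainTheorem7 (N : ℕ) [NeZero N] (dh dj : ℕ)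
    (h : LocalMatrix N dh) (hh : h.IsHermitian)
    (j : LocalMatrix N dj) (hj : j.IsHermitian) (hj0 : tracialState (place 0 j) = 0)
    (Q : ℕ → Op N) (hQloc : ∀ n, Q n ∈ localAlgebra N 1 n) (hQsa : ∀ n, IsSelfAdjoint (Q n))
    (hQ : IsAlmostConserved h Q) (β : ℝ) (hβ : 0 ≤ β) :
    -- the infinite-volume dynamics exists on the quasi-local algebra
    (∀ t : ℝ, ∀ A ∈ quasiLocalAlgebra N,
      Tendsto (fun p : ℤ × ℤ => finiteEvolution h p.1 p.2 t A) (atBot ×ˢ atTop)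
        (𝓝 (evolution h t A)) ∧ evolution h t A ∈ quasiLocalAlgebra N) ∧
    ∃ (C : ℝ → ℝ) (D : ℝ),
      -- the current autocorrelation per site in the thermodynamic limit, at each fixed time
      (∀ t : ℝ, Tendsto
        (fun n : ℕ => 1 / (n : ℂ) *
          tracialState (homogeneousSum j 1 n * evolution h t (homogeneousSum j 1 n)))
        atTop (𝓝 (C t : ℂ))) ∧
      (∀ t : ℝ, HasSum (fun x : ℤ => tracialState (place x j * evolution h t (place 0 j)))
        (C t : ℂ)) ∧
      Continuous C ∧
      -- the Drude weight: the time limit is taken afterwards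
      Tendsto (fun t : ℝ => β / (2 * t) * ∫ s in (0 : ℝ)..t, C s) atTop (𝓝 D) ∧
      -- the Mazur bound
      BddAbove (Set.range (mazurRatio j Q)) ∧
      β / 2 * limsup (mazurRatio j Q) atTop ≤ D ∧
      -- for a pseudo-local extensive charge the limits exist
      (IsPseudoLocal Q → ∃ r χ : ℝ,
        Tendsto (fun n : ℕ => 1 / (n : ℂ) * tracialState (homogeneousSum j 1 n * Q n))
          atTop (𝓝 (r : ℂ)) ∧
        Tendsto (fun n : ℕ => 1 / (n : ℂ) * tracialState (Q n * Q n)) atTop (𝓝 (χ : ℂ)) ∧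
        (χ ≠ 0 → Tendsto (mazurRatio j Q) atTop (𝓝 (r ^ 2 / χ)) ∧
          β / 2 * (r ^ 2 / χ) ≤ D)) := by
  have hQm (n : ℕ) : Q n ∈ quasiLocalAlgebra N := by
    obtain ⟨M, hM⟩ := hQloc n
    exact hM ▸ place_mem 1 M
  have hJ (n : ℕ) := homogeneousSum_mem j 1 (n : ℤ)
  obtain ⟨D, hDsq, hD⟩ := exists_drude hh hj hj0
  -- The limsup over volumes is already bounded for each `T > 0`; only now does `T → ∞`.
  have hlimsup : limsup (mazurRatio j Q) atTop ≤ D := by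
    refine ge_of_tendsto hDsq ?_
    filter_upwards [eventually_gt_atTop 0] with T hT
    exact limsup_mazurRatio_le hh hj hj0 hQm hQsa hQ hT
  have hbound : β / 2 * limsup (mazurRatio j Q) atTop ≤ β / 2 * D :=
    mul_le_mul_of_nonneg_left hlimsup (by positivity)
  refine ⟨fun t A hA => ⟨tendsto_finiteEvolution hh t hA, evolution_mem hh t hA⟩,
    fun t => (currentCorr h j t).re, β / 2 * D, fun t => ?_, fun t => ?_,
    Complex.continuous_re.comp (continuous_currentCorr hh hj0), ?_,
    bddAbove_mazurRatio hh hj hj0 hQm hQsa, hbound, fun hloc => ?_⟩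
  · rw [ofReal_currentCorr_re hh hj hj0]
    refine (tendsto_infinite_autocorr hh hj0 t).congr fun n => ?_
    rw [traceFun_eq (mul_mem (hJ n) (evolution_mem hh t (hJ n)))]
  · rw [ofReal_currentCorr_re hh hj hj0]
    refine (hasSum_currentCorr hh hj0 t).congr_fun fun x => ?_
    rw [traceFun_eq (mul_mem (place_mem _ _) (evolution_mem hh t (place_mem _ _)))]
  · refine (hD.const_mul (β / 2)).congr fun t => ?_
    rw [primitive]
    ring
  · obtain ⟨r, χ, hr, hχ, hratio⟩ := exists_pseudoLocal_limits hj hj0 hQm hQsa hloc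
    refine ⟨r, χ, hr, hχ, fun hχ0 => ⟨hratio hχ0, ?_⟩⟩
    rwa [(hratio hχ0).limsup_eq] at hbound
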